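/- **Theorem.** Let $n>2$ be an integer, $j\ge 0$ an integer and $\mu$ a real number with $0<\mu<\frac{n-1}{2}$ and $\mu+j<\frac{n-2}{2}$. Let $H=SO_0(n,1)$ be the identity component of the group of real matrices of determinant one preserving the form $x_1^2+\dots+x_n^2-x_{n+1}^2$, and let $H_1=SO_0(n-1,1)$, embedded in $H$ so as to fix the $n$-th coordinate vector. For $N\ge 1$ and $0<\lambda<\frac N2$ let $\mathcal C_\lambda(\mathbb R^N)$ be the completion of $C_c^\infty(\mathbb R^N)$ for the norm $\|f\|_\lambda^2=\int_{\mathbb R^N}|\mathcal Ff(\xi)|^2|\xi|^{N-2\lambda}\,d\xi$, where $\mathcal F$ is the Fourier transform. Its elements are functions on $\mathbb R^N$ that define tempered distributions. For $x\in\mathbb R^N$ put $v(x)=(1-|x|^2,2x,1+|x|^2)\in\mathbb R^{N+1,1}$. For $h\in SO_0(N+1,1)$ and all $x$ with at most one exception, $h\,v(x)=J(h,x)\,v(h\cdot x)$ with $J(h,x)>0$ and $h\cdot x\in\mathbb R^N$. The complementary series representation $\pi_\lambda$ of $SO_0(N+1,1)$ on $\mathcal C_\lambda(\mathbb R^N)$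 is the strongly continuous unitary representation $\pi_\lambda(h)f(x)=J(h^{-1},x)^{-\lambda}f(h^{-1}\cdot x)$. Write $\mathcal C_\mu=\mathcal C_\mu(\mathbb R^{n-1})$, a representation of $H$, and $\mathcal C_{\mu+j}=\mathcal C_{\mu+j}(\mathbb R^{n-2})$, a representation of $H_1$. Let $C^\infty_\mu(\mathbb R^{n-1})$ be the space of functions $(1+|x|^2)^{-\mu}\varphi(u(x))$ with $\varphi$ smooth on the unit sphere $S^{n-1}$, where $u(x)=\frac{1}{1+|x|^2}(1-|x|^2,2x)$. For $f\in C^\infty_\mu(\mathbb R^{n-1})$ and $y\in\mathbb R^{n-2}$ define Juhl's operator by $$\mathcal D_{\mu,j}f(y)=\Big(\sum_{0\le 2k\le j}C_k\,\partial_{n-1}^{\,j-2k}\Delta_{n-2}^{\,k}f\Big)(y,0),\qquad C_k=\frac{j!}{4^k\,k!\,(j-2k)!}\prod_{i=1}^{k}\frac{1}{\mu+j-i-\frac{n-2}{2}},$$ where $\Delta_{n-2}=\partial_1^2+\dots+\partial_{n-2}^2$; in particular $C_0=1$. Then $C^\infty_\mu(\mathbb R^{n-1})\subset\mathcal C_\mu$,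 and $\mathcal D_{\mu,j}$ extends to a non-zero bounded linear operator $\mathcal D_{\mu,j}:\mathcal C_\mu\to\mathcal C_{\mu+j}$ which is surjective and $H_1$-invariant: $\mathcal D_{\mu,j}\,\pi_\mu(h)=\pi_{\mu+j}(h)\,\mathcal D_{\mu,j}$ for all $h\in H_1$. Consequently $\mathcal C_{\mu+j}$ appears as a discrete component of $\mathcal C_\mu$ restricted to $H_1$: there is an $H_1$-equivariant linear isometry of $\mathcal C_{\mu+j}$ into $\mathcal C_\mu$. -/

import Mathlib

open MeasureTheory FourierTransform SchwartzMap
open scoped ContDiff Matrix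

noncomputable section

namespace Branching

/-! ## The groups `SO₀(p, 1)` -/

/-- The matrix of the quadratic form `x₁² + ⋯ + x_p² - x_{p+1}²`. The space coordinates are indexed
by `Fin p` and the time coordinate by `Fin 1`. -/
abbrev lorentzForm (p : ℕ) : Matrix (Fin p ⊕ Fin 1) (Fin p ⊕ Fin 1) ℝ :=
  LieAlgebra.Orthogonal.indefiniteDiagonal (Fin p) (Fin 1) ℝ

/-- `SO(p, 1)`: the real matrices of determinant one preserving the Lorentz form. -/
def SO (p : ℕ) : Subgroup (GL (Fin p ⊕ Fin 1) ℝ) where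
  carrier := {A | (A : Matrix (Fin p ⊕ Fin 1) (Fin p ⊕ Fin 1) ℝ)ᵀ * lorentzForm p * A.val
      = lorentzForm p ∧ A.val.det = 1}
  one_mem' := by simp
  mul_mem' := by
    rintro A B ⟨hA, hA'⟩ ⟨hB, hB'⟩
    refine ⟨?_, by simp [hA', hB']⟩
    simp only [Units.val_mul, Matrix.transpose_mul]
    calc B.valᵀ * A.valᵀ * lorentzForm p * (A.val * B.val)
        = B.valᵀ * (A.valᵀ * lorentzForm p * A.val) * B.val := by simp only [Matrix.mul_assoc]
      _ = lorentzForm p := by rw [hA, hB]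
  inv_mem' := by
    rintro A ⟨hA, hA'⟩
    have h1 : A.val * (A⁻¹).val = 1 := by rw [← Units.val_mul]; simp
    have h2 : ((A⁻¹).val)ᵀ * A.valᵀ = 1 := by rw [← Matrix.transpose_mul, h1]; simp
    refine ⟨?_, ?_⟩
    · calc ((A⁻¹).val)ᵀ * lorentzForm p * (A⁻¹).val
          = ((A⁻¹).val)ᵀ * (A.valᵀ * lorentzForm p * A.val) * (A⁻¹).val := by rw [hA]
        _ = (((A⁻¹).val)ᵀ * A.valᵀ) * lorentzForm p * (A.val * (A⁻¹).val) := by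
            simp only [Matrix.mul_assoc]
        _ = lorentzForm p := by rw [h1, h2]; simp
    · simp [hA']

/-- `SO₀(p, 1)`: the identity component of `SO(p, 1)`. -/
abbrev SO₀ (p : ℕ) : Type := Subgroup.connectedComponentOfOne (SO p)

/-- The matrix of an element of `SO₀(p, 1)`. -/
def SO₀.mat {p : ℕ} (h : SO₀ p) : Matrix (Fin p ⊕ Fin 1) (Fin p ⊕ Fin 1) ℝ :=
  ((h : SO p) : GL (Fin p ⊕ Fin 1) ℝ).val

/-- The coordinates of `ℝ^{p+1,1}`: those of `ℝ^{p,1}`, together with one further space coordinate,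
which becomes the last space coordinate. -/
def coordEquiv (p : ℕ) : (Fin p ⊕ Fin 1) ⊕ Unit ≃ Fin (p + 1) ⊕ Fin 1 where
  toFun := Sum.elim (Sum.elim (fun i => Sum.inl i.castSucc) Sum.inr) (fun _ => Sum.inl (Fin.last p))
  invFun := Sum.elim
    (Fin.lastCases (motive := fun _ => (Fin p ⊕ Fin 1) ⊕ Unit) (Sum.inr ())
      (fun i => Sum.inl (Sum.inl i)))
    (fun t => Sum.inl (Sum.inr t))
  left_inv := by rintro ((i | i) | i) <;> simp
  right_inv := by
    rintro (i | i)
    · refine Fin.lastCases ?_ (fun i => ?_) i <;> simp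
    · simp

/-- The matrix on `ℝ^{p+1,1}` that acts by `A` on `ℝ^{p,1}` and fixes the last space coordinate
vector. -/
def extendMatrix (p : ℕ) : Matrix (Fin p ⊕ Fin 1) (Fin p ⊕ Fin 1) ℝ →*
    Matrix (Fin (p + 1) ⊕ Fin 1) (Fin (p + 1) ⊕ Fin 1) ℝ where
  toFun A := Matrix.reindex (coordEquiv p) (coordEquiv p)
    (Matrix.fromBlocks A 0 0 (1 : Matrix Unit Unit ℝ))
  map_one' := by simp [Matrix.fromBlocks_one]
  map_mul' A B := by
    simp [Matrix.fromBlocks_multiply, Matrix.submatrix_mul_equiv]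

theorem continuous_extendMatrix (p : ℕ) : Continuous (extendMatrix p) := by
  change Continuous fun A : Matrix (Fin p ⊕ Fin 1) (Fin p ⊕ Fin 1) ℝ =>
    Matrix.reindex (coordEquiv p) (coordEquiv p)
      (Matrix.fromBlocks A 0 0 (1 : Matrix Unit Unit ℝ))
  fun_prop

theorem extendMatrix_lorentzForm (p : ℕ) :
    extendMatrix p (lorentzForm p) = lorentzForm (p + 1) := by
  have h : ∀ a b, extendMatrix p (lorentzForm p) (coordEquiv p a) (coordEquiv p b)
      = lorentzForm (p + 1) (coordEquiv p a) (coordEquiv p b) := by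
    intro a b
    rw [lorentzForm, lorentzForm, LieAlgebra.Orthogonal.indefiniteDiagonal,
      LieAlgebra.Orthogonal.indefiniteDiagonal, Matrix.diagonal_apply]
    rcases a with (a | a) | a <;> rcases b with (b | b) | b <;>
      simp [extendMatrix, coordEquiv, Matrix.diagonal_apply, Fin.ext_iff] <;> omega
  ext a b
  simpa using h ((coordEquiv p).symm a) ((coordEquiv p).symm b)

theorem extendMatrix_transpose (p : ℕ) (A : Matrix (Fin p ⊕ Fin 1) (Fin p ⊕ Fin 1) ℝ) :
    extendMatrix p Aᵀ = (extendMatrix p A)ᵀ := by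
  simp [extendMatrix, Matrix.fromBlocks_transpose]

/-- The embedding `SO(p, 1) → SO(p + 1, 1)`. -/
def embedSO (p : ℕ) : SO p →* SO (p + 1) :=
  ((Units.map (extendMatrix p)).comp (SO p).subtype).codRestrict (SO (p + 1)) (by
    rintro ⟨A, hA, hA'⟩
    refine ⟨?_, ?_⟩
    · change (extendMatrix p A.val)ᵀ * lorentzForm (p + 1) * extendMatrix p A.val = _
      rw [← extendMatrix_lorentzForm, ← extendMatrix_transpose, ← map_mul, ← map_mul, hA]
    · change (extendMatrix p A.val).det = 1
      simp [extendMatrix, hA'])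

theorem continuous_embedSO (p : ℕ) : Continuous (embedSO p) :=
  ((Units.continuous_map (continuous_extendMatrix p)).comp continuous_subtype_val).subtype_mk _

/-- The embedding `SO₀(p, 1) → SO₀(p + 1, 1)`, whose image fixes the last space coordinate
vector. -/
def embedSO₀ (p : ℕ) : SO₀ p →* SO₀ (p + 1) :=
  ((embedSO p).comp (Subgroup.connectedComponentOfOne (SO p)).subtype).codRestrict
    (Subgroup.connectedComponentOfOne (SO (p + 1))) (by
      rintro ⟨A, hA⟩
      have h := (continuous_embedSO p).image_connectedComponent_subset 1 ⟨A, hA, rfl⟩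
      rwa [map_one] at h)

/-! ## The action of `SO₀(N + 1, 1)` on functions on `ℝ^N` -/

/-- `ℝ^N` with its Euclidean norm. -/
abbrev E (N : ℕ) : Type := EuclideanSpace ℝ (Fin N)

/-- The lift of `x ∈ ℝ^N` to the light cone of `ℝ^{N+1,1}`, namely `(1 - |x|², 2x, 1 + |x|²)`.
Divided by its time coordinate it is the inverse stereographic projection of `x`. -/
def lightVector {N : ℕ} (x : E N) : Fin (N + 1) ⊕ Fin 1 → ℝ :=
  Sum.elim (Fin.cons (1 - ‖x‖ ^ 2) fun i => 2 * x i) fun _ => 1 + ‖x‖ ^ 2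

/-- The scalar `J` with `A (lightVector x) = J • lightVector x'`. -/
def conformalScale {N : ℕ} (A : Matrix (Fin (N + 1) ⊕ Fin 1) (Fin (N + 1) ⊕ Fin 1) ℝ)
    (x : E N) : ℝ :=
  ((A *ᵥ lightVector x) (Sum.inl 0) + (A *ᵥ lightVector x) (Sum.inr 0)) / 2

/-- The point `x' = A · x` with `A (lightVector x) = J • lightVector x'`: the conformal action of
`A`, defined off the at most one point where `J = 0`, which is sent to infinity. -/
def conformalMap {N : ℕ} (A : Matrix (Fin (N + 1) ⊕ Fin 1) (Fin (N + 1) ⊕ Fin 1) ℝ)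
    (x : E N) : E N :=
  WithLp.toLp 2 fun i => (A *ᵥ lightVector x) (Sum.inl i.succ) / (2 * conformalScale A x)

/-- The action `(π_μ(h) f)(x) = J(h⁻¹, x)^{-μ} f(h⁻¹ · x)` of the spherical principal series with
parameter `μ`, in the noncompact picture. -/
def principalAction {N : ℕ} (μ : ℝ) (h : SO₀ (N + 1)) (f : E N → ℂ) (x : E N) : ℂ :=
  ((conformalScale h⁻¹.mat x ^ (-μ) : ℝ) : ℂ) * f (conformalMap h⁻¹.mat x)

/-- The space `C^∞_μ(ℝ^N)` of smooth vectors of the principal series in the noncompact picture: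
the functions `(1 + |x|²)^{-μ} φ(u)`, where `u` is the inverse stereographic projection of `x`
and `φ` is a smooth function on the unit sphere of `ℝ^{N+1}`, given as the restriction of a smooth
function on `ℝ^{N+1}`. -/
def IsSmoothVector (N : ℕ) (μ : ℝ) (f : E N → ℂ) : Prop :=
  ∃ φ : (Fin (N + 1) → ℝ) → ℂ, ContDiff ℝ ∞ φ ∧ ∀ x : E N,
    f x = (((1 + ‖x‖ ^ 2) ^ (-μ) : ℝ) : ℂ) *
      φ fun i => lightVector x (Sum.inl i) / (1 + ‖x‖ ^ 2)

/-! ## The complementary series as weighted Sobolev spaces -/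

/-- The measure `|ξ|^{N - 2μ} dξ` on `ℝ^N`. -/
def freqMeasure (N : ℕ) (μ : ℝ) : Measure (E N) :=
  volume.withDensity fun ξ => ENNReal.ofReal (‖ξ‖ ^ ((N : ℝ) - 2 * μ))

/-- The Hilbert space `𝒞_μ`: the completion of `C_c^∞(ℝ^N)` for the norm
`‖f‖² = ∫ |𝓕 f(ξ)|² |ξ|^{N - 2μ} dξ`. An element is represented by its Fourier transform: the space
is the closure of `𝓕 (C_c^∞(ℝ^N))` in `L²(ℝ^N, |ξ|^{N - 2μ} dξ)`. -/
def compSubmodule (N : ℕ) (μ : ℝ) : Submodule ℂ (Lp ℂ 2 (freqMeasure N μ)) :=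
  (Submodule.span ℂ {u : Lp ℂ 2 (freqMeasure N μ) | ∃ f : E N → ℂ,
    ContDiff ℝ ∞ f ∧ HasCompactSupport f ∧ u =ᵐ[freqMeasure N μ] 𝓕 f}).topologicalClosure

/-- The Hilbert space `𝒞_μ` of functions on `ℝ^N`, as a type. -/
abbrev CompSeries (N : ℕ) (μ : ℝ) : Type := compSubmodule N μ

/-- The element `u` of `𝒞_μ` is the function `f` on `ℝ^N`: `f` defines a tempered distribution,
whose Fourier transform in the sense of distributions is the function `u`. -/
def Realizes {N : ℕ} {μ : ℝ} (u : CompSeries N μ) (f : E N → ℂ) : Prop :=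
  ∀ φ : 𝓢(E N, ℂ), Integrable (fun x => f x * φ x) ∧
    Integrable (fun ξ => (u : Lp ℂ 2 (freqMeasure N μ)) ξ * φ ξ) ∧
    ∫ x, f x * (𝓕 φ) x = ∫ ξ, (u : Lp ℂ 2 (freqMeasure N μ)) ξ * φ ξ

/-- `π` is the complementary series representation of `SO₀(N + 1, 1)` on `𝒞_μ`: the strongly
continuous unitary representation that acts on the elements of `𝒞_μ`, as functions on `ℝ^N`, by the
formula of the principal series. These conditions determine `π`. -/
structure IsComplementarySeries (N : ℕ) (μ : ℝ)
    (π : SO₀ (N + 1) →* (CompSeries N μ ≃ₗᵢ[ℂ] CompSeries N μ)) : Prop where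
  continuous : ∀ u, Continuous fun h => π h u
  action : ∀ u, ∃ f, Realizes u f ∧ ∀ h, Realizes (π h u) (principalAction μ h f)

/-! ## Juhl's differential operators -/

/-- The partial derivative `∂f/∂x_i`. -/
def partialDeriv {N : ℕ} (i : Fin N) (f : E N → ℂ) (x : E N) : ℂ :=
  fderiv ℝ f x (EuclideanSpace.single i 1)

/-- The Laplace operator `Δ = ∂₁² + ⋯ + ∂_d²` in the first `d` variables of `ℝ^{d+1}`. -/
def tangentialLaplacian {d : ℕ} (f : E (d + 1) → ℂ) (x : E (d + 1)) : ℂ :=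
  ∑ i : Fin d, partialDeriv i.castSucc (partialDeriv i.castSucc f) x

/-- The inclusion `y ↦ (y, 0)` of `ℝ^d` into `ℝ^{d+1}`. -/
def hyperplaneIncl {d : ℕ} (y : E d) : E (d + 1) :=
  WithLp.toLp 2 (Fin.snoc (α := fun _ => ℝ) (fun i => y i) 0)

/-- Juhl's coefficients
`C_k = j! / (4^k k! (j - 2k)!) ∏_{i=1}^{k} (μ + j - i - d/2)⁻¹`, for `2k ≤ j`, with `C_0 = 1`.
They are those of the Gegenbauer polynomial of degree `j` and parameter `μ - d/2`. -/
def juhlCoeff (d : ℕ) (μ : ℝ) (j k : ℕ) : ℝ :=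
  (j.factorial : ℝ) / (4 ^ k * k.factorial * (j - 2 * k).factorial) *
    ∏ i ∈ Finset.Icc 1 k, (μ + j - i - d / 2)⁻¹

/-- Juhl's operator
`(D_{μ,j} f)(y) = ∑_{2k ≤ j} C_k (∂_{d+1}^{j-2k} Δ_d^k f)(y, 0)` from functions on `ℝ^{d+1}`
to functions on `ℝ^d`. -/
def juhlOperator (d : ℕ) (μ : ℝ) (j : ℕ) (f : E (d + 1) → ℂ) (y : E d) : ℂ :=
  ∑ k ∈ Finset.range (j / 2 + 1), (juhlCoeff d μ j k : ℂ) *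
    ((partialDeriv (Fin.last d))^[j - 2 * k] (tangentialLaplacian^[k] f)) (hyperplaneIncl y)

end Branching

end

noncomputable section

namespace Branching

/-! ## Subordination to Gaussians -/

/-! On the Fourier side, `𝒞_μ(ℝ^{d+1})` is the whole of `L²(|ξ|^{d+1-2μ} dξ)`, and Juhl's operator
becomes an integral over normal lines: the transform of `D f` at `η` is `(2πi)^j ∫ P(|η|², τ) 𝓕f(η,
τ) dτ`. Here `P` is the homogeneous Gegenbauer polynomial of degree `j` with parameter index `a =
(d+1)/2 - (μ+j)`. Up to a scalar, `D` is therefore the adjoint of the map `T : 𝒞_{μ+j} → 𝒞_μ` that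
sends `v` to `|ξ|^{2μ-d-1} P(|ξ'|², ξ_n) |ξ'|^{d-2(μ+j)} v(ξ')`, where `ξ = (ξ', ξ_n)`.

By homogeneity, `∫ (r²+τ²)^{(2μ-d-1)/2} P(r², τ)² dτ = κ r^{2(μ+j)-d}`, and the integral converges
because `a > 1/2`, that is `μ + j < d/2`. So `κ^{-1/2} T` is an isometry (`integral_slice`,
`branchFun_sq`). Its adjoint is bounded and surjective, and `D` is a non-zero multiple of that
adjoint.

Equivariance is seen in the position picture (`realizes_branchIsometry_testVec`). The Rodrigues
formula writes `(s+τ²)^{-a-j} P(s, τ)` as a multiple of `∂_τ^j (s+τ²)^{-a}`, and `|ξ|^{-2a}` is a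
multiple of the Fourier transform of `|x|^{-2(μ+j)}`. So `T` sends the vector of a test function `g`
to a multiple of `x_n^j ∫ |x-(y,0)|^{-2(μ+j)} g(y) dy`. Under `H₁` the squared distance and `x_n`
transform by powers of `J` only, which makes this kernel covariant
(`principalAction_branchPotential`). Passing to adjoints, `D` intertwines the unitary
representations, and the covariance of the differential operator never has to be computed.

The representations are built by duality. The principal series with parameter `N - μ` acts on
functions bounded by `(1+|x|²)^{-(N-μ)}`. The map `g ↦ |ξ|^{2μ-N} 𝓕g` carries them densely into
`𝒞_μ`, with norm given by the Riesz form `∬ |x-y|^{-2μ} g(x) conj(g(y))`. That form is conformally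
invariant, so the action extends unitarily, and its dual is the action with parameter `μ`
(`norm_testVec_testAction`, `realizes_compRep_realization`). The Riesz form is obtained by writing
powers as superpositions of Gaussians.

A smooth vector need not be a Schwartz function. A cutoff on the sphere splits it into a compactly
supported part and a part near the point at infinity. A half turn in `H₁` makes the second part
compactly supported too, and equivariance and locality of `D` give the formula
(`exists_realizes_smoothVec`). -/

theorem integral_rpow_mul_exp_neg_pi {μ p : ℝ} (hμ : 0 < μ) (hp : 0 < p) :
    ∫ t in Set.Ioi (0 : ℝ), t ^ (μ - 1) * Real.exp (-(Real.pi * t * p))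
      = Real.Gamma μ * (Real.pi * p) ^ (-μ) := by
  have h := Real.integral_rpow_mul_exp_neg_mul_Ioi hμ (mul_pos Real.pi_pos hp)
  rw [one_div, Real.inv_rpow (by positivity), ← Real.rpow_neg (by positivity),
    mul_comm ((Real.pi * p) ^ (-μ))] at h
  rw [← h]
  refine integral_congr_ae (Filter.Eventually.of_forall fun t => ?_)
  simp only
  ring_nf

theorem integral_rpow_mul_exp_neg_pi_div {b q : ℝ} (hb : 0 < b) (hq : 0 < q) :
    ∫ t in Set.Ioi (0 : ℝ), t ^ (-b - 1) * Real.exp (-(Real.pi * q / t))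
      = Real.Gamma b * (Real.pi * q) ^ (-b) := by
  -- The substitution `t ↦ t⁻¹` reduces this to the previous integral.
  rw [← integral_rpow_mul_exp_neg_pi hb hq, ← integral_comp_rpow_Ioi _ (show (-1 : ℝ) ≠ 0 by simp)]
  refine setIntegral_congr_fun measurableSet_Ioi fun t (ht : 0 < t) => ?_
  simp only [abs_neg, abs_one, one_mul, smul_eq_mul]
  rw [← Real.rpow_mul ht.le, ← mul_assoc, ← Real.rpow_add ht, Real.rpow_neg_one, mul_assoc Real.pi,
    mul_comm _ q, ← mul_assoc, div_eq_mul_inv]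
  ring_nf
  simp

/-- Interchange of the integral against a positive kernel `k t (p a)` in the parameter `t`, whose
total mass in `t` is `m (p a)`, with an integral in `a`. -/
theorem integral_kernel_swap {α : Type*} [MeasurableSpace α] {ρ : Measure α} [SFinite ρ]
    {p : α → ℝ} {G : α → ℂ} {k : ℝ → ℝ → ℝ} {m : ℝ → ℝ}
    (hk : Measurable (Function.uncurry k)) (hk0 : ∀ t > 0, ∀ s, 0 ≤ k t s)
    (hm : ∀ s > 0, ∫ t in Set.Ioi (0 : ℝ), k t s = m s) (hm0 : ∀ s > 0, 0 < m s)
    (hp : Measurable p) (hp0 : ∀ᵐ a ∂ρ, 0 < p a) (hG : AEStronglyMeasurable G ρ)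
    (hmG : Integrable (fun a => (m (p a) : ℂ) * G a) ρ) :
    IntegrableOn (fun t => ∫ a, (k t (p a) : ℂ) * G a ∂ρ) (Set.Ioi 0) ∧
    ∫ t in Set.Ioi (0 : ℝ), ∫ a, (k t (p a) : ℂ) * G a ∂ρ = ∫ a, (m (p a) : ℂ) * G a ∂ρ := by
  -- A non-integrable function has Bochner integral zero, whereas the total mass is positive.
  have hint : ∀ s > 0, IntegrableOn (fun t => k t s) (Set.Ioi (0 : ℝ)) := by
    intro s hs
    by_contra h
    exact (hm0 s hs).ne' (by rw [← hm s hs]; exact integral_undef h)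
  have hI : Integrable (Function.uncurry fun t a => (k t (p a) : ℂ) * G a)
      ((volume.restrict (Set.Ioi (0 : ℝ))).prod ρ) := by
    have hmeas : AEStronglyMeasurable (Function.uncurry fun t a => (k t (p a) : ℂ) * G a)
        ((volume.restrict (Set.Ioi (0 : ℝ))).prod ρ) := by
      have h1 : Measurable fun x : ℝ × α => (k x.1 (p x.2) : ℂ) := Complex.measurable_ofReal.comp
        (hk.comp (measurable_fst.prodMk (hp.comp measurable_snd)))
      have h2 : AEStronglyMeasurable (fun x : ℝ × α => G x.2)
          ((volume.restrict (Set.Ioi (0 : ℝ))).prod ρ) := hG.comp_snd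
      exact h1.aestronglyMeasurable.mul h2
    rw [integrable_prod_iff' hmeas]
    refine ⟨?_, ?_⟩
    · filter_upwards [hp0] with a ha
      have h3 : Integrable (fun t => (k t (p a) : ℂ)) (volume.restrict (Set.Ioi (0 : ℝ))) :=
        Integrable.ofReal (hint _ ha)
      exact h3.mul_const (G a)
    · refine hmG.norm.congr ?_
      filter_upwards [hp0] with a ha
      simp only [Function.uncurry_apply_pair, norm_mul, Complex.norm_real, Real.norm_eq_abs]
      rw [integral_mul_const, abs_of_pos (hm0 _ ha), ← hm _ ha]
      congr 1
      exact setIntegral_congr_fun measurableSet_Ioi fun t ht => (abs_of_nonneg (hk0 t ht _)).symm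
  refine ⟨hI.integral_prod_left, ?_⟩
  rw [integral_integral_swap hI]
  refine integral_congr_ae ?_
  filter_upwards [hp0] with a ha
  rw [integral_mul_const, ← hm _ ha, integral_complex_ofReal]

section Subordination

variable {α β : Type*} [MeasurableSpace α] [MeasurableSpace β] {ρ : Measure α} {σ : Measure β}
  [SFinite ρ] [SFinite σ] {p : α → ℝ} {q : β → ℝ} {G : α → ℂ} {K : β → ℂ} {μ b : ℝ}

/-- The power `p^{-μ}` is a superposition of the Gaussians `e^{-πtp}` with density `t^{μ-1}`.
Integrability in `t` is recorded because `integrable_of_subordination` transfers it to the other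
side. -/
theorem integral_rpow_mul_of_gaussian (hμ : 0 < μ) (hp : Measurable p) (hp0 : ∀ᵐ a ∂ρ, 0 < p a)
    (hG : AEStronglyMeasurable G ρ)
    (hpG : Integrable (fun a => ((p a ^ (-μ) : ℝ) : ℂ) * G a) ρ) :
    IntegrableOn (fun t : ℝ => ((t ^ (μ - 1) : ℝ) : ℂ) *
      ∫ a, (Real.exp (-(Real.pi * t * p a)) : ℂ) * G a ∂ρ) (Set.Ioi 0) ∧
    ∫ t in Set.Ioi (0 : ℝ), ((t ^ (μ - 1) : ℝ) : ℂ) *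
      ∫ a, (Real.exp (-(Real.pi * t * p a)) : ℂ) * G a ∂ρ
      = (Real.Gamma μ * Real.pi ^ (-μ) : ℝ) * ∫ a, ((p a ^ (-μ) : ℝ) : ℂ) * G a ∂ρ := by
  have key := integral_kernel_swap (ρ := ρ) (p := p) (G := G)
    (k := fun t s => t ^ (μ - 1) * Real.exp (-(Real.pi * t * s)))
    (m := fun s => Real.Gamma μ * (Real.pi * s) ^ (-μ)) (by unfold Function.uncurry; fun_prop)
    (fun t ht s => by have : 0 < t := ht; positivity)
    (fun s hs => integral_rpow_mul_exp_neg_pi hμ hs)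
    (fun s hs => by have : 0 < s := hs; have := Real.Gamma_pos_of_pos hμ; positivity) hp hp0 hG ?_
  · have e : ∀ t, ∫ a, ((t ^ (μ - 1) * Real.exp (-(Real.pi * t * p a)) : ℝ) : ℂ) * G a ∂ρ
        = ((t ^ (μ - 1) : ℝ) : ℂ) * ∫ a, (Real.exp (-(Real.pi * t * p a)) : ℂ) * G a ∂ρ := by
      intro t
      rw [← integral_const_mul]
      exact integral_congr_ae (.of_forall fun a => by push_cast; ring)
    simp only [e] at key
    refine ⟨key.1, key.2.trans ?_⟩
    rw [← integral_const_mul]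
    refine integral_congr_ae ?_
    filter_upwards [hp0] with a ha
    rw [Real.mul_rpow Real.pi_pos.le ha.le]
    push_cast; ring
  · refine (hpG.const_mul ((Real.Gamma μ * Real.pi ^ (-μ) : ℝ) : ℂ)).congr ?_
    filter_upwards [hp0] with a ha
    rw [Real.mul_rpow Real.pi_pos.le ha.le]
    push_cast; ring

theorem integral_rpow_mul_of_gaussian_inv (hb : 0 < b) (hq : Measurable q)
    (hq0 : ∀ᵐ a ∂σ, 0 < q a) (hK : AEStronglyMeasurable K σ)
    (hqK : Integrable (fun a => ((q a ^ (-b) : ℝ) : ℂ) * K a) σ) :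
    ∫ t in Set.Ioi (0 : ℝ), ((t ^ (-b - 1) : ℝ) : ℂ) *
      ∫ a, (Real.exp (-(Real.pi * q a / t)) : ℂ) * K a ∂σ
      = (Real.Gamma b * Real.pi ^ (-b) : ℝ) * ∫ a, ((q a ^ (-b) : ℝ) : ℂ) * K a ∂σ := by
  have key := integral_kernel_swap (ρ := σ) (p := q) (G := K)
    (k := fun t s => t ^ (-b - 1) * Real.exp (-(Real.pi * s / t)))
    (m := fun s => Real.Gamma b * (Real.pi * s) ^ (-b)) (by unfold Function.uncurry; fun_prop)
    (fun t ht s => by have : 0 < t := ht; positivity)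
    (fun s hs => integral_rpow_mul_exp_neg_pi_div hb hs)
    (fun s hs => by have : 0 < s := hs; have := Real.Gamma_pos_of_pos hb; positivity) hq hq0 hK ?_
  · have e : ∀ t, ∫ a, ((t ^ (-b - 1) * Real.exp (-(Real.pi * q a / t)) : ℝ) : ℂ) * K a ∂σ
        = ((t ^ (-b - 1) : ℝ) : ℂ) * ∫ a, (Real.exp (-(Real.pi * q a / t)) : ℂ) * K a ∂σ := by
      intro t
      rw [← integral_const_mul]
      exact integral_congr_ae (.of_forall fun a => by push_cast; ring)
    simp only [e] at key
    refine key.2.trans ?_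
    rw [← integral_const_mul]
    refine integral_congr_ae ?_
    filter_upwards [hq0] with a ha
    rw [Real.mul_rpow Real.pi_pos.le ha.le]
    push_cast; ring
  · refine (hqK.const_mul ((Real.Gamma b * Real.pi ^ (-b) : ℝ) : ℂ)).congr ?_
    filter_upwards [hq0] with a ha
    rw [Real.mul_rpow Real.pi_pos.le ha.le]
    push_cast; ring

/-- If the Gaussian transforms of `G` and `K` are related by `t ↦ 1 / t`, then so are the integrals
of `G` and `K` against powers. -/
theorem subordination (hμ : 0 < μ) (hb : 0 < b) (hp : Measurable p) (hp0 : ∀ᵐ a ∂ρ, 0 < p a)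
    (hG : AEStronglyMeasurable G ρ) (hq : Measurable q) (hq0 : ∀ᵐ a ∂σ, 0 < q a)
    (hK : AEStronglyMeasurable K σ)
    (hGK : ∀ t > 0, ∫ a, (Real.exp (-(Real.pi * t * p a)) : ℂ) * G a ∂ρ
      = ((t ^ (-(μ + b)) : ℝ) : ℂ) * ∫ a, (Real.exp (-(Real.pi * q a / t)) : ℂ) * K a ∂σ)
    (hpG : Integrable (fun a => ((p a ^ (-μ) : ℝ) : ℂ) * G a) ρ)
    (hqK : Integrable (fun a => ((q a ^ (-b) : ℝ) : ℂ) * K a) σ) :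
    (Real.Gamma μ * Real.pi ^ (-μ) : ℝ) * ∫ a, ((p a ^ (-μ) : ℝ) : ℂ) * G a ∂ρ
      = (Real.Gamma b * Real.pi ^ (-b) : ℝ) * ∫ a, ((q a ^ (-b) : ℝ) : ℂ) * K a ∂σ := by
  rw [← (integral_rpow_mul_of_gaussian hμ hp hp0 hG hpG).2,
    ← integral_rpow_mul_of_gaussian_inv hb hq hq0 hK hqK]
  refine setIntegral_congr_fun measurableSet_Ioi fun t (ht : 0 < t) => ?_
  rw [hGK t ht, ← mul_assoc, ← Complex.ofReal_mul, ← Real.rpow_add ht,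
    show μ - 1 + -(μ + b) = -b - 1 by ring]

/-- In the situation of `subordination`, if `K` is nonnegative then the integrability on one side
implies that on the other. -/
theorem integrable_of_subordination {K : β → ℝ} (hμ : 0 < μ) (hb : 0 < b) (hp : Measurable p)
    (hp0 : ∀ᵐ a ∂ρ, 0 < p a) (hG : AEStronglyMeasurable G ρ) (hq : Measurable q)
    (hq0 : ∀ᵐ a ∂σ, 0 < q a) (hK : AEStronglyMeasurable K σ) (hK0 : ∀ a, 0 ≤ K a)
    (hGK : ∀ t > 0, ∫ a, (Real.exp (-(Real.pi * t * p a)) : ℂ) * G a ∂ρ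
      = ((t ^ (-(μ + b)) : ℝ) : ℂ) * ∫ a, (Real.exp (-(Real.pi * q a / t)) : ℂ) * K a ∂σ)
    (hKt : ∀ t > 0, Integrable (fun a => Real.exp (-(Real.pi * q a / t)) * K a) σ)
    (hpG : Integrable (fun a => ((p a ^ (-μ) : ℝ) : ℂ) * G a) ρ) :
    Integrable (fun a => q a ^ (-b) * K a) σ := by
  have hA := (integral_rpow_mul_of_gaussian hμ hp hp0 hG hpG).1
  have hΓ := Real.Gamma_pos_of_pos hb
  have hint : ∀ s > 0, IntegrableOn (fun t : ℝ => t ^ (-b - 1) * Real.exp (-(Real.pi * s / t)))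
      (Set.Ioi (0 : ℝ)) := by
    intro s hs
    by_contra h
    have h1 := integral_rpow_mul_exp_neg_pi_div hb hs
    rw [integral_undef h] at h1
    have : 0 < s := hs
    have : 0 < Real.Gamma b * (Real.pi * s) ^ (-b) := by positivity
    linarith
  have hI : Integrable (Function.uncurry fun (t : ℝ) a =>
      t ^ (-b - 1) * Real.exp (-(Real.pi * q a / t)) * K a)
      ((volume.restrict (Set.Ioi (0 : ℝ))).prod σ) := by
    have hmeas : AEStronglyMeasurable (Function.uncurry fun (t : ℝ) a =>
        t ^ (-b - 1) * Real.exp (-(Real.pi * q a / t)) * K a)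
        ((volume.restrict (Set.Ioi (0 : ℝ))).prod σ) := by
      refine AEStronglyMeasurable.mul ?_ hK.comp_snd
      refine Measurable.aestronglyMeasurable ?_
      fun_prop
    rw [integrable_prod_iff hmeas]
    refine ⟨?_, ?_⟩
    · refine (ae_restrict_iff' measurableSet_Ioi).2 (.of_forall fun t ht => ?_)
      simpa [mul_assoc] using (hKt t ht).const_mul (t ^ (-b - 1))
    -- As `K ≥ 0`, the inner integral of the norm is the Gaussian transform of `K` itself; by `hGK`
    -- it is the norm of a function of `t` already known to be integrable.
    · refine hA.norm.congr ((ae_restrict_iff' measurableSet_Ioi).2 (.of_forall fun t ht => ?_))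
      have ht0 : (0 : ℝ) < t := ht
      simp only
      rw [hGK t ht]
      have e1 : ∫ a, (Real.exp (-(Real.pi * q a / t)) : ℂ) * (K a : ℂ) ∂σ
          = ((∫ a, Real.exp (-(Real.pi * q a / t)) * K a ∂σ : ℝ) : ℂ) := by
        rw [← integral_complex_ofReal]; push_cast; rfl
      have e2 : 0 ≤ ∫ a, Real.exp (-(Real.pi * q a / t)) * K a ∂σ :=
        integral_nonneg fun a => mul_nonneg (Real.exp_pos _).le (hK0 a)
      rw [e1, ← mul_assoc, ← Complex.ofReal_mul, ← Complex.ofReal_mul, Complex.norm_real,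
        ← Real.rpow_add ht, Real.norm_of_nonneg (by positivity), ← integral_const_mul]
      refine integral_congr_ae (.of_forall fun a => ?_)
      have := hK0 a
      simp only [Function.uncurry_apply_pair]
      rw [Real.norm_of_nonneg (by positivity)]
      ring_nf
  have h2 := hI.integral_prod_right
  refine (h2.const_mul ((Real.Gamma b * Real.pi ^ (-b))⁻¹)).congr ?_
  filter_upwards [hq0] with a ha
  simp only [Function.uncurry_apply_pair]
  rw [integral_mul_const, integral_rpow_mul_exp_neg_pi_div hb ha,
    Real.mul_rpow Real.pi_pos.le ha.le]
  field_simp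

end Subordination

/-! ## The Gaussian identities -/

variable {N : ℕ}

theorem fourier_gaussian_dilate {t : ℝ} (ht : 0 < t) (z : E N) :
    𝓕 (fun ξ : E N => (Real.exp (-(Real.pi * ‖ξ‖ ^ 2 / t)) : ℂ)) z
      = ((t ^ ((N : ℝ) / 2) : ℝ) : ℂ) * (Real.exp (-(Real.pi * t * ‖z‖ ^ 2)) : ℂ) := by
  have hpt : 0 < ((Real.pi / t : ℝ) : ℂ).re := by rw [Complex.ofReal_re]; positivity
  have h := fourier_gaussian_innerProductSpace (V := E N) hpt z
  have e : (fun v : E N => Complex.exp (-((Real.pi / t : ℝ) : ℂ) * (‖v‖ : ℂ) ^ 2))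
      = fun ξ : E N => (Real.exp (-(Real.pi * ‖ξ‖ ^ 2 / t)) : ℂ) := by
    funext v; rw [Complex.ofReal_exp]; push_cast; ring_nf
  rw [e] at h
  rw [h]
  have hpi := Real.pi_pos.ne'
  have e1 : (Real.pi : ℂ) / ((Real.pi / t : ℝ) : ℂ) = (t : ℂ) := by
    rw [← Complex.ofReal_div]; congr 1; field_simp
  have e2 : (-(Real.pi : ℂ) ^ 2 * (‖z‖ : ℂ) ^ 2 / ((Real.pi / t : ℝ) : ℂ))
      = ((-(Real.pi * t * ‖z‖ ^ 2) : ℝ) : ℂ) := by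
    have : (-(Real.pi : ℝ) ^ 2 * ‖z‖ ^ 2 / (Real.pi / t)) = -(Real.pi * t * ‖z‖ ^ 2) := by
      field_simp
    rw [← this]; push_cast; rfl
  rw [e1, e2, Complex.ofReal_cpow ht.le, ← Complex.ofReal_exp]
  simp

theorem integrable_gaussian_dilate {t : ℝ} (ht : 0 < t) :
    Integrable (fun ξ : E N => (Real.exp (-(Real.pi * ‖ξ‖ ^ 2 / t)) : ℂ)) := by
  have hpt : 0 < ((Real.pi / t : ℝ) : ℂ).re := by rw [Complex.ofReal_re]; positivity
  have h := GaussianFourier.integrable_cexp_neg_mul_sq_norm_add (V := E N) hpt 0 0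
  refine h.congr (.of_forall fun v => ?_)
  simp only
  rw [Complex.ofReal_exp]; push_cast; simp; ring_nf

theorem integral_fourier_mul_flip {f g : E N → ℂ} (hf : Integrable f) (hg : Integrable g) :
    ∫ ξ, 𝓕 f ξ * g ξ = ∫ x, f x * 𝓕 g x := by
  have := VectorFourier.integral_fourierIntegral_smul_eq_flip (L := innerₗ (E N))
    Real.continuous_fourierChar continuous_inner hf hg
  simp only [smul_eq_mul, flip_innerₗ] at this
  exact this

theorem continuous_fourier_of_integrable {g : E N → ℂ} (hg : Integrable g) : Continuous (𝓕 g) :=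
  VectorFourier.fourierIntegral_continuous Real.continuous_fourierChar continuous_inner hg

theorem norm_fourier_le {g : E N → ℂ} (ξ : E N) : ‖𝓕 g ξ‖ ≤ ∫ x, ‖g x‖ :=
  VectorFourier.norm_fourierIntegral_le_integral_norm _ _ _ _ _

theorem fourier_congr_ae {f g : E N → ℂ} (h : f =ᵐ[volume] g) : 𝓕 f = 𝓕 g := by
  funext ξ
  rw [Real.fourier_eq, Real.fourier_eq]
  exact integral_congr_ae (h.mono fun x hx => by simp only [hx])

/-- The input `hGK` of `subordination` for `G = 𝓕 φ` and `K = φ`: the Fourier transform is moved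
onto a Gaussian. -/
theorem gaussian_pairing {φ : E N → ℂ} (hφ : Integrable φ) {t : ℝ} (ht : 0 < t) :
    ∫ x, (Real.exp (-(Real.pi * t * ‖x‖ ^ 2)) : ℂ) * 𝓕 φ x
      = ((t ^ (-((N : ℝ) / 2)) : ℝ) : ℂ) *
        ∫ ξ, (Real.exp (-(Real.pi * ‖ξ‖ ^ 2 / t)) : ℂ) * φ ξ := by
  have ht' : 0 < 1 / t := by positivity
  have h := integral_fourier_mul_flip hφ (integrable_gaussian_dilate (N := N) ht')
  simp only [fourier_gaussian_dilate ht'] at h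
  have e1 : ∀ x : E N, 𝓕 φ x * (Real.exp (-(Real.pi * ‖x‖ ^ 2 / (1 / t))) : ℂ)
      = (Real.exp (-(Real.pi * t * ‖x‖ ^ 2)) : ℂ) * 𝓕 φ x := fun x => by
    rw [mul_comm]; congr 4; field_simp
  have e2 : ∀ x : E N, φ x * ((((1 / t) ^ ((N : ℝ) / 2) : ℝ) : ℂ) *
      (Real.exp (-(Real.pi * (1 / t) * ‖x‖ ^ 2)) : ℂ)) = ((t ^ (-((N : ℝ) / 2)) : ℝ) : ℂ) *
        ((Real.exp (-(Real.pi * ‖x‖ ^ 2 / t)) : ℂ) * φ x) := fun x => by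
    rw [Real.rpow_neg ht.le, one_div, Real.inv_rpow ht.le,
      show Real.pi * t⁻¹ * ‖x‖ ^ 2 = Real.pi * ‖x‖ ^ 2 / t by ring]
    ring
  simp only [e1, e2] at h
  rw [h, integral_const_mul]

theorem fourier_eq_char (f : E N → ℂ) (w : E N) :
    𝓕 f w = ∫ v, (Real.fourierChar (-inner ℝ v w) : ℂ) * f v := by
  rw [Real.fourier_eq]; rfl

/-- Writing `e^{-πt|x-y|²}` as a Fourier integral separates `x` from `y`, and the two factors are `𝓕
g` and its conjugate. The powers of `t` are those required by `subordination` with `μ + b = N/2`. -/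
theorem gaussian_sesquilinear {g : E N → ℂ} (hg : Integrable g) {t : ℝ} (ht : 0 < t) :
    ∫ z : E N × E N, (Real.exp (-(Real.pi * t * ‖z.1 - z.2‖ ^ 2)) : ℂ) *
        (g z.1 * star (g z.2))
      = ((t ^ (-((N : ℝ) / 2)) : ℝ) : ℂ) *
        ∫ ξ, (Real.exp (-(Real.pi * ‖ξ‖ ^ 2 / t)) : ℂ) * ((‖𝓕 g ξ‖ ^ 2 : ℝ) : ℂ) := by
  have hγ := integrable_gaussian_dilate (N := N) ht
  have hg' : Integrable fun x => star (g x) := by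
    rw [← integrable_norm_iff (continuous_star.comp_aestronglyMeasurable hg.1)]
    simpa using hg.norm
  have hI : Integrable (Function.uncurry fun (z : E N × E N) (ξ : E N) =>
      (Real.fourierChar (-inner ℝ ξ (z.1 - z.2)) : ℂ) *
      ((g z.1 * star (g z.2)) * (Real.exp (-(Real.pi * ‖ξ‖ ^ 2 / t)) : ℂ)))
      ((volume.prod volume).prod volume) := by
    refine ((hg.mul_prod hg').mul_prod hγ).bdd_mul (c := 1) ?_ ?_
    · exact (by fun_prop : Continuous fun p : (E N × E N) × E N =>
        (Real.fourierChar (-inner ℝ p.2 (p.1.1 - p.1.2)) : ℂ)).aestronglyMeasurable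
    · exact .of_forall fun p => (Circle.norm_coe _).le
  have h := integral_integral_swap (μ := volume.prod volume) hI
  have e1 : ∀ z : E N × E N, ∫ ξ, (Real.fourierChar (-inner ℝ ξ (z.1 - z.2)) : ℂ) *
      ((g z.1 * star (g z.2)) * (Real.exp (-(Real.pi * ‖ξ‖ ^ 2 / t)) : ℂ))
      = ((t ^ ((N : ℝ) / 2) : ℝ) : ℂ) * ((Real.exp (-(Real.pi * t * ‖z.1 - z.2‖ ^ 2)) : ℂ) *
        (g z.1 * star (g z.2))) := by
    intro z
    rw [← mul_assoc, ← fourier_gaussian_dilate ht (z.1 - z.2), fourier_eq_char,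
      ← integral_mul_const]
    exact integral_congr_ae (.of_forall fun ξ => by simp only; ring)
  have e2 : ∀ ξ : E N, ∫ z : E N × E N, (Real.fourierChar (-inner ℝ ξ (z.1 - z.2)) : ℂ) *
      ((g z.1 * star (g z.2)) * (Real.exp (-(Real.pi * ‖ξ‖ ^ 2 / t)) : ℂ))
      = (Real.exp (-(Real.pi * ‖ξ‖ ^ 2 / t)) : ℂ) * ((‖𝓕 g ξ‖ ^ 2 : ℝ) : ℂ) := by
    intro ξ
    have h1 : ∫ z : E N × E N, ((Real.fourierChar (-inner ℝ z.1 ξ) : ℂ) * g z.1) *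
        star ((Real.fourierChar (-inner ℝ z.2 ξ) : ℂ) * g z.2) = ((‖𝓕 g ξ‖ ^ 2 : ℝ) : ℂ) := by
      have := integral_prod_mul (μ := (volume : Measure (E N))) (ν := (volume : Measure (E N)))
        (fun x => (Real.fourierChar (-inner ℝ x ξ) : ℂ) * g x)
        (fun y => star ((Real.fourierChar (-inner ℝ y ξ) : ℂ) * g y))
      rw [Measure.volume_eq_prod, this]
      have hc : ∫ y, star ((Real.fourierChar (-inner ℝ y ξ) : ℂ) * g y) = star (𝓕 g ξ) := by
        rw [fourier_eq_char]; exact integral_conj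
      rw [hc, ← fourier_eq_char]
      rw [Complex.star_def, Complex.mul_conj, Complex.normSq_eq_norm_sq]
    rw [← h1, ← integral_const_mul]
    refine integral_congr_ae (.of_forall fun z => ?_)
    simp only [star_mul']
    have : (Real.fourierChar (-inner ℝ ξ (z.1 - z.2)) : ℂ)
        = (Real.fourierChar (-inner ℝ z.1 ξ) : ℂ) * star (Real.fourierChar (-inner ℝ z.2 ξ) : ℂ) := by
      rw [real_inner_comm ξ z.1, real_inner_comm ξ z.2, inner_sub_right, neg_sub, sub_eq_add_neg,
        add_comm, AddChar.map_add_eq_mul]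
      push_cast
      rw [Complex.star_def, ← Circle.coe_inv_eq_conj, ← AddChar.map_neg_eq_inv]
      simp
    rw [this]; ring
  rw [← Measure.volume_eq_prod] at h
  simp only [e1, e2] at h
  rw [← h, integral_const_mul, ← mul_assoc, ← Complex.ofReal_mul, ← Real.rpow_add ht]
  simp

end Branching
end

noncomputable section

namespace Branching

/-! ## Integrability of Riesz kernels -/

variable {N : ℕ} {μ : ℝ}

theorem ae_ne_point [NeZero N] (y : E N) : ∀ᵐ x : E N, x ≠ y :=
  Measure.ae_ne volume y

theorem integrable_riesz_unit [NeZero N] {a : ℝ} (ha : a < N) :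
    Integrable fun x : E N => (Set.Iio (1 : ℝ)).indicator (fun r => r ^ (-a)) ‖x‖ := by
  have hN : 0 < N := Nat.pos_of_ne_zero (NeZero.ne N)
  rw [integrable_fun_norm_addHaar (volume : Measure (E N))]
  have h1 : IntegrableOn (fun y : ℝ => y ^ ((N : ℝ) - 1 - a)) (Set.Ioo 0 1) :=
    (intervalIntegral.integrableOn_Ioo_rpow_iff one_pos).2 (by linarith)
  have h2 := (integrable_indicator_iff measurableSet_Ioo).2 h1
  refine (h2.integrableOn (s := Set.Ioi 0)).congr_fun (fun y (hy : 0 < y) => ?_) measurableSet_Ioi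
  simp only [finrank_euclideanSpace, Fintype.card_fin, smul_eq_mul]
  by_cases h : y < 1
  · rw [Set.indicator_of_mem (show y ∈ Set.Ioo (0 : ℝ) 1 from ⟨hy, h⟩),
      Set.indicator_of_mem (show y ∈ Set.Iio (1 : ℝ) from h), ← Real.rpow_natCast,
      ← Real.rpow_add hy]
    congr 1
    rw [Nat.cast_sub (Nat.succ_le_of_lt hN)]
    push_cast; ring
  · rw [Set.indicator_of_notMem (fun h' => h h'.2), Set.indicator_of_notMem (show y ∉ Set.Iio (1 : ℝ) from h),
      mul_zero]

/-- Within distance one of `y` the singularity is integrable and `w ≤ B`; farther away the kernel is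
at most one. Translation invariance makes the bound uniform in `y`. -/
theorem riesz_bound [NeZero N] {a : ℝ} (ha0 : 0 ≤ a) (ha : a < N) :
    ∃ C₀ : ℝ, 0 ≤ C₀ ∧ ∀ (B : ℝ) (w : E N → ℝ), (∀ x, 0 ≤ w x) → (∀ x, w x ≤ B) → Integrable w →
      ∀ y, Integrable (fun x => ‖x - y‖ ^ (-a) * w x) ∧
        ∫ x, ‖x - y‖ ^ (-a) * w x ≤ C₀ * B + ∫ x, w x := by
  set k : E N → ℝ := fun x => (Set.Iio (1 : ℝ)).indicator (fun r => r ^ (-a)) ‖x‖ with hk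
  have hki : Integrable k := integrable_riesz_unit ha
  have hk0 : ∀ x, 0 ≤ k x := fun x => Set.indicator_apply_nonneg fun h => by positivity
  refine ⟨∫ x, k x, integral_nonneg hk0, fun B w hw0 hwB hw y => ?_⟩
  have hle : ∀ x, ‖x - y‖ ^ (-a) * w x ≤ k (x - y) * B + w x := by
    intro x
    by_cases h : ‖x - y‖ < 1
    · have : k (x - y) = ‖x - y‖ ^ (-a) := Set.indicator_of_mem (show _ ∈ Set.Iio (1 : ℝ) from h) _
      rw [this]
      have h1 : ‖x - y‖ ^ (-a) * w x ≤ ‖x - y‖ ^ (-a) * B := by gcongr; exact hwB x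
      linarith [hw0 x]
    · have : k (x - y) = 0 := Set.indicator_of_notMem (show _ ∉ Set.Iio (1 : ℝ) from h) _
      rw [this, zero_mul, zero_add]
      exact mul_le_of_le_one_left (hw0 x)
        (Real.rpow_le_one_of_one_le_of_nonpos (not_lt.1 h) (by linarith))
  have hi : Integrable fun x => k (x - y) * B + w x := ((hki.comp_sub_right y).mul_const B).add hw
  have hi' : Integrable fun x => ‖x - y‖ ^ (-a) * w x := by
    refine hi.mono' ?_ (.of_forall fun x => ?_)
    · exact (by fun_prop : Measurable fun x : E N => ‖x - y‖ ^ (-a)).aestronglyMeasurable.mul hw.1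
    · rw [Real.norm_of_nonneg (mul_nonneg (by positivity) (hw0 x))]
      exact hle x
  refine ⟨hi', (integral_mono hi' hi hle).trans ?_⟩
  rw [integral_add ((hki.comp_sub_right y).mul_const B) hw, integral_mul_const,
    integral_sub_right_eq_self k y]

/-! ## The frequency space -/

/-- The range of parameters of the complementary series. -/
class ComplementaryRange (N : ℕ) (μ : ℝ) : Prop where
  pos : 0 < μ
  lt : μ < (N : ℝ) / 2

theorem ComplementaryRange.neZero [h : ComplementaryRange N μ] : NeZero N :=
  ⟨by rintro rfl; have h1 := h.pos; have h2 := h.lt; simp at h2; linarith⟩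

variable (N μ) in
theorem range_pos [h : ComplementaryRange N μ] : 0 < μ := h.pos

variable (N μ) in
theorem range_lt [h : ComplementaryRange N μ] : 0 < (N : ℝ) - 2 * μ := by have := h.lt; linarith

theorem measurable_freqDensity :
    Measurable fun ξ : E N => ENNReal.ofReal (‖ξ‖ ^ ((N : ℝ) - 2 * μ)) := by fun_prop

/-- The density can vanish only at the origin, a null set, so the null sets are those of Lebesgue
measure. -/
theorem ae_freqMeasure_iff [ComplementaryRange N μ] {p : E N → Prop} :
    (∀ᵐ ξ ∂freqMeasure N μ, p ξ) ↔ ∀ᵐ ξ : E N, p ξ := by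
  have := ComplementaryRange.neZero (N := N) (μ := μ)
  rw [freqMeasure, ae_withDensity_iff measurable_freqDensity]
  constructor
  · intro h
    filter_upwards [h, ae_ne_point (0 : E N)] with ξ h1 h2
    refine h1 ?_
    have : 0 < ‖ξ‖ := norm_pos_iff.2 h2
    have : 0 < ‖ξ‖ ^ ((N : ℝ) - 2 * μ) := by positivity
    simpa using this
  · intro h
    filter_upwards [h] with ξ h1 _ using h1

theorem ae_freqMeasure_eq [ComplementaryRange N μ] :
    ae (freqMeasure N μ) = ae (volume : Measure (E N)) := by
  ext s; exact ae_freqMeasure_iff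

theorem aestronglyMeasurable_freq_iff [ComplementaryRange N μ] {F : Type*} [TopologicalSpace F]
    {f : E N → F} :
    AEStronglyMeasurable f (freqMeasure N μ) ↔ AEStronglyMeasurable f := by
  have h1 : freqMeasure N μ ≪ volume := withDensity_absolutelyContinuous _ _
  have h2 : volume ≪ freqMeasure N μ := fun s hs => by
    have : ∀ᵐ ξ ∂freqMeasure N μ, ξ ∉ s := measure_eq_zero_iff_ae_notMem.1 hs
    exact measure_eq_zero_iff_ae_notMem.2 (ae_freqMeasure_iff.1 this)
  exact ⟨fun h => h.mono_ac h2, fun h => h.mono_ac h1⟩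

theorem integrable_freq_iff {F : Type*} [NormedAddCommGroup F] [NormedSpace ℝ F] {f : E N → F} :
    Integrable f (freqMeasure N μ) ↔ Integrable fun ξ => ‖ξ‖ ^ ((N : ℝ) - 2 * μ) • f ξ := by
  rw [freqMeasure, integrable_withDensity_iff_integrable_smul' measurable_freqDensity (by simp)]
  refine integrable_congr (.of_forall fun ξ => ?_)
  simp only
  rw [ENNReal.toReal_ofReal (by positivity)]

theorem integral_freq {F : Type*} [NormedAddCommGroup F] [NormedSpace ℝ F] (f : E N → F) :
    ∫ ξ, f ξ ∂freqMeasure N μ = ∫ ξ, ‖ξ‖ ^ ((N : ℝ) - 2 * μ) • f ξ := by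
  rw [freqMeasure, integral_withDensity_eq_integral_toReal_smul measurable_freqDensity (by simp)]
  refine integral_congr_ae (.of_forall fun ξ => ?_)
  simp only
  rw [ENNReal.toReal_ofReal (by positivity)]

/-- This places Schwartz functions in `L²(freqMeasure)`. In the exponent `N + (N + 1)`, the first
`N` absorbs the density and the rest is integrable. -/
instance [ComplementaryRange N μ] : (freqMeasure N μ).HasTemperateGrowth := by
  refine ⟨⟨N + (N + 1), ?_⟩⟩
  rw [integrable_freq_iff]
  have h : Integrable (fun x : E N => (1 + ‖x‖) ^ (-((N : ℝ) + 1))) :=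
    integrable_one_add_norm (by simp)
  refine h.mono' (by fun_prop : Measurable _).aestronglyMeasurable (.of_forall fun ξ => ?_)
  have h0 : 0 ≤ ‖ξ‖ := norm_nonneg ξ
  rw [smul_eq_mul, Real.norm_of_nonneg (by positivity)]
  have h1 : ‖ξ‖ ^ ((N : ℝ) - 2 * μ) ≤ (1 + ‖ξ‖) ^ (N : ℝ) := by
    refine (Real.rpow_le_rpow h0 (le_add_of_nonneg_left zero_le_one) (range_lt N μ).le).trans ?_
    exact Real.rpow_le_rpow_of_exponent_le (by linarith) (by linarith [range_pos N μ])
  calc _ ≤ (1 + ‖ξ‖) ^ (N : ℝ) * (1 + ‖ξ‖) ^ (-((N + (N + 1) : ℕ) : ℝ)) := by gcongr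
    _ = _ := by rw [← Real.rpow_add (by linarith)]; congr 1; push_cast; ring

theorem inner_freq (u v : Lp ℂ 2 (freqMeasure N μ)) :
    inner ℂ u v = ∫ ξ, ((‖ξ‖ ^ ((N : ℝ) - 2 * μ) : ℝ) : ℂ) * (star (u ξ) * v ξ) := by
  rw [L2.inner_def, integral_freq]
  refine integral_congr_ae (.of_forall fun ξ => ?_)
  simp only [RCLike.inner_apply, Complex.real_smul, Complex.star_def]
  ring

/-! ## Uniqueness -/

theorem ae_eq_zero_of_forall_schwartz {U : E N → ℂ}
    (hU : ∀ φ : 𝓢(E N, ℂ), Integrable fun x => U x * φ x)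
    (h0 : ∀ φ : 𝓢(E N, ℂ), ∫ x, U x * φ x = 0) : U =ᵐ[volume] 0 := by
  have key : ∀ g : E N → ℝ, (hg : ContDiff ℝ ∞ g) → (hc : HasCompactSupport g) →
      ∃ φ : 𝓢(E N, ℂ), ∀ x, φ x = g x := fun g hg hc =>
    ⟨(hc.comp_left (g := Complex.ofReal) Complex.ofReal_zero).toSchwartzMap
      (Complex.ofRealCLM.contDiff.comp hg), fun x => rfl⟩
  -- Testing against a bump function equal to one on a compact set gives integrability there.
  have hloc : LocallyIntegrable U := by
    rw [locallyIntegrable_iff]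
    intro K hK
    obtain ⟨R, hR0, hR⟩ := hK.isBounded.subset_closedBall_lt 0 (0 : E N)
    let b : ContDiffBump (0 : E N) := ⟨R, R + 1, hR0, by linarith⟩
    obtain ⟨φ, hφ⟩ := key b b.contDiff b.hasCompactSupport
    refine ((hU φ).integrableOn (s := K)).congr_fun (fun x hx => ?_) hK.measurableSet
    simp only
    rw [hφ, b.one_of_mem_closedBall (hR hx)]; simp
  refine ae_eq_zero_of_integral_contDiff_smul_eq_zero hloc fun g hg hc => ?_
  obtain ⟨φ, hφ⟩ := key g hg hc
  rw [← h0 φ]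
  exact integral_congr_ae (.of_forall fun x => by simp [hφ, mul_comm])

theorem ae_eq_zero_of_fourier_eq_zero {W : E N → ℂ} (hW : Integrable W) (h0 : ∀ ξ, 𝓕 W ξ = 0) :
    W =ᵐ[volume] 0 := by
  have hint : ∀ φ : 𝓢(E N, ℂ), Integrable fun x => W x * φ x := fun φ =>
    hW.mul_bdd (c := SchwartzMap.seminorm ℂ 0 0 φ) φ.continuous.aestronglyMeasurable
      (.of_forall fun x => φ.norm_le_seminorm ℂ x)
  refine ae_eq_zero_of_forall_schwartz hint fun φ => ?_
  have h := integral_fourier_mul_flip hW (𝓕⁻ φ : 𝓢(E N, ℂ)).integrable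
  simp only [h0, zero_mul, integral_zero] at h
  rw [h]
  refine integral_congr_ae (.of_forall fun x => ?_)
  simp only
  rw [← SchwartzMap.fourier_coe, FourierTransform.fourier_fourierInv_eq]

/-- For every frequency there is an element of a fixed sequence of bump functions whose Fourier
transform does not vanish there. -/
theorem exists_bump_seq : ∃ φ : ℕ → E N → ℂ, (∀ n, ContDiff ℝ ∞ (φ n)) ∧
    (∀ n, HasCompactSupport (φ n)) ∧ ∀ ξ, ∃ n, 𝓕 (φ n) ξ ≠ 0 := by
  let b : ℕ → ContDiffBump (0 : E N) := fun n =>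
    ⟨1 / ((n : ℝ) + 2), 1 / ((n : ℝ) + 1), by positivity, by gcongr; norm_num⟩
  refine ⟨fun n x => ((b n).normed volume x : ℂ), fun n =>
    Complex.ofRealCLM.contDiff.comp (b n).contDiff_normed, fun n =>
    ((b n).hasCompactSupport_normed).comp_left (g := Complex.ofReal) Complex.ofReal_zero,
    fun ξ => ?_⟩
  have ht : Filter.Tendsto (fun n => (b n).rOut) Filter.atTop (nhds 0) :=
    tendsto_one_div_add_atTop_nhds_zero_nat
  -- The Fourier transform of a bump at `ξ` is its convolution with a character, evaluated at `0`.
  -- The bumps form an approximate identity, so the values tend to `1`.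
  have hg : Continuous fun x : E N => (Real.fourierChar (inner ℝ x ξ) : ℂ) := by fun_prop
  have h := ContDiffBump.convolution_tendsto_right_of_continuous (μ := volume) ht hg 0
  have h1 : ∀ n, MeasureTheory.convolution ((b n).normed volume)
      (fun x : E N => (Real.fourierChar (inner ℝ x ξ) : ℂ)) (ContinuousLinearMap.lsmul ℝ ℝ) volume 0
      = 𝓕 (fun x => ((b n).normed volume x : ℂ)) ξ := by
    intro n
    rw [fourier_eq_char, MeasureTheory.convolution]
    refine integral_congr_ae (.of_forall fun x => ?_)
    simp [mul_comm]
  simp only [h1, inner_zero_left] at h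
  simp only [AddChar.map_zero_eq_one, Circle.coe_one] at h
  exact ((h.eventually_ne one_ne_zero)).exists

theorem fourier_comp_sub_right (f : E N → ℂ) (a ξ : E N) :
    𝓕 (fun x => f (x - a)) ξ = (Real.fourierChar (-inner ℝ a ξ) : ℂ) * 𝓕 f ξ := by
  rw [fourier_eq_char, fourier_eq_char, ← integral_const_mul,
    ← integral_sub_right_eq_self (fun x => (Real.fourierChar (-inner ℝ a ξ) : ℂ) *
      ((Real.fourierChar (-inner ℝ x ξ) : ℂ) * f x)) a]
  refine integral_congr_ae (.of_forall fun x => ?_)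
  simp only
  rw [← mul_assoc, inner_sub_left, ← Circle.coe_mul, ← AddChar.map_add_eq_mul]
  congr 4; ring

/-- Let `u` be orthogonal to the transforms of all translates of `φ_n`. Translation multiplies the
transform by a character, so the integrable function `|ξ|^{N-2μ} conj(𝓕φ_n) u` has zero Fourier
transform and vanishes. Since no frequency is a zero of every `𝓕φ_n`, `u` vanishes. Hence an element
of `𝒞_μ` may be given by any function in the weighted `L²`. -/
theorem compSubmodule_eq_top [ComplementaryRange N μ] : compSubmodule N μ = ⊤ := by
  have := ComplementaryRange.neZero (N := N) (μ := μ)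
  rw [compSubmodule, Submodule.topologicalClosure_eq_top_iff, Submodule.eq_bot_iff]
  intro u hu
  rw [Submodule.mem_orthogonal] at hu
  obtain ⟨φ, hφ, hφc, hφ0⟩ := exists_bump_seq (N := N)
  have key : ∀ n, (fun ξ => ((‖ξ‖ ^ ((N : ℝ) - 2 * μ) : ℝ) : ℂ) * (star (𝓕 (φ n) ξ) * u ξ))
      =ᵐ[volume] 0 := by
    intro n
    have hS : ∀ f : E N → ℂ, ContDiff ℝ ∞ f → HasCompactSupport f →
        ∃ v : Lp ℂ 2 (freqMeasure N μ), v =ᵐ[volume] 𝓕 f ∧ inner ℂ v u = 0 := by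
      intro f hf hc
      let F : 𝓢(E N, ℂ) := 𝓕 (hc.toSchwartzMap hf)
      refine ⟨F.toLp 2 (freqMeasure N μ), ?_, hu _ (Submodule.subset_span ⟨f, hf, hc, ?_⟩)⟩
      · have := F.coeFn_toLp 2 (freqMeasure N μ)
        rwa [Filter.EventuallyEq, ae_freqMeasure_eq] at this
      · exact F.coeFn_toLp 2 (freqMeasure N μ)
    obtain ⟨v, hv, -⟩ := hS _ (hφ n) (hφc n)
    have hW : Integrable (fun ξ =>
        ((‖ξ‖ ^ ((N : ℝ) - 2 * μ) : ℝ) : ℂ) * (star (𝓕 (φ n) ξ) * u ξ)) := by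
      have h1 := L2.integrable_inner (𝕜 := ℂ) v u
      rw [integrable_freq_iff] at h1
      refine h1.congr ?_
      filter_upwards [hv] with ξ h
      simp only [RCLike.inner_apply, Complex.real_smul, h, Complex.star_def]
      ring
    refine ae_eq_zero_of_fourier_eq_zero hW fun a => ?_
    obtain ⟨v', hv', h0⟩ := hS (fun x => φ n (x - -a)) (by have := hφ n; fun_prop)
      ((hφc n).comp_homeomorph (Homeomorph.subRight (-a)))
    rw [inner_freq] at h0
    rw [fourier_eq_char, ← h0]
    refine integral_congr_ae ?_
    filter_upwards [hv'] with ξ h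
    rw [h, fourier_comp_sub_right, star_mul', Complex.star_def, ← Circle.coe_inv_eq_conj,
      ← AddChar.map_neg_eq_inv, inner_neg_left, neg_neg, real_inner_comm ξ a]
    ring
  rw [Lp.eq_zero_iff_ae_eq_zero, Filter.EventuallyEq, ae_freqMeasure_eq]
  filter_upwards [ae_all_iff.2 key, ae_ne_point (0 : E N)] with ξ h h0
  obtain ⟨n, hn⟩ := hφ0 ξ
  have h1 := h n
  have : 0 < ‖ξ‖ := norm_pos_iff.2 h0
  have h2 : ((‖ξ‖ ^ ((N : ℝ) - 2 * μ) : ℝ) : ℂ) ≠ 0 := by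
    rw [Complex.ofReal_ne_zero]; positivity
  simpa [h2, hn] using h1

end Branching
end

noncomputable section

namespace Branching

variable {N : ℕ} {μ : ℝ}

/-! ## The Riesz potential form -/

theorem sq_rpow {x : ℝ} (hx : 0 ≤ x) (a : ℝ) : (x ^ 2) ^ a = x ^ (2 * a) := by
  rw [← Real.rpow_natCast, ← Real.rpow_mul hx]; norm_num

theorem ae_prod_ne [NeZero N] : ∀ᵐ z : E N × E N, z.1 ≠ z.2 := by
  have hs : MeasurableSet {z : E N × E N | z.1 ≠ z.2} :=
    (isClosed_eq continuous_fst continuous_snd).measurableSet.compl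
  rw [Measure.volume_eq_prod, Measure.ae_prod_iff_ae_ae hs]
  exact .of_forall fun x => (ae_ne_point x).mono fun y hy => hy.symm

/-- The constant relating `|x|^{-2μ}` and the Fourier transform of `|ξ|^{2μ-N}`. -/
def rieszConst (N : ℕ) (μ : ℝ) : ℝ :=
  (Real.Gamma μ * Real.pi ^ (-μ)) /
    (Real.Gamma ((N : ℝ) / 2 - μ) * Real.pi ^ (-((N : ℝ) / 2 - μ)))

theorem rieszConst_pos [h : ComplementaryRange N μ] : 0 < rieszConst N μ := by
  have h1 := Real.Gamma_pos_of_pos h.pos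
  have h2 := Real.Gamma_pos_of_pos (sub_pos.2 h.lt)
  unfold rieszConst; positivity

theorem mul_eq_mul_rieszConst [h : ComplementaryRange N μ] {A B : ℂ}
    (hAB : (Real.Gamma μ * Real.pi ^ (-μ) : ℝ) * A =
      (Real.Gamma ((N : ℝ) / 2 - μ) * Real.pi ^ (-((N : ℝ) / 2 - μ)) : ℝ) * B) :
    B = (rieszConst N μ : ℂ) * A := by
  have h2 := Real.Gamma_pos_of_pos (sub_pos.2 h.lt)
  have h3 : 0 < Real.Gamma ((N : ℝ) / 2 - μ) * Real.pi ^ (-((N : ℝ) / 2 - μ)) := by positivity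
  have h4 : ((Real.Gamma ((N : ℝ) / 2 - μ) * Real.pi ^ (-((N : ℝ) / 2 - μ)) : ℝ) : ℂ) ≠ 0 :=
    Complex.ofReal_ne_zero.2 h3.ne'
  rw [rieszConst, Complex.ofReal_div, div_mul_eq_mul_div, hAB, mul_div_cancel_left₀ _ h4]

/-- Subordination with `p = |x-y|²`, `q = |ξ|²` and `b = N/2 - μ`. Integrability on the frequency
side is a conclusion, since `|𝓕 g|²` is nonnegative. -/
theorem riesz_form [h : ComplementaryRange N μ] {g : E N → ℂ} (hg : Integrable g)
    (hK : Integrable fun z : E N × E N =>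
      ((‖z.1 - z.2‖ ^ (-(2 * μ)) : ℝ) : ℂ) * (g z.1 * star (g z.2))) :
    Integrable (fun ξ => ‖ξ‖ ^ (2 * μ - N) * ‖𝓕 g ξ‖ ^ 2) ∧
    ((∫ ξ, ‖ξ‖ ^ (2 * μ - N) * ‖𝓕 g ξ‖ ^ 2 : ℝ) : ℂ) = (rieszConst N μ : ℂ) *
      ∫ z : E N × E N, ((‖z.1 - z.2‖ ^ (-(2 * μ)) : ℝ) : ℂ) * (g z.1 * star (g z.2)) := by
  have := ComplementaryRange.neZero (N := N) (μ := μ)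
  have hb : 0 < (N : ℝ) / 2 - μ := sub_pos.2 h.lt
  have hp : Measurable fun z : E N × E N => ‖z.1 - z.2‖ ^ 2 := by fun_prop
  have hp0 : ∀ᵐ z : E N × E N, 0 < ‖z.1 - z.2‖ ^ 2 := ae_prod_ne.mono fun z hz => by
    have := norm_pos_iff.2 (sub_ne_zero.2 hz); positivity
  have hq : Measurable fun ξ : E N => ‖ξ‖ ^ 2 := by fun_prop
  have hq0 : ∀ᵐ ξ : E N, 0 < ‖ξ‖ ^ 2 := (ae_ne_point 0).mono fun z hz => by
    have := norm_pos_iff.2 hz; positivity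
  have hG : AEStronglyMeasurable (fun z : E N × E N => g z.1 * star (g z.2)) := by
    rw [Measure.volume_eq_prod]
    exact AEStronglyMeasurable.mul (f := fun z : E N × E N => g z.1) hg.1.comp_fst
      (continuous_star.comp_aestronglyMeasurable hg.1.comp_snd)
  have hKc : Continuous fun ξ => ‖𝓕 g ξ‖ ^ 2 := (continuous_fourier_of_integrable hg).norm.pow 2
  have hGK : ∀ t > 0, ∫ z : E N × E N, (Real.exp (-(Real.pi * t * ‖z.1 - z.2‖ ^ 2)) : ℂ) *
      (g z.1 * star (g z.2)) = ((t ^ (-(μ + ((N : ℝ) / 2 - μ))) : ℝ) : ℂ) *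
        ∫ ξ, (Real.exp (-(Real.pi * ‖ξ‖ ^ 2 / t)) : ℂ) * ((‖𝓕 g ξ‖ ^ 2 : ℝ) : ℂ) := by
    intro t ht
    rw [add_sub_cancel]; exact gaussian_sesquilinear hg ht
  have hpG : Integrable fun z : E N × E N =>
      (((‖z.1 - z.2‖ ^ 2) ^ (-μ) : ℝ) : ℂ) * (g z.1 * star (g z.2)) := by
    simp_rw [sq_rpow (norm_nonneg _), mul_neg]; exact hK
  have e : ∀ ξ : E N, (‖ξ‖ ^ 2) ^ (-((N : ℝ) / 2 - μ)) = ‖ξ‖ ^ (2 * μ - N) := fun ξ => by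
    rw [sq_rpow (norm_nonneg _)]; congr 1; ring
  have hqK : Integrable fun ξ => (‖ξ‖ ^ 2) ^ (-((N : ℝ) / 2 - μ)) * ‖𝓕 g ξ‖ ^ 2 := by
    refine integrable_of_subordination h.pos hb hp hp0 hG hq hq0 hKc.aestronglyMeasurable
      (fun ξ => by positivity) hGK (fun t ht => ?_) hpG
    have h1 := (integrable_gaussian_dilate (N := N) ht).re
    simp only [RCLike.re_eq_complex_re, Complex.ofReal_re] at h1
    refine h1.mul_bdd (c := (∫ x, ‖g x‖) ^ 2) hKc.aestronglyMeasurable (.of_forall fun ξ => ?_)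
    rw [Real.norm_of_nonneg (by positivity)]
    have := norm_fourier_le (g := g) ξ
    gcongr
  refine ⟨by simpa only [e] using hqK, ?_⟩
  have hqK' : Integrable fun ξ =>
      (((‖ξ‖ ^ 2) ^ (-((N : ℝ) / 2 - μ)) : ℝ) : ℂ) * ((‖𝓕 g ξ‖ ^ 2 : ℝ) : ℂ) :=
    (Integrable.ofReal (𝕜 := ℂ) hqK).congr (.of_forall fun ξ => by simp)
  have key := mul_eq_mul_rieszConst (subordination h.pos hb hp hp0 hG hq hq0
    (Complex.continuous_ofReal.comp hKc).aestronglyMeasurable hGK hpG hqK')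
  simp_rw [sq_rpow (norm_nonneg _), mul_neg] at key
  rw [← key, ← integral_complex_ofReal]
  refine integral_congr_ae (.of_forall fun ξ => ?_)
  simp only
  rw [← mul_neg, ← sq_rpow (norm_nonneg _), e, Complex.ofReal_mul]; rfl

/-- The Fourier transform of the tempered distribution `|x|^{-2μ}`. -/
theorem riesz_fourier [h : ComplementaryRange N μ] {φ : E N → ℂ} (hφ : Integrable φ)
    (h1 : Integrable fun x => ((‖x‖ ^ (-(2 * μ)) : ℝ) : ℂ) * 𝓕 φ x)
    (h2 : Integrable fun ξ => ((‖ξ‖ ^ (2 * μ - N) : ℝ) : ℂ) * φ ξ) :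
    ∫ ξ, ((‖ξ‖ ^ (2 * μ - N) : ℝ) : ℂ) * φ ξ
      = (rieszConst N μ : ℂ) * ∫ x, ((‖x‖ ^ (-(2 * μ)) : ℝ) : ℂ) * 𝓕 φ x := by
  have := ComplementaryRange.neZero (N := N) (μ := μ)
  have hb : 0 < (N : ℝ) / 2 - μ := sub_pos.2 h.lt
  have hq : Measurable fun ξ : E N => ‖ξ‖ ^ 2 := by fun_prop
  have hq0 : ∀ᵐ ξ : E N, 0 < ‖ξ‖ ^ 2 := (ae_ne_point 0).mono fun z hz => by
    have := norm_pos_iff.2 hz; positivity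
  have e : ∀ ξ : E N, (‖ξ‖ ^ 2) ^ (-((N : ℝ) / 2 - μ)) = ‖ξ‖ ^ (2 * μ - N) := fun ξ => by
    rw [sq_rpow (norm_nonneg _)]; congr 1; ring
  have e' : ∀ ξ : E N, (‖ξ‖ ^ 2) ^ (-μ) = ‖ξ‖ ^ (-(2 * μ)) := fun ξ => by
    rw [sq_rpow (norm_nonneg _)]; congr 1; ring
  have key := subordination (μ := μ) (b := (N : ℝ) / 2 - μ) (ρ := (volume : Measure (E N)))
    (σ := (volume : Measure (E N))) (G := 𝓕 φ) (K := φ) h.pos hb hq hq0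
    (continuous_fourier_of_integrable hφ).aestronglyMeasurable hq hq0 hφ.1
    (fun t ht => by rw [add_sub_cancel]; exact gaussian_pairing hφ ht)
    (by simpa only [e'] using h1) (by simpa only [e] using h2)
  simp only [e, e'] at key
  exact mul_eq_mul_rieszConst key

/-! ## The weight -/

/-- The weight `(1 + |x|²)^{-(N - μ)}`. -/
def weight (N : ℕ) (μ : ℝ) (x : E N) : ℝ := (1 + ‖x‖ ^ 2) ^ (-((N : ℝ) - μ))

theorem weight_pos (x : E N) : 0 < weight N μ x := by unfold weight; positivity

theorem continuous_weight : Continuous (weight N μ) := by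
  unfold weight
  exact (by fun_prop : Continuous fun x : E N => 1 + ‖x‖ ^ 2).rpow_const
    fun x => Or.inl (by positivity)

theorem weight_le_one [ComplementaryRange N μ] (x : E N) : weight N μ x ≤ 1 := by
  have := range_pos N μ
  have := range_lt N μ
  exact Real.rpow_le_one_of_one_le_of_nonpos (by nlinarith [sq_nonneg ‖x‖]) (by linarith)

theorem integrable_weight [ComplementaryRange N μ] : Integrable (weight N μ) := by
  have := range_lt N μ
  have h := integrable_rpow_neg_one_add_norm_sq (E := E N) (μ := volume)
    (r := 2 * ((N : ℝ) - μ)) (by simp; linarith)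
  refine h.congr (.of_forall fun x => ?_)
  simp only [weight]; congr 1; ring

variable (N μ) in
theorem weight_riesz_bound [ComplementaryRange N μ] : ∃ C : ℝ, 0 ≤ C ∧ ∀ y : E N,
    Integrable (fun x => ‖x - y‖ ^ (-(2 * μ)) * weight N μ x) ∧
      ∫ x, ‖x - y‖ ^ (-(2 * μ)) * weight N μ x ≤ C := by
  have := ComplementaryRange.neZero (N := N) (μ := μ)
  have h1 := range_pos N μ
  have h2 := range_lt N μ
  obtain ⟨C₀, h0, h⟩ := riesz_bound (N := N) (a := 2 * μ) (by linarith) (by linarith)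
  exact ⟨C₀ * 1 + ∫ x, weight N μ x,
    add_nonneg (by linarith) (integral_nonneg fun x => (weight_pos x).le), fun y =>
    h 1 _ (fun x => (weight_pos x).le) weight_le_one integrable_weight y⟩

/-- Functions whose square is integrable against the inverse of the weight. -/
structure WeightedSq (N : ℕ) (μ : ℝ) (g : E N → ℂ) : Prop where
  meas : AEStronglyMeasurable g
  int : Integrable fun x => ‖g x‖ ^ 2 / weight N μ x

theorem WeightedSq.integrable [ComplementaryRange N μ] {g : E N → ℂ} (hg : WeightedSq N μ g) :
    Integrable g := by
  refine (hg.int.add (integrable_weight (N := N) (μ := μ))).mono' hg.meas (.of_forall fun x => ?_)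
  have hw := weight_pos (μ := μ) x
  simp only [Pi.add_apply]
  rw [div_add' _ _ _ hw.ne', le_div_iff₀ hw]
  nlinarith [sq_nonneg (‖g x‖ - weight N μ x), norm_nonneg (g x)]

variable (N μ) in
-- The Schur test with the weight `w`: `|g(x) g(y)|` is at most the mean of `|g(x)|² w(y)/w(x)` and
-- `|g(y)|² w(x)/w(y)`, and `∫ |x-y|^{-2μ} w(y) dy` is bounded uniformly in `x` by
-- `weight_riesz_bound`.
theorem exists_schur_bound [ComplementaryRange N μ] : ∃ C : ℝ, 0 ≤ C ∧ ∀ g : E N → ℂ, WeightedSq N μ g →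
    Integrable (fun z : E N × E N => ((‖z.1 - z.2‖ ^ (-(2 * μ)) : ℝ) : ℂ) * (g z.1 * star (g z.2)))
    ∧ ‖∫ z : E N × E N, ((‖z.1 - z.2‖ ^ (-(2 * μ)) : ℝ) : ℂ) * (g z.1 * star (g z.2))‖
      ≤ C * ∫ x, ‖g x‖ ^ 2 / weight N μ x := by
  obtain ⟨C, hC0, hC⟩ := weight_riesz_bound N μ
  refine ⟨C, hC0, fun g hg => ?_⟩
  set A : E N × E N → ℝ := fun z =>
    (‖g z.1‖ ^ 2 / weight N μ z.1) * (‖z.2 - z.1‖ ^ (-(2 * μ)) * weight N μ z.2) with hA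
  have hA0 : ∀ z, 0 ≤ A z := fun z => by
    have := weight_pos (μ := μ) z.1; have := weight_pos (μ := μ) z.2; positivity
  have hkm : Measurable fun z : E N × E N => ‖z.2 - z.1‖ ^ (-(2 * μ)) * weight N μ z.2 :=
    (by fun_prop : Measurable fun z : E N × E N => ‖z.2 - z.1‖ ^ (-(2 * μ))).mul
      (continuous_weight.measurable.comp measurable_snd)
  have hAm : AEStronglyMeasurable A (volume.prod volume) :=
    AEStronglyMeasurable.mul (f := fun z : E N × E N => ‖g z.1‖ ^ 2 / weight N μ z.1)
      hg.int.1.comp_fst hkm.aestronglyMeasurable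
  have hinner : ∀ x : E N, ∫ y, A (x, y) = (‖g x‖ ^ 2 / weight N μ x) *
      ∫ y, ‖y - x‖ ^ (-(2 * μ)) * weight N μ y := fun x => by
    rw [← integral_const_mul]
  have hle : ∀ x : E N, ∫ y, A (x, y) ≤ C * (‖g x‖ ^ 2 / weight N μ x) := fun x => by
    have := weight_pos (μ := μ) x
    rw [hinner, mul_comm C]
    gcongr
    exact (hC x).2
  have hAi : Integrable A (volume.prod volume) := by
    rw [integrable_prod_iff hAm]
    refine ⟨.of_forall fun x => (hC x).1.const_mul (‖g x‖ ^ 2 / weight N μ x), ?_⟩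
    refine (hg.int.const_mul C).mono' hAm.norm.integral_prod_right' (.of_forall fun x => ?_)
    rw [Real.norm_of_nonneg (integral_nonneg fun y => norm_nonneg _)]
    simp_rw [Real.norm_of_nonneg (hA0 _)]
    exact hle x
  have hAint : ∫ z, A z ∂(volume.prod volume) ≤ C * ∫ x, ‖g x‖ ^ 2 / weight N μ x := by
    rw [integral_prod _ hAi, ← integral_const_mul]
    exact integral_mono hAi.integral_prod_left (hg.int.const_mul C) hle
  have hAs : Integrable (fun z => A z.swap) (volume.prod volume) := hAi.swap
  have hAsint : ∫ z, A (Prod.swap z) ∂(volume.prod volume) = ∫ z, A z ∂(volume.prod volume) :=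
    integral_prod_swap A
  have hbound : ∀ z : E N × E N, ‖((‖z.1 - z.2‖ ^ (-(2 * μ)) : ℝ) : ℂ) * (g z.1 * star (g z.2))‖
      ≤ (A z + A z.swap) / 2 := by
    intro z
    have h1 := weight_pos (μ := μ) z.1
    have h2 := weight_pos (μ := μ) z.2
    simp only [norm_mul, norm_star, Complex.norm_real, hA, Prod.fst_swap, Prod.snd_swap]
    rw [Real.norm_of_nonneg (by positivity), norm_sub_rev z.2 z.1]
    set r := ‖z.1 - z.2‖ ^ (-(2 * μ))
    have hr : 0 ≤ r := by positivity
    have key : ‖g z.1‖ * ‖g z.2‖ ≤ (‖g z.1‖ ^ 2 / weight N μ z.1 * weight N μ z.2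
        + ‖g z.2‖ ^ 2 / weight N μ z.2 * weight N μ z.1) / 2 := by
      rw [div_mul_eq_mul_div, div_mul_eq_mul_div, div_add_div _ _ h1.ne' h2.ne', div_div,
        le_div_iff₀ (by positivity)]
      nlinarith [sq_nonneg (‖g z.1‖ * weight N μ z.2 - ‖g z.2‖ * weight N μ z.1)]
    calc r * (‖g z.1‖ * ‖g z.2‖) ≤ r * _ := mul_le_mul_of_nonneg_left key hr
      _ = _ := by ring
  have hm : AEStronglyMeasurable (fun z : E N × E N =>
      ((‖z.1 - z.2‖ ^ (-(2 * μ)) : ℝ) : ℂ) * (g z.1 * star (g z.2))) (volume.prod volume) := by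
    refine AEStronglyMeasurable.mul
      (by fun_prop : Measurable fun z : E N × E N =>
        ((‖z.1 - z.2‖ ^ (-(2 * μ)) : ℝ) : ℂ)).aestronglyMeasurable ?_
    exact AEStronglyMeasurable.mul (f := fun z : E N × E N => g z.1) hg.meas.comp_fst
      (continuous_star.comp_aestronglyMeasurable hg.meas.comp_snd)
  have hi := (hAi.add hAs).div_const 2
  refine ⟨hi.mono' hm (.of_forall hbound), ?_⟩
  rw [Measure.volume_eq_prod]
  refine (norm_integral_le_of_norm_le hi (.of_forall hbound)).trans ?_
  simp only [Pi.add_apply]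
  rw [integral_div, integral_add hAi hAs, hAsint]
  linarith

end Branching
end

noncomputable section

namespace Branching

variable {N : ℕ} {μ : ℝ}

/-! ## Elements of the complementary series -/

section FreqVec

variable [ComplementaryRange N μ]

/-- The element of `𝒞_μ` with a given Fourier transform. -/
def freqVec (F : E N → ℂ) (hF : MemLp F 2 (freqMeasure N μ)) : CompSeries N μ :=
  ⟨hF.toLp F, by rw [compSubmodule_eq_top]; trivial⟩

theorem freqVec_ae {F : E N → ℂ} (hF : MemLp F 2 (freqMeasure N μ)) :
    ((freqVec F hF : CompSeries N μ) : Lp ℂ 2 (freqMeasure N μ)) =ᵐ[volume] F := by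
  have := hF.coeFn_toLp
  rwa [Filter.EventuallyEq, ae_freqMeasure_eq] at this

theorem CompSeries.ext_ae {u v : CompSeries N μ}
    (h : (u : Lp ℂ 2 (freqMeasure N μ)) =ᵐ[volume] (v : Lp ℂ 2 (freqMeasure N μ))) : u = v := by
  refine Subtype.ext (Lp.ext ?_)
  rwa [Filter.EventuallyEq, ae_freqMeasure_eq]

theorem CompSeries.coe_add_ae (u v : CompSeries N μ) :
    ((u + v : CompSeries N μ) : Lp ℂ 2 (freqMeasure N μ)) =ᵐ[volume]
      fun ξ => (u : Lp ℂ 2 (freqMeasure N μ)) ξ + (v : Lp ℂ 2 (freqMeasure N μ)) ξ := by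
  have := Lp.coeFn_add (u : Lp ℂ 2 (freqMeasure N μ)) (v : Lp ℂ 2 (freqMeasure N μ))
  rwa [Filter.EventuallyEq, ae_freqMeasure_eq] at this

theorem CompSeries.coe_smul_ae (c : ℂ) (u : CompSeries N μ) :
    ((c • u : CompSeries N μ) : Lp ℂ 2 (freqMeasure N μ)) =ᵐ[volume]
      fun ξ => c * (u : Lp ℂ 2 (freqMeasure N μ)) ξ := by
  have := Lp.coeFn_smul c (u : Lp ℂ 2 (freqMeasure N μ))
  rwa [Filter.EventuallyEq, ae_freqMeasure_eq] at this

theorem CompSeries.aestronglyMeasurable (u : CompSeries N μ) :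
    AEStronglyMeasurable (u : Lp ℂ 2 (freqMeasure N μ)) :=
  aestronglyMeasurable_freq_iff.1 (Lp.aestronglyMeasurable _)

omit [ComplementaryRange N μ] in
theorem CompSeries.inner_eq (u v : CompSeries N μ) :
    inner ℂ u v = ∫ ξ, ((‖ξ‖ ^ ((N : ℝ) - 2 * μ) : ℝ) : ℂ) *
      (star ((u : Lp ℂ 2 (freqMeasure N μ)) ξ) * (v : Lp ℂ 2 (freqMeasure N μ)) ξ) :=
  inner_freq _ _

theorem memLp_freq_iff {F : E N → ℂ} (hF : AEStronglyMeasurable F) :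
    MemLp F 2 (freqMeasure N μ) ↔ Integrable fun ξ => ‖ξ‖ ^ ((N : ℝ) - 2 * μ) * ‖F ξ‖ ^ 2 := by
  rw [memLp_two_iff_integrable_sq_norm (aestronglyMeasurable_freq_iff.2 hF), integrable_freq_iff]
  rfl

theorem CompSeries.norm_sq_eq (u : CompSeries N μ) :
    ‖u‖ ^ 2 = ∫ ξ, ‖ξ‖ ^ ((N : ℝ) - 2 * μ) * ‖(u : Lp ℂ 2 (freqMeasure N μ)) ξ‖ ^ 2 := by
  have h : ((‖u‖ ^ 2 : ℝ) : ℂ) = _ := (by simpa using (inner_self_eq_norm_sq_to_K (𝕜 := ℂ) u).symm :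
    ((‖u‖ ^ 2 : ℝ) : ℂ) = inner ℂ u u).trans (CompSeries.inner_eq u u)
  rw [← Complex.ofReal_inj, h, ← integral_complex_ofReal]
  refine integral_congr_ae (.of_forall fun ξ => ?_)
  simp only
  rw [Complex.star_def, ← Complex.normSq_eq_conj_mul_self, Complex.normSq_eq_norm_sq]
  push_cast; rfl

theorem ae_norm_pos (N : ℕ) [NeZero N] : ∀ᵐ ξ : E N, 0 < ‖ξ‖ :=
  (ae_ne_point 0).mono fun _ h => norm_pos_iff.2 h

theorem rpow_mul_rpow_neg_cancel {r : ℝ} (hr : 0 < r) (a b : ℝ) (hab : a + b = 0) :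
    r ^ a * r ^ b = 1 := by rw [← Real.rpow_add hr, hab, Real.rpow_zero]

/-- The function `|ξ|^{2μ-N} F` is in the frequency space if `F` is in the dual one. -/
theorem memLp_dual {F : E N → ℂ} (hF : AEStronglyMeasurable F)
    (h : Integrable fun ξ => ‖ξ‖ ^ (2 * μ - N) * ‖F ξ‖ ^ 2) :
    MemLp (fun ξ => ((‖ξ‖ ^ (2 * μ - N) : ℝ) : ℂ) * F ξ) 2 (freqMeasure N μ) := by
  have := ComplementaryRange.neZero (N := N) (μ := μ)
  rw [memLp_freq_iff]
  · refine h.congr ?_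
    filter_upwards [ae_norm_pos N] with ξ hξ
    rw [norm_mul, Complex.norm_real, Real.norm_of_nonneg (by positivity), mul_pow, ← mul_assoc,
      pow_two (‖ξ‖ ^ (2 * μ - N)), ← mul_assoc,
      rpow_mul_rpow_neg_cancel hξ _ _ (by ring), one_mul]
  · exact (by fun_prop : Measurable fun ξ : E N =>
      ((‖ξ‖ ^ (2 * μ - N) : ℝ) : ℂ)).aestronglyMeasurable.mul hF

theorem norm_sq_dual {F : E N → ℂ}
    (h : MemLp (fun ξ => ((‖ξ‖ ^ (2 * μ - N) : ℝ) : ℂ) * F ξ) 2 (freqMeasure N μ)) :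
    ‖freqVec _ h‖ ^ 2 = ∫ ξ, ‖ξ‖ ^ (2 * μ - N) * ‖F ξ‖ ^ 2 := by
  have := ComplementaryRange.neZero (N := N) (μ := μ)
  rw [CompSeries.norm_sq_eq]
  refine integral_congr_ae ?_
  filter_upwards [ae_norm_pos N, freqVec_ae h] with ξ hξ h1
  rw [h1, norm_mul, Complex.norm_real, Real.norm_of_nonneg (by positivity), mul_pow, ← mul_assoc,
      pow_two (‖ξ‖ ^ (2 * μ - N)), ← mul_assoc,
      rpow_mul_rpow_neg_cancel hξ _ _ (by ring), one_mul]

/-- The density of the measure cancels the factor `|ξ|^{2μ-N}`, so the Hilbert space inner product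
becomes an unweighted pairing, as in the pairing of distributions. -/
theorem inner_dual {F : E N → ℂ} (u v : CompSeries N μ)
    (h : (v : Lp ℂ 2 (freqMeasure N μ)) =ᵐ[volume]
      fun ξ => ((‖ξ‖ ^ (2 * μ - N) : ℝ) : ℂ) * F ξ) :
    Integrable (fun ξ => star (F ξ) * (u : Lp ℂ 2 (freqMeasure N μ)) ξ) ∧
    inner ℂ v u = ∫ ξ, star (F ξ) * (u : Lp ℂ 2 (freqMeasure N μ)) ξ := by
  have := ComplementaryRange.neZero (N := N) (μ := μ)
  have e : (fun ξ => ((‖ξ‖ ^ ((N : ℝ) - 2 * μ) : ℝ) : ℂ) *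
      (star ((v : Lp ℂ 2 (freqMeasure N μ)) ξ) * (u : Lp ℂ 2 (freqMeasure N μ)) ξ))
      =ᵐ[volume] fun ξ => star (F ξ) * (u : Lp ℂ 2 (freqMeasure N μ)) ξ := by
    filter_upwards [ae_norm_pos N, h] with ξ hξ h1
    rw [h1, star_mul', Complex.star_def, Complex.conj_ofReal, ← mul_assoc, ← mul_assoc,
      ← Complex.ofReal_mul, rpow_mul_rpow_neg_cancel hξ _ _ (by ring), Complex.ofReal_one, one_mul]
  refine ⟨?_, ?_⟩
  · have h1 := L2.integrable_inner (𝕜 := ℂ) (v : Lp ℂ 2 (freqMeasure N μ)) u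
    rw [integrable_freq_iff] at h1
    refine (h1.congr (.of_forall fun ξ => ?_)).congr e
    simp only [RCLike.inner_apply, Complex.real_smul, Complex.star_def]
    ring
  · rw [CompSeries.inner_eq]
    exact integral_congr_ae e

/-- The only singularity is at the origin and is integrable: this is `riesz_bound` with exponent `N
- 2μ < N` and centre `0`. -/
theorem schwartz_dual (φ : 𝓢(E N, ℂ)) :
    Integrable fun ξ => ‖ξ‖ ^ (2 * μ - N) * ‖φ ξ‖ ^ 2 := by
  have := ComplementaryRange.neZero (N := N) (μ := μ)
  obtain ⟨C₀, -, h⟩ := riesz_bound (N := N) (a := N - 2 * μ) (range_lt N μ).le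
    (by linarith [range_pos N μ])
  have h1 : Integrable fun ξ => ‖φ ξ‖ ^ 2 := (memLp_two_iff_integrable_sq_norm
    φ.continuous.aestronglyMeasurable).1 (φ.memLp 2)
  have h2 := (h ((SchwartzMap.seminorm ℂ 0 0 φ) ^ 2) (fun ξ => ‖φ ξ‖ ^ 2) (fun ξ => by positivity)
    (fun ξ => by have := φ.norm_le_seminorm ℂ ξ; gcongr) h1 0).1
  simpa using h2

theorem integrable_mul_schwartz (u : CompSeries N μ) (φ : 𝓢(E N, ℂ)) :
    Integrable fun ξ => (u : Lp ℂ 2 (freqMeasure N μ)) ξ * φ ξ := by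
  have h := memLp_dual (F := fun ξ => star (φ ξ)) (μ := μ)
    (continuous_star.comp φ.continuous).aestronglyMeasurable (by simpa using schwartz_dual φ)
  have := (inner_dual u _ (freqVec_ae h)).1
  simpa [mul_comm] using this

theorem Realizes.unique_left {u v : CompSeries N μ} {f g : E N → ℂ} (hu : Realizes u f)
    (hv : Realizes v g) (hfg : f =ᵐ[volume] g) : u = v := by
  refine CompSeries.ext_ae ?_
  have h0 := ae_eq_zero_of_forall_schwartz (U := fun ξ => (u : Lp ℂ 2 (freqMeasure N μ)) ξ -
    (v : Lp ℂ 2 (freqMeasure N μ)) ξ)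
    (fun φ => by
      simp only [sub_mul]
      exact (integrable_mul_schwartz u φ).sub (integrable_mul_schwartz v φ))
    (fun φ => by
      simp only [sub_mul]
      rw [integral_sub (integrable_mul_schwartz u φ) (integrable_mul_schwartz v φ),
        ← (hu φ).2.2, ← (hv φ).2.2, sub_eq_zero]
      exact integral_congr_ae (hfg.mono fun x hx => by simp only [hx]))
  filter_upwards [h0] with ξ h using sub_eq_zero.1 h

omit [ComplementaryRange N μ] in
theorem Realizes.unique_right {u : CompSeries N μ} {f g : E N → ℂ} (hf : Realizes u f)
    (hg : Realizes u g) : f =ᵐ[volume] g := by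
  have h0 := ae_eq_zero_of_forall_schwartz (U := fun x => f x - g x)
    (fun φ => by simp only [sub_mul]; exact (hf φ).1.sub (hg φ).1)
    (fun φ => by
      simp only [sub_mul]
      rw [integral_sub (hf φ).1 (hg φ).1, sub_eq_zero]
      have h1 := (hf (𝓕⁻ φ)).2.2.trans (hg (𝓕⁻ φ)).2.2.symm
      rwa [FourierTransform.fourier_fourierInv_eq] at h1)
  filter_upwards [h0] with ξ h using sub_eq_zero.1 h

omit [ComplementaryRange N μ] in
theorem Realizes.congr {u : CompSeries N μ} {f g : E N → ℂ} (hf : Realizes u f)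
    (hfg : f =ᵐ[volume] g) : Realizes u g := fun φ => by
  obtain ⟨h1, h2, h3⟩ := hf φ
  refine ⟨h1.congr (hfg.mono fun x hx => by simp only [hx]), h2, ?_⟩
  rw [← h3]
  exact integral_congr_ae (hfg.mono fun x hx => by simp only [hx])

theorem Realizes.add {u v : CompSeries N μ} {f g : E N → ℂ} (hf : Realizes u f)
    (hg : Realizes v g) : Realizes (u + v) fun x => f x + g x := fun φ => by
  refine ⟨by simp only [add_mul]; exact (hf φ).1.add (hg φ).1, integrable_mul_schwartz _ _, ?_⟩
  simp only [add_mul]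
  rw [integral_add (hf (𝓕 φ)).1 (hg (𝓕 φ)).1, (hf φ).2.2, (hg φ).2.2,
    ← integral_add (hf φ).2.1 (hg φ).2.1]
  refine integral_congr_ae ?_
  filter_upwards [CompSeries.coe_add_ae u v] with ξ h
  rw [h]; ring

end FreqVec
end Branching
end

noncomputable section

namespace Branching

variable {N : ℕ} {μ : ℝ}

/-! ## The realization of elements as functions -/

/-- The measure `(1 + |x|²)^{-(N - μ)} dx`. -/
def weightMeasure (N : ℕ) (μ : ℝ) : Measure (E N) :=
  volume.withDensity fun x => ENNReal.ofReal (weight N μ x)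

theorem measurable_weightDensity :
    Measurable fun x : E N => ENNReal.ofReal (weight N μ x) :=
  continuous_weight.measurable.ennreal_ofReal

theorem ae_weightMeasure_eq : ae (weightMeasure N μ) = ae (volume : Measure (E N)) := by
  ext s
  change (∀ᵐ x ∂weightMeasure N μ, x ∈ s) ↔ ∀ᵐ x : E N, x ∈ s
  rw [weightMeasure, ae_withDensity_iff measurable_weightDensity]
  refine Filter.eventually_congr (.of_forall fun x => ?_)
  simp [weight_pos]

theorem aestronglyMeasurable_weight_iff {f : E N → ℂ} :
    AEStronglyMeasurable f (weightMeasure N μ) ↔ AEStronglyMeasurable f := by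
  have h1 : weightMeasure N μ ≪ volume := withDensity_absolutelyContinuous _ _
  have h2 : volume ≪ weightMeasure N μ := fun s hs => by
    have h : ∀ᵐ ξ ∂weightMeasure N μ, ξ ∉ s := measure_eq_zero_iff_ae_notMem.1 hs
    rw [ae_weightMeasure_eq] at h
    exact measure_eq_zero_iff_ae_notMem.2 h
  exact ⟨fun h => h.mono_ac h2, fun h => h.mono_ac h1⟩

theorem integrable_weightMeasure_iff {F : Type*} [NormedAddCommGroup F] [NormedSpace ℝ F]
    {f : E N → F} :
    Integrable f (weightMeasure N μ) ↔ Integrable fun x => weight N μ x • f x := by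
  rw [weightMeasure, integrable_withDensity_iff_integrable_smul' measurable_weightDensity (by simp)]
  refine integrable_congr (.of_forall fun ξ => ?_)
  simp only
  rw [ENNReal.toReal_ofReal (weight_pos _).le]

theorem integral_weightMeasure {F : Type*} [NormedAddCommGroup F] [NormedSpace ℝ F] (f : E N → F) :
    ∫ x, f x ∂weightMeasure N μ = ∫ x, weight N μ x • f x := by
  rw [weightMeasure,
    integral_withDensity_eq_integral_toReal_smul measurable_weightDensity (by simp)]
  refine integral_congr_ae (.of_forall fun ξ => ?_)
  simp only
  rw [ENNReal.toReal_ofReal (weight_pos _).le]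

theorem memLp_weight_iff {f : E N → ℂ} (hf : AEStronglyMeasurable f) :
    MemLp f 2 (weightMeasure N μ) ↔ Integrable fun x => weight N μ x * ‖f x‖ ^ 2 := by
  rw [memLp_two_iff_integrable_sq_norm (aestronglyMeasurable_weight_iff.2 hf),
    integrable_weightMeasure_iff]
  rfl

instance : CompleteSpace (CompSeries N μ) :=
  (Submodule.isClosed_topologicalClosure _).completeSpace_coe

section Realization

variable [ComplementaryRange N μ]

instance : IsFiniteMeasure (weightMeasure N μ) := by
  have h : Integrable (fun _ : E N => (1 : ℝ)) (weightMeasure N μ) := by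
    rw [integrable_weightMeasure_iff]; simpa using integrable_weight
  exact (integrable_const_iff_isFiniteMeasure one_ne_zero).1 h

omit [ComplementaryRange N μ] in
theorem weightedSq_of_memLp {G : E N → ℂ} (hG : MemLp G 2 (weightMeasure N μ)) :
    WeightedSq N μ fun x => (weight N μ x : ℂ) * G x := by
  have hm := aestronglyMeasurable_weight_iff.1 hG.1
  refine ⟨(Complex.continuous_ofReal.comp continuous_weight).aestronglyMeasurable.mul hm, ?_⟩
  refine ((memLp_weight_iff hm).1 hG).congr (.of_forall fun x => ?_)
  have := weight_pos (μ := μ) x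
  simp only [norm_mul, Complex.norm_real, Real.norm_of_nonneg this.le]
  field_simp

theorem WeightedSq.memLp {g : E N → ℂ} (hg : WeightedSq N μ g) :
    MemLp (fun ξ => ((‖ξ‖ ^ (2 * μ - N) : ℝ) : ℂ) * 𝓕 g ξ) 2 (freqMeasure N μ) := by
  obtain ⟨C, hC0, hC⟩ := exists_schur_bound N μ
  exact memLp_dual (continuous_fourier_of_integrable hg.integrable).aestronglyMeasurable
    (riesz_form hg.integrable (hC g hg).1).1

variable (N μ) in
-- The squared norm is the Riesz form up to `rieszConst`, and the Schur test bounds that form.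
theorem exists_potential_bound : ∃ C : ℝ, 0 ≤ C ∧ ∀ g : E N → ℂ, (hg : WeightedSq N μ g) →
    ‖freqVec _ hg.memLp‖ ^ 2 ≤ C ^ 2 * ∫ x, ‖g x‖ ^ 2 / weight N μ x := by
  obtain ⟨C, hC0, hC⟩ := exists_schur_bound N μ
  have hc := rieszConst_pos (N := N) (μ := μ)
  refine ⟨Real.sqrt (rieszConst N μ * C), Real.sqrt_nonneg _, fun g hg => ?_⟩
  obtain ⟨h1, h2⟩ := hC g hg
  have h3 := (riesz_form hg.integrable h1).2
  rw [Real.sq_sqrt (by positivity), norm_sq_dual]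
  have h4 := congrArg norm h3
  rw [Complex.norm_real, norm_mul, Complex.norm_real, Real.norm_of_nonneg hc.le,
    Real.norm_of_nonneg (integral_nonneg fun ξ => by positivity)] at h4
  rw [h4, mul_assoc]
  gcongr

theorem fourier_add_of_integrable {f g : E N → ℂ} (hf : Integrable f) (hg : Integrable g) :
    𝓕 (fun x => f x + g x) = fun ξ => 𝓕 f ξ + 𝓕 g ξ :=
  VectorFourier.fourierIntegral_add Real.continuous_fourierChar continuous_inner hf hg

theorem fourier_const_mul (c : ℂ) (f : E N → ℂ) :
    𝓕 (fun x => c * f x) = fun ξ => c * 𝓕 f ξ :=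
  VectorFourier.fourierIntegral_const_smul _ _ _ f c

variable (N μ) in
/-- The bounded map `G ↦ |ξ|^{2μ-N} 𝓕 (weight * G)` from `L²(weight)` to `𝒞_μ`. -/
def potential : Lp ℂ 2 (weightMeasure N μ) →L[ℂ] CompSeries N μ :=
  LinearMap.mkContinuous
    { toFun := fun G => freqVec _ (weightedSq_of_memLp (Lp.memLp G)).memLp
      map_add' := fun G G' => by
        refine CompSeries.ext_ae ?_
        have h1 := Lp.coeFn_add G G'
        rw [Filter.EventuallyEq, ae_weightMeasure_eq] at h1
        have h2 : 𝓕 (fun x => (weight N μ x : ℂ) * (G + G' : Lp ℂ 2 (weightMeasure N μ)) x)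
            = fun ξ => 𝓕 (fun x => (weight N μ x : ℂ) * G x) ξ +
              𝓕 (fun x => (weight N μ x : ℂ) * G' x) ξ := by
          rw [← fourier_add_of_integrable (weightedSq_of_memLp (Lp.memLp G)).integrable
            (weightedSq_of_memLp (Lp.memLp G')).integrable]
          refine fourier_congr_ae (h1.mono fun x hx => ?_)
          simp only [hx, Pi.add_apply]; ring
        filter_upwards [freqVec_ae (weightedSq_of_memLp (Lp.memLp (G + G'))).memLp,
          freqVec_ae (weightedSq_of_memLp (Lp.memLp G)).memLp,
          freqVec_ae (weightedSq_of_memLp (Lp.memLp G')).memLp,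
          CompSeries.coe_add_ae (freqVec _ (weightedSq_of_memLp (Lp.memLp G)).memLp)
            (freqVec _ (weightedSq_of_memLp (Lp.memLp G')).memLp)] with ξ e1 e2 e3 e4
        rw [e1, e4, e2, e3, h2]; ring
      map_smul' := fun c G => by
        refine CompSeries.ext_ae ?_
        have h1 := Lp.coeFn_smul c G
        rw [Filter.EventuallyEq, ae_weightMeasure_eq] at h1
        have h2 : 𝓕 (fun x => (weight N μ x : ℂ) * (c • G : Lp ℂ 2 (weightMeasure N μ)) x)
            = fun ξ => c * 𝓕 (fun x => (weight N μ x : ℂ) * G x) ξ := by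
          rw [← fourier_const_mul]
          refine fourier_congr_ae (h1.mono fun x hx => ?_)
          simp only [hx, Pi.smul_apply, smul_eq_mul]; ring
        filter_upwards [freqVec_ae (weightedSq_of_memLp (Lp.memLp (c • G))).memLp,
          freqVec_ae (weightedSq_of_memLp (Lp.memLp G)).memLp,
          CompSeries.coe_smul_ae c (freqVec _ (weightedSq_of_memLp (Lp.memLp G)).memLp)]
          with ξ e1 e2 e3
        simp only [RingHom.id_apply]
        rw [e1, e3, e2, h2]; ring }
    (exists_potential_bound N μ).choose (fun G => by
      obtain ⟨hC0, hC⟩ := (exists_potential_bound N μ).choose_spec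
      have h := hC _ (weightedSq_of_memLp (Lp.memLp G))
      refine le_of_sq_le_sq (h.trans (le_of_eq ?_)) (by positivity)
      rw [mul_pow]
      congr 1
      have h2 : ((‖G‖ ^ 2 : ℝ) : ℂ) = inner ℂ G G := by simp
      rw [← Complex.ofReal_inj, h2, L2.inner_def, integral_weightMeasure, ← integral_complex_ofReal]
      refine integral_congr_ae (.of_forall fun x => ?_)
      have hw := weight_pos (μ := μ) x
      simp only [norm_mul, Complex.norm_real, Real.norm_of_nonneg hw.le, inner_self_eq_norm_sq_to_K,
        Complex.real_smul]
      norm_cast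
      field_simp
      exact Complex.ofReal_mul _ _)

theorem potential_ae (G : Lp ℂ 2 (weightMeasure N μ)) :
    (potential N μ G : Lp ℂ 2 (freqMeasure N μ)) =ᵐ[volume]
      fun ξ => ((‖ξ‖ ^ (2 * μ - N) : ℝ) : ℂ) * 𝓕 (fun x => (weight N μ x : ℂ) * G x) ξ :=
  freqVec_ae (weightedSq_of_memLp (Lp.memLp G)).memLp

/-! ### Test functions and the functions realizing elements of `𝒞_μ` -/

variable (N μ) in
/-- Measurable functions bounded by a multiple of the weight: a space of test functions that is
invariant under the conformal group. -/
def TestSpace : Submodule ℂ (E N → ℂ) where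
  carrier := {g | AEStronglyMeasurable g ∧ ∃ C, ∀ x, ‖g x‖ ≤ C * weight N μ x}
  zero_mem' := ⟨aestronglyMeasurable_const, 0, fun x => by simp⟩
  add_mem' := by
    rintro g g' ⟨h, C, hC⟩ ⟨h', C', hC'⟩
    refine ⟨h.add h', C + C', fun x => ?_⟩
    rw [add_mul]
    exact (norm_add_le _ _).trans (add_le_add (hC x) (hC' x))
  smul_mem' := by
    rintro c g ⟨h, C, hC⟩
    refine ⟨h.const_smul c, ‖c‖ * C, fun x => ?_⟩
    rw [mul_assoc, Pi.smul_apply, norm_smul]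
    exact mul_le_mul_of_nonneg_left (hC x) (norm_nonneg c)

theorem TestSpace.memLp (g : TestSpace N μ) :
    MemLp (fun x => g.1 x / (weight N μ x : ℂ)) 2 (weightMeasure N μ) := by
  obtain ⟨h, C, hC⟩ := g.2
  refine MemLp.of_bound (aestronglyMeasurable_weight_iff.2
    (h.mul (Complex.continuous_ofReal.comp continuous_weight).measurable.inv.aestronglyMeasurable))
    C (.of_forall fun x => ?_)
  have hw := weight_pos (μ := μ) x
  rw [norm_div, Complex.norm_real, Real.norm_of_nonneg hw.le, div_le_iff₀ hw]
  exact hC x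

variable (N μ) in
/-- The element `|ξ|^{2μ-N} 𝓕 g` of `𝒞_μ` defined by a test function `g`. -/
def testVec : TestSpace N μ →ₗ[ℂ] CompSeries N μ :=
  (potential N μ).toLinearMap.comp (
    { toFun := fun g => (TestSpace.memLp g).toLp _
      map_add' := fun g g' => by
        rw [← MemLp.toLp_add]
        refine MemLp.toLp_congr _ _ (.of_forall fun x => ?_)
        simp [add_div]
      map_smul' := fun c g => by
        change _ = c • _
        rw [← MemLp.toLp_const_smul]
        refine MemLp.toLp_congr _ _ (.of_forall fun x => ?_)
        simp [mul_div_assoc] } : TestSpace N μ →ₗ[ℂ] Lp ℂ 2 (weightMeasure N μ))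

theorem TestSpace.toLp_ae (g : TestSpace N μ) :
    (fun x => (weight N μ x : ℂ) * (TestSpace.memLp g).toLp _ x) =ᵐ[volume] g.1 := by
  have h := (TestSpace.memLp g).coeFn_toLp
  rw [Filter.EventuallyEq, ae_weightMeasure_eq] at h
  filter_upwards [h] with x hx
  have hw := weight_pos (μ := μ) x
  have : (weight N μ x : ℂ) ≠ 0 := Complex.ofReal_ne_zero.2 hw.ne'
  rw [hx, mul_div_cancel₀ _ this]

theorem testVec_ae (g : TestSpace N μ) :
    (testVec N μ g : Lp ℂ 2 (freqMeasure N μ)) =ᵐ[volume]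
      fun ξ => ((‖ξ‖ ^ (2 * μ - N) : ℝ) : ℂ) * 𝓕 g.1 ξ := by
  rw [← fourier_congr_ae (TestSpace.toLp_ae g)]
  exact potential_ae _

theorem TestSpace.weightedSq (g : TestSpace N μ) : WeightedSq N μ g.1 := by
  have h : WeightedSq N μ fun x => (weight N μ x : ℂ) * (g.1 x / (weight N μ x : ℂ)) :=
    weightedSq_of_memLp (TestSpace.memLp g)
  refine ⟨g.2.1, h.int.congr (.of_forall fun x => ?_)⟩
  have hw := weight_pos (μ := μ) x
  have : (weight N μ x : ℂ) ≠ 0 := Complex.ofReal_ne_zero.2 hw.ne'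
  simp only [mul_div_cancel₀ _ this]

theorem TestSpace.integrable (g : TestSpace N μ) : Integrable g.1 := (TestSpace.weightedSq g).integrable

/-- The norm in the position picture, from which its conformal invariance is read off. -/
theorem norm_sq_testVec (g : TestSpace N μ) :
    ((‖testVec N μ g‖ ^ 2 : ℝ) : ℂ) = (rieszConst N μ : ℂ) *
      ∫ z : E N × E N, ((‖z.1 - z.2‖ ^ (-(2 * μ)) : ℝ) : ℂ) * (g.1 z.1 * star (g.1 z.2)) := by
  obtain ⟨C, hC0, hC⟩ := exists_schur_bound N μ
  have h : testVec N μ g = freqVec _ (TestSpace.weightedSq g).memLp :=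
    CompSeries.ext_ae ((testVec_ae g).trans (freqVec_ae _).symm)
  rw [h, norm_sq_dual, (riesz_form (TestSpace.integrable g) (hC g.1 (TestSpace.weightedSq g)).1).2]

theorem inner_testVec_eq_fourier (g : TestSpace N μ) (u : CompSeries N μ) :
    Integrable (fun ξ => star (𝓕 g.1 ξ) * (u : Lp ℂ 2 (freqMeasure N μ)) ξ) ∧
    inner ℂ (testVec N μ g) u = ∫ ξ, star (𝓕 g.1 ξ) * (u : Lp ℂ 2 (freqMeasure N μ)) ξ :=
  inner_dual u _ (testVec_ae g)

/-- The function on `ℝ^N` represented by an element of `𝒞_μ`. -/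
def realization (u : CompSeries N μ) : E N → ℂ :=
  ((potential N μ).adjoint u : Lp ℂ 2 (weightMeasure N μ))

theorem aestronglyMeasurable_realization (u : CompSeries N μ) :
    AEStronglyMeasurable (realization u) :=
  aestronglyMeasurable_weight_iff.1 (Lp.aestronglyMeasurable _)

theorem integrable_weight_mul_realization (u : CompSeries N μ) :
    Integrable fun x => weight N μ x * ‖realization u x‖ :=
  integrable_weightMeasure_iff.1
    (((Lp.memLp ((potential N μ).adjoint u)).integrable (by norm_num)).norm)

theorem integrable_test_mul_realization (g : TestSpace N μ) (u : CompSeries N μ) :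
    Integrable fun x => star (g.1 x) * realization u x := by
  obtain ⟨h, C, hC⟩ := g.2
  refine ((integrable_weight_mul_realization u).const_mul C).mono'
    ((continuous_star.comp_aestronglyMeasurable h).mul (aestronglyMeasurable_realization u))
    (.of_forall fun x => ?_)
  rw [norm_mul, norm_star, ← mul_assoc]
  gcongr
  exact hC x

/-- The realization is the adjoint of `potential` for the sake of this identity: the weight divided
out of `g` is restored by the measure. It also gives every element of `𝒞_μ` a function that is
integrable against all test functions. -/
theorem inner_testVec (g : TestSpace N μ) (u : CompSeries N μ) :
    inner ℂ (testVec N μ g) u = ∫ x, star (g.1 x) * realization u x := by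
  have h : inner ℂ (testVec N μ g) u
      = inner ℂ ((TestSpace.memLp g).toLp _) ((potential N μ).adjoint u) := by
    rw [ContinuousLinearMap.adjoint_inner_right]; rfl
  rw [h, L2.inner_def, integral_weightMeasure]
  refine integral_congr_ae ?_
  filter_upwards [TestSpace.toLp_ae g] with x hx
  rw [← hx, realization]
  simp only [RCLike.inner_apply, Complex.real_smul, star_mul', Complex.star_def,
    Complex.conj_ofReal]
  ring

/-- A Schwartz function is bounded by a multiple of the weight. -/
theorem schwartz_mem_testSpace (φ : 𝓢(E N, ℂ)) : (φ : E N → ℂ) ∈ TestSpace N μ := by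
  refine ⟨φ.continuous.aestronglyMeasurable, ?_⟩
  obtain ⟨C, hC0, hC⟩ : ∃ C, 0 ≤ C ∧ ∀ x, ‖φ x‖ ≤ C * (1 + ‖x‖) ^ (-((2 * N : ℕ) : ℝ)) := by
    refine ⟨2 ^ (2 * N) * ((Finset.Iic (2 * N, 0)).sup fun m => SchwartzMap.seminorm ℂ m.1 m.2) φ,
      by positivity, fun x => ?_⟩
    have h := SchwartzMap.one_add_le_sup_seminorm_apply (𝕜 := ℂ) (m := (2 * N, 0)) (k := 2 * N)
      (n := 0) le_rfl le_rfl φ x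
    rw [norm_iteratedFDeriv_zero] at h
    rw [Real.rpow_neg (by positivity), Real.rpow_natCast, ← div_eq_mul_inv,
      le_div_iff₀ (by positivity), mul_comm]
    exact h
  refine ⟨C, fun x => (hC x).trans ?_⟩
  gcongr
  have h1 := range_pos N μ
  have h2 := range_lt N μ
  have h0 := norm_nonneg x
  unfold weight
  rw [Real.rpow_neg (by positivity), Real.rpow_neg (by positivity)]
  gcongr
  calc (1 + ‖x‖ ^ 2) ^ ((N : ℝ) - μ) ≤ ((1 + ‖x‖) ^ 2) ^ ((N : ℝ) - μ) := by
        refine Real.rpow_le_rpow (by positivity) (by nlinarith) (by linarith)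
    _ ≤ ((1 + ‖x‖) ^ 2) ^ (N : ℝ) :=
        Real.rpow_le_rpow_of_exponent_le (by nlinarith) (by linarith)
    _ = _ := by rw [sq_rpow (by positivity)]; push_cast; rfl

theorem star_fourier_star (f : E N → ℂ) (ξ : E N) :
    star (𝓕 (fun x => star (f x)) ξ) = 𝓕⁻ f ξ := by
  rw [fourier_eq_char, Real.fourierInv_eq, Complex.star_def, ← integral_conj]
  refine integral_congr_ae (.of_forall fun x => ?_)
  simp only [map_mul, Complex.conj_conj]
  rw [← Circle.coe_inv_eq_conj, ← AddChar.map_neg_eq_inv, neg_neg]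
  rfl

omit [ComplementaryRange N μ] in
theorem star_mem_testSpace {g : E N → ℂ} (hg : g ∈ TestSpace N μ) :
    (fun x => star (g x)) ∈ TestSpace N μ := by
  obtain ⟨h, C, hC⟩ := hg
  exact ⟨continuous_star.comp_aestronglyMeasurable h, C, fun x => by simpa using hC x⟩

/-- The test function `conj (𝓕 φ)`. -/
def schwartzTest (N : ℕ) (μ : ℝ) [ComplementaryRange N μ] (φ : 𝓢(E N, ℂ)) : TestSpace N μ :=
  ⟨fun x => star ((𝓕 φ) x), star_mem_testSpace (g := (𝓕 φ : 𝓢(E N, ℂ))) (schwartz_mem_testSpace _)⟩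

theorem inner_schwartzTest (φ : 𝓢(E N, ℂ)) (u : CompSeries N μ) :
    inner ℂ (testVec N μ (schwartzTest N μ φ)) u
      = ∫ ξ, (u : Lp ℂ 2 (freqMeasure N μ)) ξ * φ ξ := by
  rw [(inner_testVec_eq_fourier _ _).2]
  refine integral_congr_ae (.of_forall fun ξ => ?_)
  simp only [schwartzTest]
  rw [star_fourier_star, ← SchwartzMap.fourierInv_coe, FourierTransform.fourierInv_fourier_eq,
    mul_comm]

/-- Every Schwartz function is of the form `𝓕 φ`, and pairing `u` with `φ` is the inner product with
the vector of the test function `conj (𝓕 φ)`. -/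
theorem realizes_of_forall_test (u : CompSeries N μ) (f : E N → ℂ)
    (hf : ∀ φ : 𝓢(E N, ℂ), Integrable fun x => f x * (𝓕 φ) x)
    (h : ∀ φ : 𝓢(E N, ℂ), ∫ x, f x * (𝓕 φ) x = inner ℂ (testVec N μ (schwartzTest N μ φ)) u) :
    Realizes u f := fun φ => by
  refine ⟨?_, integrable_mul_schwartz u φ, by rw [← inner_schwartzTest]; exact h φ⟩
  have := hf (𝓕⁻ φ)
  rwa [FourierTransform.fourier_fourierInv_eq] at this

theorem realizes_realization (u : CompSeries N μ) : Realizes u (realization u) := by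
  refine realizes_of_forall_test u _ (fun φ => ?_) fun φ => ?_
  · have := integrable_test_mul_realization (schwartzTest N μ φ) u
    simpa [schwartzTest, mul_comm] using this
  · rw [inner_testVec]
    exact integral_congr_ae (.of_forall fun x => by simp [schwartzTest, mul_comm])

theorem eq_zero_of_inner_schwartzTest {u : CompSeries N μ}
    (h : ∀ φ, inner ℂ (testVec N μ (schwartzTest N μ φ)) u = 0) : u = 0 := by
  have h0 := ae_eq_zero_of_forall_schwartz (integrable_mul_schwartz u)
    (fun φ => by rw [← inner_schwartzTest]; exact h φ)
  refine CompSeries.ext_ae (h0.trans (Filter.EventuallyEq.symm ?_))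
  have := Lp.coeFn_zero ℂ 2 (freqMeasure N μ)
  rw [Filter.EventuallyEq, ae_freqMeasure_eq] at this
  exact this

/-- The test functions `conj (𝓕 φ)` suffice: an element orthogonal to them pairs to zero with every
Schwartz function. Operators are defined, and identities checked, on this dense range. -/
theorem denseRange_testVec : DenseRange (testVec N μ) := by
  rw [DenseRange, ← LinearMap.coe_range, Submodule.dense_iff_topologicalClosure_eq_top,
    Submodule.topologicalClosure_eq_top_iff, Submodule.eq_bot_iff]
  intro u hu
  exact eq_zero_of_inner_schwartzTest fun φ => (Submodule.mem_orthogonal _ _).1 hu _ ⟨_, rfl⟩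

end Realization
end Branching
end

noncomputable section

namespace Branching

variable {N : ℕ} {μ : ℝ}

/-! ## The Lorentz form and the light cone -/

/-- The Lorentz form as a bilinear form. -/
def lorentzInner {p : ℕ} (X Y : Fin p ⊕ Fin 1 → ℝ) : ℝ :=
  ∑ i, X (Sum.inl i) * Y (Sum.inl i) - X (Sum.inr 0) * Y (Sum.inr 0)

theorem lorentzInner_eq {p : ℕ} (X Y : Fin p ⊕ Fin 1 → ℝ) :
    lorentzInner X Y = X ⬝ᵥ (lorentzForm p *ᵥ Y) := by
  simp [lorentzInner, lorentzForm, LieAlgebra.Orthogonal.indefiniteDiagonal, dotProduct,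
    Matrix.mulVec_diagonal, Fintype.sum_sum_type, sub_eq_add_neg]

theorem SO.lorentzInner_mulVec {p : ℕ} (A : SO p) (X Y : Fin p ⊕ Fin 1 → ℝ) :
    lorentzInner (A.1.val *ᵥ X) (A.1.val *ᵥ Y) = lorentzInner X Y := by
  have h := A.2.1
  rw [lorentzInner_eq, lorentzInner_eq]
  conv_rhs => rw [← h]
  rw [Matrix.dotProduct_mulVec, Matrix.dotProduct_mulVec, Matrix.dotProduct_mulVec,
    ← Matrix.vecMul_vecMul, ← Matrix.vecMul_vecMul, Matrix.vecMul_transpose]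

theorem SO₀.mat_mul {p : ℕ} (h k : SO₀ p) : (h * k).mat = h.mat * k.mat := rfl

theorem SO₀.mat_one {p : ℕ} : (1 : SO₀ p).mat = 1 := rfl

theorem SO₀.mat_inv_mul {p : ℕ} (h : SO₀ p) : h⁻¹.mat * h.mat = 1 := by
  rw [← SO₀.mat_mul, inv_mul_cancel, SO₀.mat_one]

theorem SO₀.mat_mul_inv {p : ℕ} (h : SO₀ p) : h.mat * h⁻¹.mat = 1 := by
  rw [← SO₀.mat_mul, mul_inv_cancel, SO₀.mat_one]

theorem SO₀.continuous_mat {p : ℕ} : Continuous (SO₀.mat (p := p)) :=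
  Units.continuous_val.comp (continuous_subtype_val.comp continuous_subtype_val)

theorem SO₀.lorentzInner_mulVec {p : ℕ} (h : SO₀ p) (X Y : Fin p ⊕ Fin 1 → ℝ) :
    lorentzInner (h.mat *ᵥ X) (h.mat *ᵥ Y) = lorentzInner X Y :=
  SO.lorentzInner_mulVec h.1 X Y

@[simp] theorem lightVector_zero (x : E N) : lightVector x (Sum.inl 0) = 1 - ‖x‖ ^ 2 := rfl

@[simp] theorem lightVector_succ (x : E N) (i : Fin N) :
    lightVector x (Sum.inl i.succ) = 2 * x i := rfl

@[simp] theorem lightVector_time (x : E N) (i : Fin 1) :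
    lightVector x (Sum.inr i) = 1 + ‖x‖ ^ 2 := rfl

/-- Euclidean distance is encoded in the Lorentz form, which the group preserves; every covariance
property of distances below comes from this. -/
theorem lorentzInner_lightVector (x y : E N) :
    lorentzInner (lightVector x) (lightVector y) = -2 * ‖x - y‖ ^ 2 := by
  have h : inner ℝ x y = ∑ i, x i * y i := by
    simp [PiLp.inner_apply, mul_comm]
  rw [lorentzInner, Fin.sum_univ_succ, norm_sub_sq_real, h]
  simp only [lightVector_zero, lightVector_succ, lightVector_time]
  have e : ∑ i, 2 * x i * (2 * y i) = 4 * ∑ i, x i * y i := by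
    rw [Finset.mul_sum]; exact Finset.sum_congr rfl fun i _ => by ring
  rw [e]; ring

theorem eq_smul_lightVector {X : Fin (N + 1) ⊕ Fin 1 → ℝ} (hX : lorentzInner X X = 0) {s : ℝ}
    (hs : s = (X (Sum.inl 0) + X (Sum.inr 0)) / 2) (hs0 : s ≠ 0) :
    X = s • lightVector (WithLp.toLp 2 fun i : Fin N => X (Sum.inl i.succ) / (2 * s) : E N) := by
  rw [lorentzInner, Fin.sum_univ_succ] at hX
  set y : E N := WithLp.toLp 2 fun i : Fin N => X (Sum.inl i.succ) / (2 * s) with hy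
  -- The equation of the light cone factors as `∑ X_i² = (X_t - X_0)(X_t + X_0)`, and the last
  -- factor is `2 s`.
  have hn : ‖y‖ ^ 2 = (X (Sum.inr 0) - X (Sum.inl 0)) / (2 * s) := by
    rw [EuclideanSpace.real_norm_sq_eq]
    have : ∀ i, y i ^ 2 = (X (Sum.inl i.succ) * X (Sum.inl i.succ)) / (2 * s) ^ 2 := fun i => by
      simp only [hy]; rw [div_pow, pow_two (X _)]
    simp only [this]
    rw [← Finset.sum_div, div_eq_div_iff (by positivity) (by positivity)]
    have e : ∑ i : Fin N, X (Sum.inl i.succ) * X (Sum.inl i.succ)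
        = (X (Sum.inr 0) - X (Sum.inl 0)) * (2 * s) := by rw [hs]; linarith
    rw [e]; ring
  have h1 : s * ‖y‖ ^ 2 = (X (Sum.inr 0) - X (Sum.inl 0)) / 2 := by rw [hn]; field_simp
  funext k
  rcases k with k | k
  · refine Fin.cases ?_ (fun i => ?_) k
    · simp only [Pi.smul_apply, lightVector_zero, smul_eq_mul, mul_sub, h1]
      rw [hs]; ring
    · simp only [Pi.smul_apply, lightVector_succ, smul_eq_mul, hy]
      field_simp
  · rw [Subsingleton.elim k 0]
    simp only [Pi.smul_apply, lightVector_time, smul_eq_mul, mul_add, h1]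
    rw [hs]; ring

theorem conformalScale_smul (A : Matrix (Fin (N + 1) ⊕ Fin 1) (Fin (N + 1) ⊕ Fin 1) ℝ) {c : ℝ}
    {X : Fin (N + 1) ⊕ Fin 1 → ℝ} {x : E N} (h : X = c • lightVector x) :
    ((A *ᵥ X) (Sum.inl 0) + (A *ᵥ X) (Sum.inr 0)) / 2 = c * conformalScale A x := by
  rw [h, Matrix.mulVec_smul, conformalScale]; simp only [Pi.smul_apply, smul_eq_mul]; ring

/-! ## The conformal action -/

section Action

variable (h k : SO₀ (N + 1)) (x y : E N)

theorem lorentzInner_mulVec_self :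
    lorentzInner (h.mat *ᵥ lightVector x) (h.mat *ᵥ lightVector x) = 0 := by
  rw [SO₀.lorentzInner_mulVec, lorentzInner_lightVector]; simp

theorem mulVec_lightVector (hx : conformalScale h.mat x ≠ 0) :
    h.mat *ᵥ lightVector x = conformalScale h.mat x • lightVector (conformalMap h.mat x) :=
  eq_smul_lightVector (lorentzInner_mulVec_self h x) rfl hx

theorem abs_le_time_of_lightlike {p : ℕ} {X : Fin p ⊕ Fin 1 → ℝ} (hX : lorentzInner X X = 0)
    (i : Fin p ⊕ Fin 1) : |X i| ≤ |X (Sum.inr 0)| := by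
  rcases i with i | i
  · rw [lorentzInner, sub_eq_zero] at hX
    refine sq_le_sq.1 ?_
    rw [pow_two, pow_two, ← hX]
    exact Finset.single_le_sum (f := fun i => X (Sum.inl i) * X (Sum.inl i))
      (fun i _ => mul_self_nonneg _) (Finset.mem_univ i)
  · rw [Subsingleton.elim i 0]

/-- A light-like vector with zero time coordinate vanishes, so this continuous function on `SO(N+1,
1)` has no zero. It is positive at the identity, hence on the identity component. -/
theorem time_pos : 0 < (h.mat *ᵥ lightVector x) (Sum.inr 0) := by
  let f : SO (N + 1) → ℝ := fun A => (A.1.val *ᵥ lightVector x) (Sum.inr 0)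
  have hf : Continuous f := by
    have : Continuous fun A : SO (N + 1) => A.1.val *ᵥ lightVector x :=
      (Units.continuous_val.comp continuous_subtype_val).matrix_mulVec continuous_const
    exact (continuous_apply (Sum.inr 0)).comp this
  have hne : ∀ A, f A ≠ 0 := by
    intro A hA
    have h0 : lorentzInner (A.1.val *ᵥ lightVector x) (A.1.val *ᵥ lightVector x) = 0 := by
      rw [SO.lorentzInner_mulVec, lorentzInner_lightVector]; simp
    have h1 : A.1.val *ᵥ lightVector x = 0 := by
      funext i
      have := abs_le_time_of_lightlike h0 i
      rw [show (A.1.val *ᵥ lightVector x) (Sum.inr 0) = 0 from hA, abs_zero] at this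
      exact abs_eq_zero.1 (le_antisymm this (abs_nonneg _))
    have h2 : lightVector x = 0 := by
      have : A.1⁻¹.val *ᵥ (A.1.val *ᵥ lightVector x) = lightVector x := by
        rw [Matrix.mulVec_mulVec, ← Units.val_mul, inv_mul_cancel, Units.val_one,
          Matrix.one_mulVec]
      rw [← this, h1, Matrix.mulVec_zero]
    have h3 := congrFun h2 (Sum.inr 0)
    simp only [lightVector_time, Pi.zero_apply] at h3
    nlinarith [sq_nonneg ‖x‖]
  have hf1 : 0 < f 1 := by
    simp only [f, OneMemClass.coe_one, Units.val_one, Matrix.one_mulVec, lightVector_time]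
    positivity
  by_contra hneg
  have hconn : IsPreconnected (connectedComponent (1 : SO (N + 1))) :=
    isPreconnected_connectedComponent
  obtain ⟨A, -, hA⟩ := hconn.intermediate_value h.2 mem_connectedComponent hf.continuousOn
    ⟨not_lt.1 hneg, hf1.le⟩
  exact hne A hA

theorem conformalScale_nonneg : 0 ≤ conformalScale h.mat x := by
  have h1 := abs_le_time_of_lightlike (lorentzInner_mulVec_self h x) (Sum.inl 0)
  rw [abs_of_pos (time_pos h x)] at h1
  have := (abs_le.1 h1).1
  unfold conformalScale; linarith

variable {x} in
theorem conformalScale_pos (hx : conformalScale h.mat x ≠ 0) : 0 < conformalScale h.mat x :=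
  lt_of_le_of_ne (conformalScale_nonneg h x) hx.symm

theorem conformalScale_mul_time (hx : conformalScale h.mat x ≠ 0) :
    conformalScale h.mat x * (1 + ‖conformalMap h.mat x‖ ^ 2)
      = (h.mat *ᵥ lightVector x) (Sum.inr 0) := by
  rw [mulVec_lightVector h x hx]; rfl

theorem conformalScale_mul (hx : conformalScale k.mat x ≠ 0) :
    conformalScale (h * k).mat x
      = conformalScale h.mat (conformalMap k.mat x) * conformalScale k.mat x := by
  have h1 := conformalScale_smul h.mat (mulVec_lightVector k x hx)
  rw [Matrix.mulVec_mulVec, ← SO₀.mat_mul] at h1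
  rw [mul_comm, ← h1]; rfl

theorem conformalMap_mul (hx : conformalScale k.mat x ≠ 0) :
    conformalMap (h * k).mat x = conformalMap h.mat (conformalMap k.mat x) := by
  ext i
  change ((h * k).mat *ᵥ lightVector x) (Sum.inl i.succ) / (2 * conformalScale (h * k).mat x) =
    (h.mat *ᵥ lightVector (conformalMap k.mat x)) (Sum.inl i.succ) /
    (2 * conformalScale h.mat (conformalMap k.mat x))
  rw [conformalScale_mul h k x hx, SO₀.mat_mul, ← Matrix.mulVec_mulVec, mulVec_lightVector k x hx,
    Matrix.mulVec_smul, Pi.smul_apply, smul_eq_mul]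
  rw [mul_comm (conformalScale h.mat (conformalMap k.mat x)), mul_left_comm,
    mul_div_mul_left _ _ hx]

@[simp] theorem conformalScale_one : conformalScale (1 : Matrix (Fin (N + 1) ⊕ Fin 1) _ ℝ) x = 1 := by
  simp only [conformalScale, Matrix.one_mulVec, lightVector_zero, lightVector_time]; ring

@[simp] theorem conformalMap_one : conformalMap (1 : Matrix (Fin (N + 1) ⊕ Fin 1) _ ℝ) x = x := by
  ext i
  simp [conformalMap]

theorem conformalScale_inv_mul (hx : conformalScale h.mat x ≠ 0) :
    conformalScale h⁻¹.mat (conformalMap h.mat x) * conformalScale h.mat x = 1 := by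
  rw [← conformalScale_mul _ _ _ hx, inv_mul_cancel, SO₀.mat_one, conformalScale_one]

theorem conformalMap_inv_map (hx : conformalScale h.mat x ≠ 0) :
    conformalMap h⁻¹.mat (conformalMap h.mat x) = x := by
  rw [← conformalMap_mul _ _ _ hx, inv_mul_cancel, SO₀.mat_one, conformalMap_one]

theorem conformalScale_inv_ne_zero (hx : conformalScale h.mat x ≠ 0) :
    conformalScale h⁻¹.mat (conformalMap h.mat x) ≠ 0 :=
  left_ne_zero_of_mul_eq_one (conformalScale_inv_mul h x hx)

/-- Invariance of the Lorentz form, evaluated on two light vectors. -/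
theorem scale_mul_scale_mul_dist (hx : conformalScale h.mat x ≠ 0)
    (hy : conformalScale h.mat y ≠ 0) :
    conformalScale h.mat x * conformalScale h.mat y *
      ‖conformalMap h.mat x - conformalMap h.mat y‖ ^ 2 = ‖x - y‖ ^ 2 := by
  have h1 := SO₀.lorentzInner_mulVec h (lightVector x) (lightVector y)
  rw [mulVec_lightVector h x hx, mulVec_lightVector h y hy, lorentzInner_lightVector] at h1
  have h2 : ∀ (a b : ℝ) (X Y : Fin (N + 1) ⊕ Fin 1 → ℝ),
      lorentzInner (a • X) (b • Y) = a * b * lorentzInner X Y := by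
    intro a b X Y
    simp only [lorentzInner, Pi.smul_apply, smul_eq_mul, mul_sub, Finset.mul_sum]
    congr 1
    · exact Finset.sum_congr rfl fun i _ => by ring
    · ring
  rw [h2, lorentzInner_lightVector] at h1
  linarith

/-- Singular points are sent to the single null line spanned by `(-1, 0, …, 0, 1)`. The light
vectors of two of them are thus Lorentz orthogonal, so their distance is zero. -/
theorem singular_subsingleton (hx : conformalScale h.mat x = 0) (hy : conformalScale h.mat y = 0) :
    x = y := by
  have key : ∀ z, conformalScale h.mat z = 0 →
      (h.mat *ᵥ lightVector z) (Sum.inl 0) = -(h.mat *ᵥ lightVector z) (Sum.inr 0) ∧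
      ∀ i : Fin N, (h.mat *ᵥ lightVector z) (Sum.inl i.succ) = 0 := by
    intro z hz
    have h0 := lorentzInner_mulVec_self h z
    rw [lorentzInner, Fin.sum_univ_succ] at h0
    have h1 : (h.mat *ᵥ lightVector z) (Sum.inl 0) = -(h.mat *ᵥ lightVector z) (Sum.inr 0) := by
      unfold conformalScale at hz; linarith
    refine ⟨h1, fun i => ?_⟩
    rw [h1] at h0
    have h2 : ∑ i : Fin N, (h.mat *ᵥ lightVector z) (Sum.inl i.succ) *
        (h.mat *ᵥ lightVector z) (Sum.inl i.succ) = 0 := by linarith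
    rw [Finset.sum_eq_zero_iff_of_nonneg fun i _ => mul_self_nonneg _] at h2
    exact mul_self_eq_zero.1 (h2 i (Finset.mem_univ i))
  have h1 := SO₀.lorentzInner_mulVec h (lightVector x) (lightVector y)
  rw [lorentzInner_lightVector, lorentzInner, Fin.sum_univ_succ, (key x hx).1, (key y hy).1] at h1
  simp only [(key x hx).2, zero_mul, Finset.sum_const_zero, add_zero] at h1
  have h2 : ‖x - y‖ ^ 2 = 0 := by linarith
  exact sub_eq_zero.1 (norm_eq_zero.1 (pow_eq_zero_iff two_ne_zero |>.1 h2))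

theorem ae_conformalScale_ne_zero [NeZero N] : ∀ᵐ x : E N, conformalScale h.mat x ≠ 0 := by
  by_cases hex : ∃ x₀ : E N, conformalScale h.mat x₀ = 0
  · obtain ⟨x₀, h0⟩ := hex
    filter_upwards [ae_ne_point x₀] with x hx hx0
    exact hx (singular_subsingleton h _ _ hx0 h0)
  · push Not at hex
    exact .of_forall hex

/-! ### Change of variables -/

theorem contDiff_mulVec_lightVector (A : Matrix (Fin (N + 1) ⊕ Fin 1) (Fin (N + 1) ⊕ Fin 1) ℝ)
    (k : Fin (N + 1) ⊕ Fin 1) : ContDiff ℝ ∞ fun x : E N => (A *ᵥ lightVector x) k := by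
  have h1 : ContDiff ℝ ∞ fun x : E N => ‖x‖ ^ 2 := contDiff_norm_sq ℝ
  have h2 : ∀ i, ContDiff ℝ ∞ fun x : E N => lightVector x i := by
    rintro (i | i)
    · refine Fin.cases ?_ (fun i => ?_) i
      · simp only [lightVector_zero]; fun_prop
      · simp only [lightVector_succ]; fun_prop
    · simp only [lightVector_time]; fun_prop
  simp only [Matrix.mulVec, dotProduct]
  exact ContDiff.sum fun i _ => contDiff_const.mul (h2 i)

theorem contDiff_conformalScale (A : Matrix (Fin (N + 1) ⊕ Fin 1) (Fin (N + 1) ⊕ Fin 1) ℝ) :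
    ContDiff ℝ ∞ fun x : E N => conformalScale A x :=
  ((contDiff_mulVec_lightVector A _).add (contDiff_mulVec_lightVector A _)).div_const 2

theorem contDiffAt_conformalMap (A : Matrix (Fin (N + 1) ⊕ Fin 1) (Fin (N + 1) ⊕ Fin 1) ℝ)
    {x : E N} (hx : conformalScale A x ≠ 0) : ContDiffAt ℝ ∞ (conformalMap A) x := by
  rw [contDiffAt_euclidean]
  intro i
  exact (contDiff_mulVec_lightVector A _).contDiffAt.div
    (contDiff_const.mul (contDiff_conformalScale A)).contDiffAt (by simpa using hx)

theorem isOpen_regular : IsOpen {x : E N | conformalScale h.mat x ≠ 0} :=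
  isOpen_ne.preimage (contDiff_conformalScale h.mat).continuous

/-- The infinitesimal form of `scale_mul_scale_mul_dist`: applied to `x + t v` and `x`, it
determines the limit of the squared norms of the difference quotients. The derivative is a
similarity of ratio `J⁻¹`, and no explicit derivative is computed. -/
theorem norm_fderiv_conformalMap (hx : conformalScale h.mat x ≠ 0) (v : E N) :
    ‖fderiv ℝ (conformalMap h.mat) x v‖ = (conformalScale h.mat x)⁻¹ * ‖v‖ := by
  have hJ := conformalScale_pos h hx
  have hd := ((contDiffAt_conformalMap h.mat hx).differentiableAt (by simp)).hasFDerivAt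
  have hl := hd.hasLineDerivAt v
  have hl' : HasDerivAt (fun t : ℝ => conformalMap h.mat (x + t • v))
      (fderiv ℝ (conformalMap h.mat) x v) 0 := hl
  have hs := hl'.tendsto_slope_zero
  simp only [zero_add, zero_smul, add_zero] at hs
  have hs2 := (hs.norm).pow 2
  have hev : ∀ᶠ t in nhdsWithin (0 : ℝ) {0}ᶜ, conformalScale h.mat (x + t • v) ≠ 0 := by
    have hc : ContinuousAt (fun t : ℝ => conformalScale h.mat (x + t • v)) 0 :=
      ((contDiff_conformalScale h.mat).continuous.comp (by fun_prop :
        Continuous fun t : ℝ => x + t • v)).continuousAt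
    have : ∀ᶠ t in nhds (0 : ℝ), conformalScale h.mat (x + t • v) ≠ 0 :=
      hc.eventually_ne (by simpa using hx)
    exact this.filter_mono nhdsWithin_le_nhds
  have ht : Filter.Tendsto (fun t : ℝ => ‖v‖ ^ 2 / (conformalScale h.mat (x + t • v) *
      conformalScale h.mat x)) (nhdsWithin (0 : ℝ) {0}ᶜ)
      (nhds (‖v‖ ^ 2 / (conformalScale h.mat x * conformalScale h.mat x))) := by
    have hc : ContinuousAt (fun t : ℝ => ‖v‖ ^ 2 / (conformalScale h.mat (x + t • v) *
      conformalScale h.mat x)) 0 := by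
      refine ContinuousAt.div continuousAt_const ?_ (by simpa using hx)
      exact (((contDiff_conformalScale h.mat).continuous.comp (by fun_prop :
        Continuous fun t : ℝ => x + t • v)).continuousAt).mul continuousAt_const
    have := hc.tendsto
    simp only [zero_smul, add_zero] at this
    exact this.mono_left nhdsWithin_le_nhds
  have heq := tendsto_nhds_unique hs2 (ht.congr' (by
    filter_upwards [hev, self_mem_nhdsWithin] with t h1 h2
    have ht0 : t ≠ 0 := h2
    have h3 := scale_mul_scale_mul_dist h (x + t • v) x h1 hx
    rw [add_sub_cancel_left, norm_smul, mul_pow, Real.norm_eq_abs, sq_abs] at h3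
    rw [norm_smul, mul_pow, norm_inv, Real.norm_eq_abs, inv_pow, sq_abs,
      div_eq_iff (mul_ne_zero h1 hx)]
    field_simp
    linarith))
  have h4 : ‖fderiv ℝ (conformalMap h.mat) x v‖ ^ 2 = ((conformalScale h.mat x)⁻¹ * ‖v‖) ^ 2 := by
    rw [heq, mul_pow, inv_pow]; field_simp
  exact (sq_eq_sq₀ (norm_nonneg _) (by positivity)).1 h4

/-- Multiplied by `J`, the derivative is a linear isometry. -/
theorem abs_det_fderiv_conformalMap (hx : conformalScale h.mat x ≠ 0) :
    |(fderiv ℝ (conformalMap h.mat) x).det| = (conformalScale h.mat x)⁻¹ ^ N := by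
  have hJ := conformalScale_pos h hx
  set L := fderiv ℝ (conformalMap h.mat) x
  let f : E N →ₗᵢ[ℝ] E N := ⟨conformalScale h.mat x • (L : E N →ₗ[ℝ] E N), fun v => by
    change ‖conformalScale h.mat x • L v‖ = ‖v‖
    rw [norm_smul, norm_fderiv_conformalMap h x hx, Real.norm_of_nonneg hJ.le]
    field_simp⟩
  have h1 : (L : E N →ₗ[ℝ] E N) = (conformalScale h.mat x)⁻¹ • f.toLinearMap := by
    change _ = (conformalScale h.mat x)⁻¹ • conformalScale h.mat x • (L : E N →ₗ[ℝ] E N)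
    rw [smul_smul, inv_mul_cancel₀ hx, one_smul]
  have h2 : |(L : E N →ₗ[ℝ] E N).det| = (conformalScale h.mat x)⁻¹ ^ N := by
    rw [← LinearMap.normDet_eq_abs_det, h1, LinearMap.normDet_smul, LinearIsometry.normDet_eq_one,
      mul_one, finrank_euclideanSpace_fin, Real.norm_of_nonneg (inv_pos.2 hJ).le]
  exact h2

theorem conformalMap_image :
    conformalMap h.mat '' {x : E N | conformalScale h.mat x ≠ 0}
      = {x : E N | conformalScale h⁻¹.mat x ≠ 0} := by
  ext y
  constructor
  · rintro ⟨x, hx, rfl⟩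
    exact conformalScale_inv_ne_zero h x hx
  · intro hy
    refine ⟨conformalMap h⁻¹.mat y, ?_, ?_⟩
    · simpa using conformalScale_inv_ne_zero h⁻¹ y hy
    · simpa using conformalMap_inv_map h⁻¹ y hy

theorem integral_conformal [NeZero N] {F : Type*} [NormedAddCommGroup F] [NormedSpace ℝ F]
    (f : E N → F) :
    ∫ x, f x = ∫ x, (conformalScale h.mat x)⁻¹ ^ N • f (conformalMap h.mat x) := by
  have h1 := integral_image_eq_integral_abs_det_fderiv_smul volume
    (isOpen_regular h).measurableSet
    (fun x hx => ((contDiffAt_conformalMap h.mat hx).differentiableAt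
      (by simp)).hasFDerivAt.hasFDerivWithinAt)
    (fun x hx y hy hxy => by
      rw [← conformalMap_inv_map h x hx, hxy, conformalMap_inv_map h y hy]) f
  rw [conformalMap_image] at h1
  have h2 : ∀ k : SO₀ (N + 1), volume.restrict {x : E N | conformalScale k.mat x ≠ 0} = volume :=
    fun k => Measure.restrict_eq_self_of_ae_mem (ae_conformalScale_ne_zero k)
  have h3 : ∫ x in {x : E N | conformalScale h.mat x ≠ 0},
      |(fderiv ℝ (conformalMap h.mat) x).det| • f (conformalMap h.mat x)
      = ∫ x in {x : E N | conformalScale h.mat x ≠ 0},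
      (conformalScale h.mat x)⁻¹ ^ N • f (conformalMap h.mat x) :=
    setIntegral_congr_fun (isOpen_regular h).measurableSet
      (fun x hx => by simp only [abs_det_fderiv_conformalMap h x hx])
  rw [h3, h2, h2] at h1
  exact h1

theorem integrable_conformal [NeZero N] {F : Type*} [NormedAddCommGroup F] [NormedSpace ℝ F]
    {f : E N → F} (hf : Integrable f) :
    Integrable fun x => (conformalScale h.mat x)⁻¹ ^ N • f (conformalMap h.mat x) := by
  have h1 := integrableOn_image_iff_integrableOn_abs_det_fderiv_smul volume
    (isOpen_regular h).measurableSet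
    (fun x hx => ((contDiffAt_conformalMap h.mat hx).differentiableAt
      (by simp)).hasFDerivAt.hasFDerivWithinAt)
    (fun x hx y hy hxy => by
      rw [← conformalMap_inv_map h x hx, hxy, conformalMap_inv_map h y hy]) f
  have h3 := (h1.1 hf.integrableOn).congr_fun
    (fun x hx => by simp only [abs_det_fderiv_conformalMap h x hx]; rfl)
    (isOpen_regular h).measurableSet
  have h2 : volume.restrict {x : E N | conformalScale h.mat x ≠ 0} = volume :=
    Measure.restrict_eq_self_of_ae_mem (ae_conformalScale_ne_zero h)
  rw [IntegrableOn, h2] at h3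
  exact h3

/-- The preimage of a null set is, off the singular point, its image under the differentiable map of
`h⁻¹`, hence null. -/
theorem ae_conformalMap [NeZero N] {p : E N → Prop} (hp : ∀ᵐ x, p x) :
    ∀ᵐ x, p (conformalMap h.mat x) := by
  have h0 : volume {x : E N | ¬ p x} = 0 := ae_iff.1 hp
  have h1 : volume (conformalMap h⁻¹.mat '' ({x : E N | conformalScale h⁻¹.mat x ≠ 0} ∩
      {x | ¬ p x})) = 0 := by
    refine addHaar_image_eq_zero_of_differentiableOn_of_addHaar_eq_zero volume ?_
      (measure_mono_null Set.inter_subset_right h0)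
    intro x hx
    exact ((contDiffAt_conformalMap h⁻¹.mat hx.1).differentiableAt
      (by simp)).differentiableWithinAt
  have h2 := measure_eq_zero_iff_ae_notMem.1 h1
  filter_upwards [h2, ae_conformalScale_ne_zero h] with x hx hx0
  by_contra hpx
  exact hx ⟨conformalMap h.mat x, ⟨conformalScale_inv_ne_zero h x hx0, hpx⟩,
    conformalMap_inv_map h x hx0⟩

end Action

end Branching
end

noncomputable section

namespace Branching

variable {N : ℕ} {μ : ℝ}

/-! ## The action on test functions -/

section TestAction

theorem riesz_kernel_conformal (h : SO₀ (N + 1)) {x y : E N} (a : ℝ)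
    (hx : conformalScale h.mat x ≠ 0) (hy : conformalScale h.mat y ≠ 0) :
    conformalScale h.mat x ^ (-a) * conformalScale h.mat y ^ (-a) *
      ‖conformalMap h.mat x - conformalMap h.mat y‖ ^ (-(2 * a)) = ‖x - y‖ ^ (-(2 * a)) := by
  have h1 := scale_mul_scale_mul_dist h x y hx hy
  have hx' := (conformalScale_pos h hx).le
  have hy' := (conformalScale_pos h hy).le
  rw [← mul_neg, ← sq_rpow (norm_nonneg _), ← sq_rpow (norm_nonneg _),
    ← Real.mul_rpow hx' hy', ← Real.mul_rpow (mul_nonneg hx' hy') (by positivity), h1]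

/-- A bound for the time coordinate of the image of a light-like vector. -/
def timeBound {p : ℕ} (A : Matrix (Fin p ⊕ Fin 1) (Fin p ⊕ Fin 1) ℝ) : ℝ :=
  ∑ i, |A (Sum.inr 0) i|

theorem continuous_timeBound {p : ℕ} : Continuous (timeBound (p := p)) := by
  unfold timeBound; fun_prop

theorem timeBound_nonneg {p : ℕ} (A : Matrix (Fin p ⊕ Fin 1) (Fin p ⊕ Fin 1) ℝ) :
    0 ≤ timeBound A := Finset.sum_nonneg fun _ _ => abs_nonneg _

theorem mulVec_time_le {p : ℕ} (A : Matrix (Fin p ⊕ Fin 1) (Fin p ⊕ Fin 1) ℝ)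
    {X : Fin p ⊕ Fin 1 → ℝ} (hX : lorentzInner X X = 0) :
    (A *ᵥ X) (Sum.inr 0) ≤ timeBound A * |X (Sum.inr 0)| := by
  rw [timeBound, Finset.sum_mul]
  change ∑ i, A (Sum.inr 0) i * X i ≤ _
  refine Finset.sum_le_sum fun i _ => (le_abs_self _).trans ?_
  rw [abs_mul]
  exact mul_le_mul_of_nonneg_left (abs_le_time_of_lightlike hX i) (abs_nonneg _)

/-- `1 + |x|²` is the time coordinate of `h` applied to the light-like vector `h⁻¹ v(x)`, and `h`
enlarges time coordinates of such vectors by a bounded factor. -/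
theorem one_add_norm_sq_le (h : SO₀ (N + 1)) (x : E N) (hx : conformalScale h⁻¹.mat x ≠ 0) :
    1 + ‖x‖ ^ 2 ≤ timeBound h.mat *
      (conformalScale h⁻¹.mat x * (1 + ‖conformalMap h⁻¹.mat x‖ ^ 2)) := by
  have h1 := mulVec_time_le h.mat (lorentzInner_mulVec_self h⁻¹ x)
  rw [Matrix.mulVec_mulVec, SO₀.mat_mul_inv, Matrix.one_mulVec, abs_of_pos (time_pos _ _),
    ← conformalScale_mul_time _ _ hx] at h1
  exact h1

theorem measurable_conformalMap (A : Matrix (Fin (N + 1) ⊕ Fin 1) (Fin (N + 1) ⊕ Fin 1) ℝ) :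
    Measurable (conformalMap A : E N → E N) := by
  have h : Measurable fun x : E N => fun i : Fin N =>
      (A *ᵥ lightVector x) (Sum.inl i.succ) / (2 * conformalScale A x) := by
    refine measurable_pi_lambda _ fun i => ?_
    exact (contDiff_mulVec_lightVector A _).continuous.measurable.div
      ((contDiff_conformalScale A).continuous.measurable.const_mul 2)
  exact (MeasurableEquiv.toLp 2 (Fin N → ℝ)).measurable.comp h

theorem aestronglyMeasurable_principalAction [NeZero N] (s : ℝ) (h : SO₀ (N + 1)) {g : E N → ℂ}
    (hg : AEStronglyMeasurable g) : AEStronglyMeasurable (principalAction s h g) := by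
  have hq : Measure.QuasiMeasurePreserving (conformalMap h⁻¹.mat : E N → E N) volume volume := by
    refine ⟨measurable_conformalMap _, fun s hs => ?_⟩
    obtain ⟨t, hst, ht, ht0⟩ := exists_measurable_superset_of_null hs
    refine measure_mono_null hst ?_
    rw [Measure.map_apply (measurable_conformalMap _) ht]
    have := ae_conformalMap h⁻¹ (measure_eq_zero_iff_ae_notMem.1 ht0)
    exact measure_eq_zero_iff_ae_notMem.2 this
  refine AEStronglyMeasurable.mul ?_ (hg.comp_quasiMeasurePreserving hq)
  exact (Complex.measurable_ofReal.comp
    ((contDiff_conformalScale h⁻¹.mat).continuous.measurable.pow_const (-s))).aestronglyMeasurable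

/-- The exponent of the weight is the parameter of the action, so the factor `J` merges with it into
`(J (1 + |h⁻¹x|²))^{-(N-μ)}`, which `one_add_norm_sq_le` compares with the weight at `x`. This makes
the space of test functions invariant. -/
theorem norm_principalAction_le [ComplementaryRange N μ] (h : SO₀ (N + 1)) {g : E N → ℂ} {C : ℝ}
    (hC : ∀ x, ‖g x‖ ≤ C * weight N μ x) (x : E N) :
    ‖principalAction (N - μ) h g x‖ ≤ C * timeBound h.mat ^ ((N : ℝ) - μ) * weight N μ x := by
  have hs : 0 < (N : ℝ) - μ := by linarith [range_pos N μ, range_lt N μ]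
  have hC0 : 0 ≤ C := nonneg_of_mul_nonneg_left ((norm_nonneg _).trans (hC 0)) (weight_pos 0)
  have hw := weight_pos (μ := μ) x
  have hT := timeBound_nonneg h.mat
  by_cases hx : conformalScale h⁻¹.mat x = 0
  -- At the singular point the real power of `0` has the default value `0`, so the bound is trivial
  -- there.
  · rw [principalAction, hx, Real.zero_rpow (by linarith)]
    simp only [Complex.ofReal_zero, zero_mul, norm_zero]
    positivity
  have hJ := conformalScale_pos h⁻¹ hx
  have h1 := one_add_norm_sq_le h x hx
  rw [principalAction, norm_mul, Complex.norm_real, Real.norm_of_nonneg (by positivity)]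
  set J := conformalScale h⁻¹.mat x
  set y := conformalMap h⁻¹.mat x
  calc J ^ (-((N : ℝ) - μ)) * ‖g y‖ ≤ J ^ (-((N : ℝ) - μ)) * (C * weight N μ y) := by
        gcongr; exact hC y
    _ = C * (J * (1 + ‖y‖ ^ 2)) ^ (-((N : ℝ) - μ)) := by
        rw [weight, Real.mul_rpow hJ.le (by positivity)]; ring
    _ ≤ C * (timeBound h.mat ^ ((N : ℝ) - μ) * weight N μ x) := by
        gcongr
        rw [weight, Real.rpow_neg (by positivity), Real.rpow_neg (by positivity),
          ← div_eq_mul_inv, inv_le_iff_one_le_mul₀ (by positivity), div_mul_eq_mul_div,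
          one_le_div (by positivity), ← Real.mul_rpow hT (by positivity)]
        gcongr
    _ = _ := by ring

theorem principalAction_congr [NeZero N] (s : ℝ) (h : SO₀ (N + 1)) {f g : E N → ℂ}
    (hfg : f =ᵐ[volume] g) : principalAction s h f =ᵐ[volume] principalAction s h g := by
  filter_upwards [ae_conformalMap h⁻¹ hfg] with x hx
  simp only [principalAction, hx]

theorem principalAction_mul [NeZero N] (s : ℝ) (h k : SO₀ (N + 1)) (g : E N → ℂ) :
    principalAction s (h * k) g =ᵐ[volume] principalAction s h (principalAction s k g) := by
  filter_upwards [ae_conformalScale_ne_zero h⁻¹] with x hx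
  simp only [principalAction]
  rw [mul_inv_rev, conformalScale_mul _ _ _ hx, conformalMap_mul _ _ _ hx,
    Real.mul_rpow (conformalScale_nonneg _ _) (conformalScale_nonneg _ _)]
  push_cast; ring

theorem principalAction_one (s : ℝ) (g : E N → ℂ) :
    principalAction s (1 : SO₀ (N + 1)) g = g := by
  funext x
  simp [principalAction, SO₀.mat_one]

theorem star_principalAction_mul_conformalMap (h : SO₀ (N + 1)) (g f : E N → ℂ) {x : E N}
    (hx : conformalScale h.mat x ≠ 0) :
    (conformalScale h.mat x)⁻¹ ^ N • (star (principalAction (N - μ) h g (conformalMap h.mat x)) *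
      f (conformalMap h.mat x)) = star (g x) * principalAction μ h⁻¹ f x := by
  have hJ := conformalScale_pos h hx
  have h1 : conformalScale h⁻¹.mat (conformalMap h.mat x) = (conformalScale h.mat x)⁻¹ :=
    eq_inv_of_mul_eq_one_left (conformalScale_inv_mul h x hx)
  simp only [principalAction, inv_inv]
  rw [h1, conformalMap_inv_map h x hx, star_mul', Complex.star_def, Complex.conj_ofReal,
    Complex.real_smul]
  have h2 : (conformalScale h.mat x)⁻¹ ^ N * (conformalScale h.mat x)⁻¹ ^ (-((N : ℝ) - μ))
      = conformalScale h.mat x ^ (-μ) := by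
    rw [← Real.rpow_natCast, ← Real.rpow_add (inv_pos.2 hJ), Real.inv_rpow hJ.le,
      ← Real.rpow_neg hJ.le]
    congr 1; ring
  rw [← h2]; push_cast; ring

/-- The principal series with parameters `N - μ` and `μ` are dual to each other. -/
theorem integral_star_principalAction [NeZero N] (h : SO₀ (N + 1)) (g f : E N → ℂ) :
    ∫ x, star (principalAction (N - μ) h g x) * f x
      = ∫ x, star (g x) * principalAction μ h⁻¹ f x := by
  rw [integral_conformal h]
  refine integral_congr_ae ?_
  filter_upwards [ae_conformalScale_ne_zero h] with x hx using star_principalAction_mul_conformalMap h g f hx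

theorem integrable_star_principalAction [NeZero N] (h : SO₀ (N + 1)) {g f : E N → ℂ}
    (hi : Integrable fun x => star (principalAction (N - μ) h g x) * f x) :
    Integrable fun x => star (g x) * principalAction μ h⁻¹ f x := by
  refine (integrable_conformal h hi).congr ?_
  filter_upwards [ae_conformalScale_ne_zero h] with x hx using star_principalAction_mul_conformalMap h g f hx

variable [ComplementaryRange N μ]

variable (μ) in
/-- The action on test functions. -/
def testAction (h : SO₀ (N + 1)) : TestSpace N μ →ₗ[ℂ] TestSpace N μ where
  toFun g := ⟨principalAction (N - μ) h g.1, by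
    have := ComplementaryRange.neZero (N := N) (μ := μ)
    obtain ⟨hm, C, hC⟩ := g.2
    exact ⟨aestronglyMeasurable_principalAction _ h hm, _, norm_principalAction_le h hC⟩⟩
  map_add' g g' := by
    refine Subtype.ext (funext fun x => ?_)
    simp [principalAction, mul_add]
  map_smul' c g := by
    refine Subtype.ext (funext fun x => ?_)
    simp only [principalAction, SetLike.val_smul, Pi.smul_apply, smul_eq_mul, RingHom.id_apply]
    ring

theorem testVec_congr {g g' : TestSpace N μ} (h : g.1 =ᵐ[volume] g'.1) :
    testVec N μ g = testVec N μ g' := by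
  refine CompSeries.ext_ae ((testVec_ae g).trans (Filter.EventuallyEq.trans ?_ (testVec_ae g').symm))
  rw [fourier_congr_ae h]

/-- The Riesz form is treated as two nested pairings. The duality of the parameters `N - μ` and `μ`
moves `h` onto the kernel, first in `y` and then in `x`, and the covariance of `|x-y|^{-2μ}` absorbs
both factors. -/
theorem norm_testVec_testAction (h : SO₀ (N + 1)) (g : TestSpace N μ) :
    ‖testVec N μ (testAction μ h g)‖ = ‖testVec N μ g‖ := by
  have := ComplementaryRange.neZero (N := N) (μ := μ)
  obtain ⟨C, hC0, hC⟩ := exists_schur_bound N μ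
  -- The conjugations are arranged so that both integrals have the shape of
  -- `integral_star_principalAction`.
  have hform : ∀ g : TestSpace N μ,
      ∫ z : E N × E N, ((‖z.1 - z.2‖ ^ (-(2 * μ)) : ℝ) : ℂ) * (g.1 z.1 * star (g.1 z.2))
      = star (∫ x, star (g.1 x) * star (∫ y, star (g.1 y) * ((‖x - y‖ ^ (-(2 * μ)) : ℝ) : ℂ))) := by
    intro g
    rw [Measure.volume_eq_prod, integral_prod _ (hC g.1 (TestSpace.weightedSq g)).1,
      Complex.star_def, ← integral_conj]
    refine integral_congr_ae (.of_forall fun x => ?_)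
    simp only [map_mul, Complex.conj_conj]
    rw [← integral_const_mul]
    exact integral_congr_ae (.of_forall fun y => by simp only; ring)
  have hinner : ∀ᵐ x : E N, conformalScale h.mat x ^ (-μ) •
      (∫ y, star ((testAction μ h g).1 y) *
        ((‖conformalMap h.mat x - y‖ ^ (-(2 * μ)) : ℝ) : ℂ))
      = ∫ y, star (g.1 y) * ((‖x - y‖ ^ (-(2 * μ)) : ℝ) : ℂ) := by
    filter_upwards [ae_conformalScale_ne_zero h] with x hx
    have h1 := integral_star_principalAction (μ := μ) h g.1
      fun y => ((‖conformalMap h.mat x - y‖ ^ (-(2 * μ)) : ℝ) : ℂ)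
    change _ • (∫ y, star (principalAction (N - μ) h g.1 y) * _) = _
    rw [h1, ← integral_smul]
    refine integral_congr_ae ?_
    filter_upwards [ae_conformalScale_ne_zero h] with y hy
    rw [← riesz_kernel_conformal h μ hx hy]
    simp only [principalAction, inv_inv, Complex.real_smul]
    push_cast; ring
  have key : ∫ x, star ((testAction μ h g).1 x) * star (∫ y, star ((testAction μ h g).1 y) *
      ((‖x - y‖ ^ (-(2 * μ)) : ℝ) : ℂ))
      = ∫ x, star (g.1 x) * star (∫ y, star (g.1 y) * ((‖x - y‖ ^ (-(2 * μ)) : ℝ) : ℂ)) := by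
    refine (integral_star_principalAction (μ := μ) h g.1 _).trans ?_
    refine integral_congr_ae ?_
    filter_upwards [hinner] with x hx
    rw [← hx]
    simp only [principalAction, inv_inv, Complex.real_smul, star_mul', Complex.star_def,
      Complex.conj_ofReal]
  have h2 := norm_sq_testVec (testAction μ h g)
  rw [hform, key, ← hform, ← norm_sq_testVec, Complex.ofReal_inj] at h2
  exact (sq_eq_sq₀ (norm_nonneg _) (norm_nonneg _)).1 h2

end TestAction

/-! ## The complementary series representation -/

section Representation

variable [ComplementaryRange N μ]

variable (μ) in
/-- The operator by which a group element acts on `𝒞_μ`. -/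
def compOperator (h : SO₀ (N + 1)) : CompSeries N μ →L[ℂ] CompSeries N μ :=
  (testVec N μ ∘ₗ testAction μ h).extendOfNorm (testVec N μ)

theorem compOperator_testVec (h : SO₀ (N + 1)) (g : TestSpace N μ) :
    compOperator μ h (testVec N μ g) = testVec N μ (testAction μ h g) :=
  LinearMap.extendOfNorm_eq denseRange_testVec
    ⟨1, fun g => by rw [one_mul]; exact (norm_testVec_testAction h g).le⟩ g

theorem norm_compOperator (h : SO₀ (N + 1)) (u : CompSeries N μ) : ‖compOperator μ h u‖ = ‖u‖ := by
  refine denseRange_testVec.induction_on u ?_ fun g => ?_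
  · exact isClosed_eq (compOperator μ h).continuous.norm continuous_norm
  · rw [compOperator_testVec, norm_testVec_testAction]

theorem compOperator_mul (h k : SO₀ (N + 1)) (u : CompSeries N μ) :
    compOperator μ (h * k) u = compOperator μ h (compOperator μ k u) := by
  have := ComplementaryRange.neZero (N := N) (μ := μ)
  refine denseRange_testVec.induction_on u ?_ fun g => ?_
  · exact isClosed_eq (compOperator μ (h * k)).continuous
      ((compOperator μ h).continuous.comp (compOperator μ k).continuous)
  · simp only [compOperator_testVec]
    exact testVec_congr (principalAction_mul _ h k g.1)

theorem compOperator_one (u : CompSeries N μ) : compOperator μ (1 : SO₀ (N + 1)) u = u := by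
  refine denseRange_testVec.induction_on u ?_ fun g => ?_
  · exact isClosed_eq (compOperator μ 1).continuous continuous_id
  · rw [compOperator_testVec]
    congr 1
    exact Subtype.ext (principalAction_one _ _)

variable (N μ) in
/-- The complementary series representation. -/
def compRep : SO₀ (N + 1) →* (CompSeries N μ ≃ₗᵢ[ℂ] CompSeries N μ) where
  toFun h :=
    { toLinearEquiv := LinearEquiv.ofLinearMap (compOperator μ h).toLinearMap
        (compOperator μ h⁻¹).toLinearMap
        (LinearMap.ext fun u => by
          change compOperator μ h (compOperator μ h⁻¹ u) = u
          rw [← compOperator_mul, mul_inv_cancel, compOperator_one])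
        (LinearMap.ext fun u => by
          change compOperator μ h⁻¹ (compOperator μ h u) = u
          rw [← compOperator_mul, inv_mul_cancel, compOperator_one])
      norm_map' := norm_compOperator h }
  map_one' := LinearIsometryEquiv.ext compOperator_one
  map_mul' h k := LinearIsometryEquiv.ext (compOperator_mul h k)

theorem compRep_testVec (h : SO₀ (N + 1)) (g : TestSpace N μ) :
    compRep N μ h (testVec N μ g) = testVec N μ (testAction μ h g) :=
  compOperator_testVec h g

theorem inner_compRep (h : SO₀ (N + 1)) (u v : CompSeries N μ) :
    inner ℂ u (compRep N μ h v) = inner ℂ (compRep N μ h⁻¹ u) v := by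
  rw [← (compRep N μ h⁻¹).inner_map_map u]
  congr 1
  change compOperator μ h⁻¹ (compOperator μ h v) = v
  rw [← compOperator_mul, inv_mul_cancel, compOperator_one]

/-- By unitarity, `h` on the element becomes `h⁻¹` on the test vector, where it acts with parameter
`N - μ`; duality turns this into the action of `h` with parameter `μ` on the function. -/
theorem realizes_compRep_realization (h : SO₀ (N + 1)) (u : CompSeries N μ) :
    Realizes (compRep N μ h u) (principalAction μ h (realization u)) := by
  have := ComplementaryRange.neZero (N := N) (μ := μ)
  refine realizes_of_forall_test _ _ (fun φ => ?_) fun φ => ?_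
  · have h1 := integrable_test_mul_realization (testAction μ h⁻¹ (schwartzTest N μ φ)) u
    have h2 := integrable_star_principalAction (μ := μ) h⁻¹ h1
    simpa [schwartzTest, mul_comm] using h2
  · rw [inner_compRep, compRep_testVec, inner_testVec]
    refine Eq.trans ?_ (integral_star_principalAction (μ := μ) h⁻¹ _ _).symm
    exact integral_congr_ae (.of_forall fun x => by simp [schwartzTest, mul_comm])

theorem Realizes.compRep {u : CompSeries N μ} {f : E N → ℂ} (hf : Realizes u f)
    (h : SO₀ (N + 1)) : Realizes (compRep N μ h u) (principalAction μ h f) := by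
  have := ComplementaryRange.neZero (N := N) (μ := μ)
  exact (realizes_compRep_realization h u).congr
    (principalAction_congr _ h ((realizes_realization u).unique_right hf))

/-- Dominated convergence along the neighbourhoods of a group element requires them to be countably
generated. -/
instance {p : ℕ} : FirstCountableTopology (SO₀ p) := by
  have h0 : FirstCountableTopology (Matrix (Fin p ⊕ Fin 1) (Fin p ⊕ Fin 1) ℝ) :=
    inferInstanceAs (FirstCountableTopology (Fin p ⊕ Fin 1 → Fin p ⊕ Fin 1 → ℝ))
  have h1 : FirstCountableTopology (Matrix (Fin p ⊕ Fin 1) (Fin p ⊕ Fin 1) ℝ)ᵐᵒᵖ :=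
    MulOpposite.opHomeomorph.symm.isInducing.firstCountableTopology
  have h2 : FirstCountableTopology (GL (Fin p ⊕ Fin 1) ℝ) :=
    Units.isInducing_embedProduct.firstCountableTopology
  have h3 : FirstCountableTopology (SO p) := Topology.IsInducing.subtypeVal.firstCountableTopology
  exact Topology.IsInducing.subtypeVal.firstCountableTopology

/-- Dominated convergence. Near `h₀` the quantity `timeBound` stays below its value at `h₀` plus
one, which gives a common majorant through `norm_principalAction_le`; pointwise convergence fails at
most at the singular point of `h₀⁻¹`. -/
theorem continuous_inner_testVec_testAction (g : TestSpace N μ) (hg : Continuous g.1)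
    (u : CompSeries N μ) :
    Continuous fun h : SO₀ (N + 1) => inner ℂ (testVec N μ (testAction μ h g)) u := by
  have := ComplementaryRange.neZero (N := N) (μ := μ)
  simp only [inner_testVec]
  obtain ⟨hm, C, hC⟩ := g.2
  have hC0 : 0 ≤ C := nonneg_of_mul_nonneg_left ((norm_nonneg _).trans (hC 0)) (weight_pos 0)
  have hs : 0 < (N : ℝ) - μ := by linarith [range_pos N μ, range_lt N μ]
  rw [continuous_iff_continuousAt]
  intro h₀
  have hT : ∀ᶠ h : SO₀ (N + 1) in nhds h₀, timeBound h.mat < timeBound h₀.mat + 1 :=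
    (continuous_timeBound.comp SO₀.continuous_mat).continuousAt.eventually_lt
      continuousAt_const (lt_add_one _)
  refine continuousAt_of_dominated (bound := fun x =>
    C * (timeBound h₀.mat + 1) ^ ((N : ℝ) - μ) * (weight N μ x * ‖realization u x‖)) ?_ ?_ ?_ ?_
  · exact .of_forall fun h => (integrable_test_mul_realization (testAction μ h g) u).1
  · filter_upwards [hT] with h hh
    refine .of_forall fun x => ?_
    rw [norm_mul, norm_star, ← mul_assoc]
    gcongr
    refine (norm_principalAction_le h hC x).trans ?_
    have := weight_pos (μ := μ) x
    have := timeBound_nonneg h.mat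
    gcongr
  · exact (integrable_weight_mul_realization u).const_mul _
  · filter_upwards [ae_conformalScale_ne_zero h₀⁻¹] with x hx
    refine ContinuousAt.mul (continuous_star.continuousAt.comp ?_) continuousAt_const
    have hM : Continuous fun h : SO₀ (N + 1) => h⁻¹.mat *ᵥ lightVector x :=
      (SO₀.continuous_mat.comp continuous_inv).matrix_mulVec continuous_const
    have hMi : ∀ i, Continuous fun h : SO₀ (N + 1) => (h⁻¹.mat *ᵥ lightVector x) i :=
      fun i => (continuous_apply i).comp hM
    have hJ : Continuous fun h : SO₀ (N + 1) => conformalScale h⁻¹.mat x :=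
      ((hMi _).add (hMi _)).div_const 2
    refine ContinuousAt.mul (f := fun h : SO₀ (N + 1) =>
      ((conformalScale h⁻¹.mat x ^ (-((N : ℝ) - μ)) : ℝ) : ℂ)) ?_ ?_
    · exact Complex.continuous_ofReal.continuousAt.comp
        (hJ.continuousAt.rpow_const (Or.inl hx))
    · refine hg.continuousAt.comp (f := fun h : SO₀ (N + 1) => conformalMap h⁻¹.mat x) ?_
      refine (PiLp.continuous_toLp 2 _).continuousAt.comp (f := fun h : SO₀ (N + 1) =>
        fun i : Fin N => (h⁻¹.mat *ᵥ lightVector x) (Sum.inl i.succ) /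
          (2 * conformalScale h⁻¹.mat x)) ?_
      refine continuousAt_pi.2 fun i => ?_
      exact (hMi _).continuousAt.div (continuousAt_const.mul hJ.continuousAt) (by simpa using hx)

/-- The vectors with continuous orbit form a closed subspace, because the operators are isometric.
It contains the test vectors coming from Schwartz functions, whose orbits are weakly continuous and
of constant norm, hence continuous; these vectors span a dense subspace. -/
theorem continuous_compRep (u : CompSeries N μ) : Continuous fun h => compRep N μ h u := by
  let V : Submodule ℂ (CompSeries N μ) :=
    { carrier := {u | Continuous fun h => compRep N μ h u}
      zero_mem' := by
        change Continuous fun h => compRep N μ h 0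
        simp only [map_zero]; exact continuous_const
      add_mem' := fun {u v} hu hv => by
        change Continuous fun h => compRep N μ h (u + v)
        simp only [map_add]; exact Continuous.add hu hv
      smul_mem' := fun c u hu => by
        change Continuous fun h => compRep N μ h (c • u)
        simp only [map_smul]; exact Continuous.const_smul hu c }
  have hVc : IsClosed (V : Set (CompSeries N μ)) := by
    refine isClosed_of_closure_subset fun u hu => ?_
    change Continuous fun h => compRep N μ h u
    refine Metric.continuous_iff'.2 fun h₀ ε hε => ?_
    obtain ⟨v, hv, huv⟩ := Metric.mem_closure_iff.1 hu (ε / 3) (by positivity)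
    have hvc : Continuous fun h => compRep N μ h v := hv
    filter_upwards [Metric.continuous_iff'.1 hvc h₀ (ε / 3) (by positivity)] with h hh
    have e : ∀ k, dist (compRep N μ k u) (compRep N μ k v) = dist u v := fun k =>
      (compRep N μ k).dist_map u v
    calc _ ≤ dist (compRep N μ h u) (compRep N μ h v) +
          dist (compRep N μ h v) (compRep N μ h₀ v) +
          dist (compRep N μ h₀ v) (compRep N μ h₀ u) := dist_triangle4 _ _ _ _
      _ < ε / 3 + ε / 3 + ε / 3 := by
        rw [dist_comm (compRep N μ h₀ v), e, e]; gcongr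
      _ = ε := by ring
  have hVs : ∀ φ, testVec N μ (schwartzTest N μ φ) ∈ V := by
    intro φ
    change Continuous fun h => compRep N μ h (testVec N μ (schwartzTest N μ φ))
    set v := testVec N μ (schwartzTest N μ φ) with hv
    have hw : ∀ u, Continuous fun h => inner ℂ (compRep N μ h v) u := fun u => by
      simp only [hv, compRep_testVec]
      exact continuous_inner_testVec_testAction _
        (continuous_star.comp (𝓕 φ : 𝓢(E N, ℂ)).continuous) u
    rw [continuous_iff_continuousAt]
    intro h₀
    rw [ContinuousAt, tendsto_iff_norm_sub_tendsto_zero]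
    -- For vectors of equal norm the distance is a function of the inner product, so weak continuity
    -- implies strong continuity.
    have h1 : ∀ h, ‖compRep N μ h v - compRep N μ h₀ v‖ ^ 2
        = 2 * ‖v‖ ^ 2 - 2 * (inner ℂ (compRep N μ h v) (compRep N μ h₀ v) : ℂ).re := by
      intro h
      rw [@norm_sub_sq ℂ, LinearIsometryEquiv.norm_map, LinearIsometryEquiv.norm_map]
      simp only [RCLike.re_eq_complex_re]; ring
    have h2 : Filter.Tendsto (fun h => ‖compRep N μ h v - compRep N μ h₀ v‖ ^ 2) (nhds h₀)
        (nhds (‖compRep N μ h₀ v - compRep N μ h₀ v‖ ^ 2)) := by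
      simp only [h1]
      exact ((continuous_const.sub (continuous_const.mul
        (Complex.continuous_re.comp (hw (compRep N μ h₀ v))))).tendsto h₀)
    have h3 := h2.sqrt
    simpa using h3
  have hVt : V = ⊤ := by
    rw [← hVc.submodule_topologicalClosure_eq, Submodule.topologicalClosure_eq_top_iff,
      Submodule.eq_bot_iff]
    intro u hu
    exact eq_zero_of_inner_schwartzTest fun φ => (Submodule.mem_orthogonal _ _).1 hu _ (hVs φ)
  have : u ∈ V := by rw [hVt]; trivial
  exact this

theorem isComplementarySeries_compRep : IsComplementarySeries N μ (compRep N μ) :=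
  ⟨continuous_compRep, fun u => ⟨realization u, realizes_realization u, fun h =>
    realizes_compRep_realization h u⟩⟩

end Representation

end Branching
end

noncomputable section

namespace Branching

variable {N d : ℕ} {μ : ℝ}

/-! ## Splitting off the last coordinate -/

/-- The projection of `ℝ^{d+1}` onto the first `d` coordinates. -/
def tangential (x : E (d + 1)) : E d := WithLp.toLp 2 fun i => x i.castSucc

/-- The point of `ℝ^{d+1}` with first coordinates `y` and last coordinate `t`. -/
def join (y : E d) (t : ℝ) : E (d + 1) :=
  WithLp.toLp 2 (Fin.snoc (α := fun _ => ℝ) (fun i => y i) t)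

@[simp] theorem join_castSucc (y : E d) (t : ℝ) (i : Fin d) : join y t i.castSucc = y i := by
  simp [join]

@[simp] theorem join_last (y : E d) (t : ℝ) : join y t (Fin.last d) = t := by simp [join]

@[simp] theorem tangential_apply (x : E (d + 1)) (i : Fin d) : tangential x i = x i.castSucc := rfl

@[simp] theorem tangential_join (y : E d) (t : ℝ) : tangential (join y t) = y := by
  ext i; simp

@[simp] theorem join_tangential (x : E (d + 1)) : join (tangential x) (x (Fin.last d)) = x := by
  ext i; refine Fin.lastCases ?_ (fun i => ?_) i <;> simp

theorem hyperplaneIncl_eq_join (y : E d) : hyperplaneIncl y = join y 0 := rfl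

theorem norm_sq_eq_tangential (x : E (d + 1)) :
    ‖x‖ ^ 2 = ‖tangential x‖ ^ 2 + x (Fin.last d) ^ 2 := by
  rw [EuclideanSpace.real_norm_sq_eq, EuclideanSpace.real_norm_sq_eq, Fin.sum_univ_castSucc]
  rfl

theorem norm_join_sq (y : E d) (t : ℝ) : ‖join y t‖ ^ 2 = ‖y‖ ^ 2 + t ^ 2 := by
  rw [norm_sq_eq_tangential]; simp

theorem inner_hyperplaneIncl (ξ : E (d + 1)) (y : E d) :
    inner ℝ ξ (hyperplaneIncl y) = inner ℝ (tangential ξ) y := by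
  simp only [PiLp.inner_apply, Fin.sum_univ_castSucc, hyperplaneIncl_eq_join, join_castSucc,
    join_last]
  simp

theorem continuous_tangential : Continuous (tangential (d := d)) := by
  unfold tangential; fun_prop

theorem continuous_join : Continuous fun z : E d × ℝ => join z.1 z.2 := by
  refine (PiLp.continuous_toLp 2 _).comp (continuous_pi fun i => ?_)
  refine Fin.lastCases ?_ (fun i => ?_) i
  · simpa using continuous_snd
  · simp only [Fin.snoc_castSucc]; fun_prop

variable (d) in
/-- The decomposition `ℝ^d × ℝ = ℝ^{d+1}`. -/
def joinEquiv : E d × ℝ ≃ᵐ E (d + 1) where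
  toFun z := join z.1 z.2
  invFun x := (tangential x, x (Fin.last d))
  left_inv z := by simp
  right_inv x := by simp
  measurable_toFun := continuous_join.measurable
  measurable_invFun := (continuous_tangential.measurable).prodMk
    (by fun_prop : Continuous fun x : E (d + 1) => x (Fin.last d)).measurable

theorem measurePreserving_join :
    MeasurePreserving (joinEquiv d) := by
  have h1 := (volume_preserving_piFinSuccAbove (fun _ : Fin (d + 1) => ℝ) (Fin.last d)).symm
  have h2 : MeasurePreserving (fun z : E d × ℝ => (z.2, WithLp.ofLp z.1)) := by
    have := (MeasurePreserving.id (volume : Measure ℝ)).prod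
      (EuclideanSpace.volume_preserving_symm_measurableEquiv_toLp (Fin d))
    exact this.comp Measure.measurePreserving_swap
  have h3 := (EuclideanSpace.volume_preserving_symm_measurableEquiv_toLp (Fin (d + 1))).symm
  have h4 := h3.comp (h1.comp h2)
  convert h4 using 1
  funext z
  ext i
  refine Fin.lastCases ?_ (fun i => ?_) i
  · change join z.1 z.2 (Fin.last d) =
      Fin.insertNth (α := fun _ => ℝ) (Fin.last d) z.2 z.1.ofLp (Fin.last d)
    simp
  · change join z.1 z.2 i.castSucc =
      Fin.insertNth (α := fun _ => ℝ) (Fin.last d) z.2 z.1.ofLp i.castSucc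
    simp [Fin.insertNth_last']

theorem integrable_join_iff {F : Type*} [NormedAddCommGroup F] {f : E (d + 1) → F} :
    Integrable (fun z : E d × ℝ => f (join z.1 z.2)) ↔ Integrable f :=
  measurePreserving_join.integrable_comp_emb (joinEquiv d).measurableEmbedding

theorem integral_join_prod {F : Type*} [NormedAddCommGroup F] [NormedSpace ℝ F]
    (f : E (d + 1) → F) : ∫ z : E d × ℝ, f (join z.1 z.2) = ∫ x, f x :=
  measurePreserving_join.integral_comp (joinEquiv d).measurableEmbedding f

theorem integral_join {F : Type*} [NormedAddCommGroup F] [NormedSpace ℝ F]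
    {f : E (d + 1) → F} (hf : Integrable f) : ∫ x, f x = ∫ η, ∫ τ, f (join η τ) := by
  rw [← integral_join_prod, Measure.volume_eq_prod]
  exact integral_prod (fun z : E d × ℝ => f (join z.1 z.2)) (integrable_join_iff.2 hf)

theorem quasiMeasurePreserving_tangential :
    Measure.QuasiMeasurePreserving (tangential (d := d)) := by
  have h1 : Measure.QuasiMeasurePreserving (Prod.fst : E d × ℝ → E d) volume volume :=
    Measure.quasiMeasurePreserving_fst
  exact h1.comp (measurePreserving_join (d := d)).symm.quasiMeasurePreserving

/-! ## Juhl's polynomials -/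

/-- The coefficients of `juhlPoly`. -/
def gegenCoeff (a : ℝ) (j k : ℕ) : ℝ :=
  (j.descFactorial (2 * k) : ℝ) * ∏ i ∈ Finset.Icc 1 k, (4 * i * (1 / 2 - a - i))⁻¹

/-- The Gegenbauer polynomial of degree `j`, in homogeneous form and with leading coefficient
one. -/
def juhlPoly (a : ℝ) (j : ℕ) (s τ : ℝ) : ℝ :=
  ∑ k ∈ Finset.range (j + 1), gegenCoeff a j k * (τ ^ (j - 2 * k) * s ^ k)

theorem gegenCoeff_zero (a : ℝ) (j : ℕ) : gegenCoeff a j 0 = 1 := by simp [gegenCoeff]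

/-- The falling factorial vanishes. Hence truncated subtraction in the exponents does no harm, and
the upper limit of the sum may be moved. -/
theorem gegenCoeff_eq_zero (a : ℝ) {j k : ℕ} (h : j < 2 * k) : gegenCoeff a j k = 0 := by
  simp [gegenCoeff, Nat.descFactorial_eq_zero_iff_lt.2 h]

/-- The parameter is chosen so that `1/2 - a - i = μ + j - i - d/2`. -/
theorem gegenCoeff_eq_juhlCoeff (j k : ℕ) (h : 2 * k ≤ j) :
    gegenCoeff (((d : ℝ) + 1) / 2 - (μ + j)) j k = juhlCoeff d μ j k := by
  have h1 : ∏ i ∈ Finset.Icc 1 k, (4 * (i : ℝ) * (1 / 2 - (((d : ℝ) + 1) / 2 - (μ + j)) - i))⁻¹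
      = (4 ^ k * k.factorial : ℝ)⁻¹ * ∏ i ∈ Finset.Icc 1 k, (μ + j - i - d / 2 : ℝ)⁻¹ := by
    have h2 : (4 ^ k * k.factorial : ℝ) = ∏ i ∈ Finset.Icc 1 k, (4 * (i : ℝ)) := by
      clear h
      induction k with
      | zero => simp
      | succ k ih =>
        rw [Finset.prod_Icc_succ_top (by omega), ← ih, Nat.factorial_succ]; push_cast; ring
    rw [h2, ← Finset.prod_inv_distrib, ← Finset.prod_mul_distrib]
    refine Finset.prod_congr rfl fun i _ => ?_
    rw [mul_inv]
    congr 2; ring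
  rw [gegenCoeff, h1, juhlCoeff, ← mul_assoc]
  congr 1
  have h3 : ((j - 2 * k).factorial : ℝ) * (j.descFactorial (2 * k) : ℝ) = j.factorial := by
    exact_mod_cast Nat.factorial_mul_descFactorial h
  rw [← h3]
  have := Nat.factorial_ne_zero (j - 2 * k)
  field_simp

/-- The coefficient form of `juhlPoly_recurrence`. The bound on `a` keeps the new denominator `1/2 -
a - (k+1)` away from zero. -/
theorem gegenCoeff_recurrence {a : ℝ} (ha : 1 / 2 < a) (j k : ℕ) :
    (2 * a + j + 2 * (k + 1)) * gegenCoeff a j (k + 1) - (j - 2 * k) * gegenCoeff a j k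
      = (2 * a + j) * gegenCoeff a (j + 1) (k + 1) := by
  unfold gegenCoeff
  rw [Finset.prod_Icc_succ_top (by omega)]
  generalize ∏ i ∈ Finset.Icc 1 k, (4 * (i : ℝ) * (1 / 2 - a - i))⁻¹ = e
  have h0 : (1 / 2 - a - ((k + 1 : ℕ) : ℝ)) ≠ 0 := by push_cast; have : (0 : ℝ) ≤ k := k.cast_nonneg; linarith
  have h1 : ((j + 1).descFactorial (2 * (k + 1)) : ℝ)
      = (j + 1) * ((j - 2 * k) * j.descFactorial (2 * k)) := by
    rw [show 2 * (k + 1) = (2 * k + 1) + 1 by ring, Nat.succ_descFactorial_succ,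
      Nat.descFactorial_succ]
    push_cast
    rcases le_or_gt (2 * k) j with h | h
    · rw [Nat.cast_sub h]; push_cast; ring
    · rw [Nat.descFactorial_eq_zero_iff_lt.2 h]; simp
  have h2 : (j.descFactorial (2 * (k + 1)) : ℝ)
      = (j - 2 * k - 1) * ((j - 2 * k) * j.descFactorial (2 * k)) := by
    rw [show 2 * (k + 1) = (2 * k + 1) + 1 by ring, Nat.descFactorial_succ,
      Nat.descFactorial_succ]
    push_cast
    rcases le_or_gt (2 * k + 1) j with h | h
    · rw [Nat.cast_sub h, Nat.cast_sub (by omega)]; push_cast; ring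
    · rcases le_or_gt (2 * k) j with h' | h'
      · obtain rfl : j = 2 * k := by omega
        simp
      · rw [Nat.descFactorial_eq_zero_iff_lt.2 h']; simp
  rw [h1, h2]
  have h3 : ((k + 1 : ℕ) : ℝ) ≠ 0 := by positivity
  obtain ⟨x, hx⟩ : ∃ x, a = 1 / 2 - ((k + 1 : ℕ) : ℝ) - x :=
    ⟨1 / 2 - ((k + 1 : ℕ) : ℝ) - a, by ring⟩
  have h4 : 1 / 2 - a - ((k + 1 : ℕ) : ℝ) = x := by rw [hx]; ring
  rw [h4] at h0 ⊢
  rw [hx]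
  field_simp
  push_cast
  ring

theorem juhlPoly_eq_sum (a : ℝ) (j : ℕ) (s τ : ℝ) {M : ℕ} (hM : j / 2 < M) :
    juhlPoly a j s τ = ∑ k ∈ Finset.range M, gegenCoeff a j k * (τ ^ (j - 2 * k) * s ^ k) := by
  have h : ∀ L, j / 2 + 1 ≤ L →
      ∑ k ∈ Finset.range (j / 2 + 1), gegenCoeff a j k * (τ ^ (j - 2 * k) * s ^ k)
      = ∑ k ∈ Finset.range L, gegenCoeff a j k * (τ ^ (j - 2 * k) * s ^ k) := by
    intro L hL
    refine Finset.sum_subset (Finset.range_mono hL) fun k _ hk => ?_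
    rw [gegenCoeff_eq_zero a (by simp only [Finset.mem_range] at hk; omega), zero_mul]
  rw [juhlPoly, ← h _ (by omega), ← h _ hM]

theorem juhlPoly_eq_juhlCoeff (j : ℕ) (s τ : ℝ) :
    juhlPoly (((d : ℝ) + 1) / 2 - (μ + j)) j s τ =
      ∑ k ∈ Finset.range (j / 2 + 1), juhlCoeff d μ j k * (τ ^ (j - 2 * k) * s ^ k) := by
  rw [juhlPoly_eq_sum _ _ _ _ (Nat.lt_succ_self _)]
  refine Finset.sum_congr rfl fun k hk => ?_
  rw [gegenCoeff_eq_juhlCoeff _ _ (by simp only [Finset.mem_range] at hk; omega)]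

theorem hasDerivAt_juhlPoly (a : ℝ) (j : ℕ) (s τ : ℝ) :
    HasDerivAt (juhlPoly a j s) (∑ k ∈ Finset.range (j + 1),
      gegenCoeff a j k * (((j - 2 * k : ℕ) : ℝ) * τ ^ (j - 2 * k - 1) * s ^ k)) τ := by
  unfold juhlPoly
  refine HasDerivAt.fun_sum fun k _ => ?_
  exact ((hasDerivAt_pow _ τ).mul_const _).const_mul _

/-- Differentiating `(s+τ²)^{-a-j} P_j` in `τ` and taking out `(s+τ²)^{-a-j-1}` leaves the left
side. This is the induction step of the Rodrigues formula. -/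
theorem juhlPoly_recurrence {a : ℝ} (ha : 1 / 2 < a) (j : ℕ) (s τ : ℝ) :
    (s + τ ^ 2) * (∑ k ∈ Finset.range (j + 1),
      gegenCoeff a j k * (((j - 2 * k : ℕ) : ℝ) * τ ^ (j - 2 * k - 1) * s ^ k))
      - 2 * (a + j) * τ * juhlPoly a j s τ = -(2 * a + j) * juhlPoly a (j + 1) s τ := by
  have h1 : ∀ k, (s + τ ^ 2) * (gegenCoeff a j k *
      (((j - 2 * k : ℕ) : ℝ) * τ ^ (j - 2 * k - 1) * s ^ k))
      - 2 * (a + j) * τ * (gegenCoeff a j k * (τ ^ (j - 2 * k) * s ^ k))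
      = (j - 2 * k) * gegenCoeff a j k * (τ ^ (j + 1 - 2 * (k + 1)) * s ^ (k + 1))
        - (2 * a + j + 2 * k) * gegenCoeff a j k * (τ ^ (j + 1 - 2 * k) * s ^ k) := by
    intro k
    rcases lt_or_ge j (2 * k) with h | h
    · rw [gegenCoeff_eq_zero a h]; ring
    · have e1 : j + 1 - 2 * (k + 1) = j - 2 * k - 1 := by omega
      have e2 : j + 1 - 2 * k = (j - 2 * k) + 1 := by omega
      have e3 : (j : ℝ) = ((j - 2 * k : ℕ) : ℝ) + 2 * k := by rw [Nat.cast_sub h]; push_cast; ring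
      rw [e1, e2, e3]
      generalize j - 2 * k = m
      cases m with
      | zero => push_cast; ring
      | succ m => rw [Nat.add_sub_cancel]; push_cast; ring
  rw [juhlPoly, Finset.mul_sum, Finset.mul_sum, ← Finset.sum_sub_distrib,
    Finset.sum_congr rfl fun k _ => h1 k, Finset.sum_sub_distrib,
    juhlPoly_eq_sum a (j + 1) s τ (M := j + 2) (by omega), Finset.sum_range_succ' _ (j + 1)]
  -- The summand `k = j + 1` is zero; adding it gives both sums the range of the polynomial of
  -- degree `j + 1`.
  have h2 : ∑ k ∈ Finset.range (j + 1),
      (2 * a + j + 2 * k) * gegenCoeff a j k * (τ ^ (j + 1 - 2 * k) * s ^ k)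
      = ∑ k ∈ Finset.range (j + 2),
      (2 * a + j + 2 * k) * gegenCoeff a j k * (τ ^ (j + 1 - 2 * k) * s ^ k) := by
    rw [Finset.sum_range_succ _ (j + 1), gegenCoeff_eq_zero a (by omega : j < 2 * (j + 1))]; ring
  rw [h2, Finset.sum_range_succ' _ (j + 1), gegenCoeff_zero, gegenCoeff_zero, mul_add,
    Finset.mul_sum, ← sub_sub, ← Finset.sum_sub_distrib]
  rw [sub_eq_add_neg]
  congr 1
  · refine Finset.sum_congr rfl fun k _ => ?_
    have := gegenCoeff_recurrence ha j k
    rw [show -(2 * a + (j : ℝ)) * (gegenCoeff a (j + 1) (k + 1) *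
      (τ ^ (j + 1 - 2 * (k + 1)) * s ^ (k + 1))) = -((2 * a + j) * gegenCoeff a (j + 1) (k + 1)) *
      (τ ^ (j + 1 - 2 * (k + 1)) * s ^ (k + 1)) by ring, ← this]
    push_cast; ring
  · push_cast; ring

/-! ### The Rodrigues formula, and bounds for Juhl's polynomials -/

/-- The functions `∂_τ^i (s + τ²)^{-a}`. -/
def kernelDeriv (a : ℝ) (s : ℝ) (i : ℕ) (τ : ℝ) : ℝ :=
  (-1) ^ i * (∏ l ∈ Finset.range i, (2 * a + l)) * ((s + τ ^ 2) ^ (-a - i) * juhlPoly a i s τ)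

theorem kernelDeriv_zero (a s τ : ℝ) : kernelDeriv a s 0 τ = (s + τ ^ 2) ^ (-a) := by
  simp [kernelDeriv, juhlPoly, gegenCoeff_zero]

/-- The Rodrigues formula. -/
theorem hasDerivAt_kernelDeriv {a : ℝ} (ha : 1 / 2 < a) {s : ℝ} (hs : 0 < s) (i : ℕ) (τ : ℝ) :
    HasDerivAt (kernelDeriv a s i) (kernelDeriv a s (i + 1) τ) τ := by
  have hp : 0 < s + τ ^ 2 := by positivity
  have h1 : HasDerivAt (fun τ : ℝ => s + τ ^ 2) (2 * τ) τ := by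
    simpa using (hasDerivAt_pow 2 τ).const_add s
  have h2 := ((h1.rpow_const (p := -a - i) (Or.inl hp.ne')).mul
    (hasDerivAt_juhlPoly a i s τ)).const_mul ((-1) ^ i * (∏ l ∈ Finset.range i, (2 * a + l)))
  refine h2.congr_deriv ?_
  have h3 := juhlPoly_recurrence ha i s τ
  have h4 : (s + τ ^ 2) ^ (-a - i) = (s + τ ^ 2) ^ (-a - i - 1) * (s + τ ^ 2) := by
    rw [← Real.rpow_add_one hp.ne']; congr 1; ring
  rw [kernelDeriv, Finset.prod_range_succ, pow_succ (-1 : ℝ)]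
  have h5 : -a - ((i + 1 : ℕ) : ℝ) = -a - i - 1 := by push_cast; ring
  rw [h5, h4]
  linear_combination (-1) ^ i * (∏ l ∈ Finset.range i, (2 * a + l)) *
    (s + τ ^ 2) ^ (-a - i - 1) * h3

theorem exists_juhlPoly_bound (a : ℝ) (j : ℕ) : ∃ C : ℝ, 0 ≤ C ∧ ∀ q s τ : ℝ, 0 ≤ q → 0 ≤ s →
    s + τ ^ 2 = q ^ 2 → |juhlPoly a j s τ| ≤ C * q ^ j := by
  refine ⟨∑ k ∈ Finset.range (j + 1), |gegenCoeff a j k|,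
    Finset.sum_nonneg fun _ _ => abs_nonneg _, fun q s τ hq hs h => ?_⟩
  rw [juhlPoly, Finset.sum_mul]
  refine (Finset.abs_sum_le_sum_abs _ _).trans (Finset.sum_le_sum fun k _ => ?_)
  rw [abs_mul]
  rcases lt_or_ge j (2 * k) with h' | h'
  · rw [gegenCoeff_eq_zero a h']; simp
  · refine mul_le_mul_of_nonneg_left ?_ (abs_nonneg _)
    have hτ : |τ| ≤ q := abs_le_of_sq_le_sq (by nlinarith) hq
    have hs' : s ≤ q ^ 2 := by nlinarith [sq_nonneg τ]
    rw [abs_mul, abs_pow, abs_pow, abs_of_nonneg hs]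
    calc |τ| ^ (j - 2 * k) * s ^ k ≤ q ^ (j - 2 * k) * (q ^ 2) ^ k := by gcongr
      _ = q ^ j := by rw [← pow_mul, ← pow_add]; congr 1; omega

theorem juhlPoly_homogeneous (a : ℝ) (j : ℕ) (r s τ : ℝ) :
    juhlPoly a j (r ^ 2 * s) (r * τ) = r ^ j * juhlPoly a j s τ := by
  rw [juhlPoly, juhlPoly, Finset.mul_sum]
  refine Finset.sum_congr rfl fun k _ => ?_
  rcases lt_or_ge j (2 * k) with h | h
  · rw [gegenCoeff_eq_zero a h]; simp
  · have : r ^ j = r ^ (j - 2 * k) * (r ^ 2) ^ k := by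
      rw [← pow_mul, ← pow_add]; congr 1; omega
    rw [this, mul_pow, mul_pow]; ring

theorem continuous_juhlPoly (a : ℝ) (j : ℕ) :
    Continuous fun z : ℝ × ℝ => juhlPoly a j z.1 z.2 := by
  unfold juhlPoly; fun_prop

theorem juhlPoly_zero_one (a : ℝ) (j : ℕ) : juhlPoly a j 0 1 = 1 := by
  rw [juhlPoly, Finset.sum_eq_single 0]
  · simp [gegenCoeff_zero]
  · intro k _ hk; simp [hk]
  · simp

/-- Otherwise homogeneity gives `P(s, 1) = 0` for all `s > 0`, and continuity gives `P(0, 1) = 0`;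
but `P(0, 1)` is the leading coefficient, which is one. -/
theorem exists_juhlPoly_ne_zero (a : ℝ) (j : ℕ) : ∃ τ, juhlPoly a j 1 τ ≠ 0 := by
  by_contra! h
  have h1 : ∀ s > 0, juhlPoly a j s 1 = 0 := by
    intro s hs
    have := juhlPoly_homogeneous a j (√s) 1 (√s)⁻¹
    rwa [h, mul_zero, Real.sq_sqrt hs.le, mul_one, mul_inv_cancel₀ (Real.sqrt_pos.2 hs).ne'] at this
  have hc : Continuous fun s => juhlPoly a j s 1 :=
    (continuous_juhlPoly a j).comp (by fun_prop : Continuous fun s : ℝ => (s, (1 : ℝ)))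
  have h2 : Filter.Tendsto (fun s => juhlPoly a j s 1) (nhdsWithin 0 (Set.Ioi 0))
      (nhds (juhlPoly a j 0 1)) := (hc.tendsto 0).mono_left nhdsWithin_le_nhds
  have h3 := tendsto_nhds_unique h2 (tendsto_const_nhds.congr' (by
    filter_upwards [self_mem_nhdsWithin] with s hs using (h1 s hs).symm))
  rw [juhlPoly_zero_one] at h3
  exact one_ne_zero h3

end Branching
end

noncomputable section

namespace Branching

variable {N d j : ℕ} {μ : ℝ}

/-! ## The isometry of `𝒞_{μ+j}` into `𝒞_μ` -/

/-- The Gegenbauer parameter `a = (d + 1) / 2 - (μ + j)`. -/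
def juhlIndex (d : ℕ) (μ : ℝ) (j : ℕ) : ℝ := ((d : ℝ) + 1) / 2 - (μ + j)

theorem half_lt_juhlIndex [h : ComplementaryRange d (μ + j)] : 1 / 2 < juhlIndex d μ j := by
  have := range_lt d (μ + j)
  unfold juhlIndex; linarith

/-- The symbol of Juhl's operator, up to the factor `(2πi)^j`. -/
def juhlSymbol (d : ℕ) (μ : ℝ) (j : ℕ) (ξ : E (d + 1)) : ℝ :=
  juhlPoly (juhlIndex d μ j) j (‖tangential ξ‖ ^ 2) (ξ (Fin.last d))

theorem continuous_juhlSymbol : Continuous (juhlSymbol d μ j) :=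
  (continuous_juhlPoly _ j).comp ((continuous_tangential.norm.pow 2).prodMk (by fun_prop))

theorem norm_join_rpow (η : E d) (τ b : ℝ) : ‖join η τ‖ ^ b = (‖η‖ ^ 2 + τ ^ 2) ^ (b / 2) := by
  rw [← norm_join_sq, sq_rpow (norm_nonneg _)]; congr 1; ring

theorem juhlSymbol_join (η : E d) (τ : ℝ) :
    juhlSymbol d μ j (join η τ) = juhlPoly (juhlIndex d μ j) j (‖η‖ ^ 2) τ := by
  simp [juhlSymbol]

/-- The integral of the square of the symbol over a slice. -/
def branchConst (d : ℕ) (μ : ℝ) (j : ℕ) : ℝ :=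
  ∫ τ : ℝ, (1 + τ ^ 2) ^ ((2 * μ - (d + 1)) / 2) * juhlPoly (juhlIndex d μ j) j 1 τ ^ 2

section Slice

variable [h : ComplementaryRange d (μ + j)]

/-- The polynomial is `O((1+τ²)^{j/2})`, so the integrand is `O((1+τ²)^{-a})`, which is integrable
since `2a > 1`. This is where `μ + j < d/2` is essential. -/
theorem integrable_branchConst : Integrable fun τ : ℝ =>
    (1 + τ ^ 2) ^ ((2 * μ - (d + 1)) / 2) * juhlPoly (juhlIndex d μ j) j 1 τ ^ 2 := by
  obtain ⟨C, hC, hb⟩ := exists_juhlPoly_bound (juhlIndex d μ j) j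
  have ha := half_lt_juhlIndex (d := d) (μ := μ) (j := j)
  have hi : Integrable fun τ : ℝ => ((1 : ℝ) + ‖τ‖ ^ 2) ^ (-(2 * juhlIndex d μ j) / 2) :=
    integrable_rpow_neg_one_add_norm_sq (by simp; linarith)
  refine (hi.const_mul (C ^ 2)).mono' ?_ (.of_forall fun τ => ?_)
  · refine Continuous.aestronglyMeasurable (Continuous.mul ?_ ?_)
    · exact Continuous.rpow_const (by fun_prop) fun τ => Or.inl (by positivity)
    · exact ((continuous_juhlPoly _ j).comp (by fun_prop : Continuous fun τ : ℝ => ((1 : ℝ), τ))).pow 2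
  · have hp : (0 : ℝ) < 1 + τ ^ 2 := by positivity
    have h1 := hb (√(1 + τ ^ 2)) 1 τ (Real.sqrt_nonneg _) zero_le_one (Real.sq_sqrt hp.le).symm
    have h2 : juhlPoly (juhlIndex d μ j) j 1 τ ^ 2 ≤ C ^ 2 * (1 + τ ^ 2) ^ (j : ℝ) := by
      rw [← sq_abs, Real.rpow_natCast]
      calc _ ≤ (C * √(1 + τ ^ 2) ^ j) ^ 2 := by gcongr
        _ = _ := by rw [mul_pow, ← pow_mul, mul_comm j 2, pow_mul, Real.sq_sqrt hp.le]
    rw [Real.norm_of_nonneg (by positivity), Real.norm_eq_abs, sq_abs]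
    calc _ ≤ (1 + τ ^ 2) ^ ((2 * μ - (d + 1)) / 2) * (C ^ 2 * (1 + τ ^ 2) ^ (j : ℝ)) := by gcongr
      _ = C ^ 2 * ((1 + τ ^ 2) ^ ((2 * μ - (d + 1)) / 2) * (1 + τ ^ 2) ^ (j : ℝ)) := by ring
      _ = _ := by
        rw [← Real.rpow_add hp]; congr 2; unfold juhlIndex; ring

theorem branchConst_pos : 0 < branchConst d μ j := by
  obtain ⟨τ, hτ⟩ := exists_juhlPoly_ne_zero (juhlIndex d μ j) j
  have hc : Continuous fun τ : ℝ =>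
      (1 + τ ^ 2) ^ ((2 * μ - (d + 1)) / 2) * juhlPoly (juhlIndex d μ j) j 1 τ ^ 2 := by
    refine Continuous.mul ?_ ?_
    · exact Continuous.rpow_const (by fun_prop) fun τ => Or.inl (by positivity)
    · exact ((continuous_juhlPoly _ j).comp (by fun_prop : Continuous fun τ : ℝ => ((1 : ℝ), τ))).pow 2
  refine integral_pos_of_integrable_nonneg_nonzero (x := τ) hc integrable_branchConst
    (fun τ => by positivity) ?_
  positivity

omit h in
theorem slice_scaling {r : ℝ} (hr : 0 < r) (τ : ℝ) :
    (r ^ 2 + τ ^ 2) ^ ((2 * μ - (d + 1)) / 2) * juhlPoly (juhlIndex d μ j) j (r ^ 2) τ ^ 2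
      = r ^ (2 * (μ + j) - (d + 1)) * ((1 + (r⁻¹ * τ) ^ 2) ^ ((2 * μ - (d + 1)) / 2) *
        juhlPoly (juhlIndex d μ j) j 1 (r⁻¹ * τ) ^ 2) := by
  have h1 := juhlPoly_homogeneous (juhlIndex d μ j) j r 1 (r⁻¹ * τ)
  rw [mul_one, mul_inv_cancel_left₀ hr.ne'] at h1
  have h2 : r ^ 2 + τ ^ 2 = r ^ 2 * (1 + (r⁻¹ * τ) ^ 2) := by field_simp
  rw [h1, h2, Real.mul_rpow (by positivity) (by positivity), sq_rpow hr.le, mul_pow (r ^ j), ← pow_mul,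
    ← Real.rpow_natCast r (j * 2)]
  have h3 : r ^ (2 * (μ + j) - (d + 1)) = r ^ (2 * ((2 * μ - (d + 1)) / 2)) * r ^ ((j * 2 : ℕ) : ℝ) := by
    rw [← Real.rpow_add hr]; congr 1; push_cast; ring
  rw [h3]; ring

/-- Homogeneity and the substitution `τ = r σ`, which contributes one further power of `r`. -/
theorem integral_slice {r : ℝ} (hr : 0 < r) :
    Integrable (fun τ : ℝ => (r ^ 2 + τ ^ 2) ^ ((2 * μ - (d + 1)) / 2) *
      juhlPoly (juhlIndex d μ j) j (r ^ 2) τ ^ 2) ∧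
    ∫ τ : ℝ, (r ^ 2 + τ ^ 2) ^ ((2 * μ - (d + 1)) / 2) *
      juhlPoly (juhlIndex d μ j) j (r ^ 2) τ ^ 2 = r ^ (2 * (μ + j) - d) * branchConst d μ j := by
  simp only [slice_scaling hr]
  refine ⟨(integrable_branchConst.comp_mul_left' (inv_pos.2 hr).ne').const_mul _, ?_⟩
  rw [integral_const_mul, Measure.integral_comp_mul_left (fun τ : ℝ =>
    (1 + τ ^ 2) ^ ((2 * μ - (d + 1)) / 2) * juhlPoly (juhlIndex d μ j) j 1 τ ^ 2), inv_inv,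
    abs_of_pos hr, smul_eq_mul, ← mul_assoc, ← Real.rpow_add_one hr.ne']
  congr 2; ring

/-- Fubini over the lines normal to the hyperplane: each slice integral turns the dual weight
`|ξ|^{2μ-(d+1)}` of `𝒞_μ` into the dual weight `|η|^{2(μ+j)-d}` of `𝒞_{μ+j}`. -/
theorem integral_symbol_sq_mul {V : E d → ℝ} (hV0 : ∀ η, 0 ≤ V η) (hVm : AEStronglyMeasurable V)
    (hV : Integrable fun η => ‖η‖ ^ (2 * (μ + j) - d) * V η) :
    Integrable (fun ξ : E (d + 1) => ‖ξ‖ ^ (2 * μ - (d + 1 : ℕ)) *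
      (juhlSymbol d μ j ξ ^ 2 * V (tangential ξ))) ∧
    ∫ ξ : E (d + 1), ‖ξ‖ ^ (2 * μ - (d + 1 : ℕ)) * (juhlSymbol d μ j ξ ^ 2 * V (tangential ξ))
      = branchConst d μ j * ∫ η, ‖η‖ ^ (2 * (μ + j) - d) * V η := by
  have := ComplementaryRange.neZero (N := d) (μ := μ + j)
  set f : E (d + 1) → ℝ := fun ξ => ‖ξ‖ ^ (2 * μ - (d + 1 : ℕ)) *
      (juhlSymbol d μ j ξ ^ 2 * V (tangential ξ)) with hf
  have hfj : ∀ η τ, f (join η τ) = ((‖η‖ ^ 2 + τ ^ 2) ^ ((2 * μ - (d + 1)) / 2) *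
      juhlPoly (juhlIndex d μ j) j (‖η‖ ^ 2) τ ^ 2) * V η := by
    intro η τ
    simp only [hf, tangential_join, juhlSymbol_join, norm_join_rpow, Nat.cast_add, Nat.cast_one]
    ring
  have hf0 : ∀ ξ, 0 ≤ f ξ := fun ξ => mul_nonneg (by positivity)
    (mul_nonneg (sq_nonneg _) (hV0 _))
  have hfm : AEStronglyMeasurable f := by
    refine AEStronglyMeasurable.mul ?_ (AEStronglyMeasurable.mul ?_ ?_)
    · exact (measurable_norm.pow_const _).aestronglyMeasurable
    · exact (continuous_juhlSymbol.pow 2).aestronglyMeasurable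
    · exact hVm.comp_quasiMeasurePreserving quasiMeasurePreserving_tangential
  have hint : ∀ᵐ η : E d, ∫ τ, f (join η τ) =
      branchConst d μ j * (‖η‖ ^ (2 * (μ + j) - d) * V η) := by
    filter_upwards [ae_norm_pos d] with η hη
    simp only [hfj]
    rw [integral_mul_const, (integral_slice hη).2]; ring
  have hfi : Integrable f := by
    rw [← integrable_join_iff, Measure.volume_eq_prod, integrable_prod_iff]
    · refine ⟨?_, ?_⟩
      · filter_upwards [ae_norm_pos d] with η hη
        simp only [hfj]
        exact (integral_slice hη).1.mul_const _
      · refine (hV.const_mul (branchConst d μ j)).congr ?_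
        filter_upwards [hint] with η hη
        rw [← hη]
        exact integral_congr_ae (.of_forall fun τ => (Real.norm_of_nonneg (hf0 _)).symm)
    · rw [← Measure.volume_eq_prod]
      exact hfm.comp_measurePreserving measurePreserving_join
  refine ⟨hfi, ?_⟩
  rw [integral_join hfi, integral_congr_ae hint, integral_const_mul]

end Slice

end Branching
end

noncomputable section

namespace Branching

variable {N d : ℕ} {μ : ℝ} {j : ℕ}

/-! ### The isometry on the frequency side -/

section Isometry

variable [h₁ : ComplementaryRange d (μ + j)]

/-- The function `|ξ|^{N-2μ} T v`, where `T` is the isometry `branchIsometry`. -/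
def branchFun (v : CompSeries d (μ + j)) (ξ : E (d + 1)) : ℂ :=
  (((√(branchConst d μ j))⁻¹ * (juhlSymbol d μ j ξ * ‖tangential ξ‖ ^ (d - 2 * (μ + j))) : ℝ) : ℂ) *
    (v : Lp ℂ 2 (freqMeasure d (μ + j))) (tangential ξ)

theorem aestronglyMeasurable_branchFun (v : CompSeries d (μ + j)) :
    AEStronglyMeasurable (branchFun v) := by
  refine AEStronglyMeasurable.mul ?_
    (v.aestronglyMeasurable.comp_quasiMeasurePreserving quasiMeasurePreserving_tangential)
  refine (Complex.measurable_ofReal.comp (Measurable.const_mul ?_ _)).aestronglyMeasurable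
  exact continuous_juhlSymbol.measurable.mul (continuous_tangential.measurable.norm.pow_const _)

theorem branchFun_sq (v : CompSeries d (μ + j)) :
    Integrable (fun ξ => ‖ξ‖ ^ (2 * μ - (d + 1 : ℕ)) * ‖branchFun v ξ‖ ^ 2) ∧
    ∫ ξ, ‖ξ‖ ^ (2 * μ - (d + 1 : ℕ)) * ‖branchFun v ξ‖ ^ 2 = ‖v‖ ^ 2 := by
  have := ComplementaryRange.neZero (N := d) (μ := μ + j)
  have hκ := branchConst_pos (d := d) (μ := μ) (j := j)
  set V : E d → ℝ := fun η => (branchConst d μ j)⁻¹ * ((‖η‖ ^ (d - 2 * (μ + j))) ^ 2 *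
    ‖(v : Lp ℂ 2 (freqMeasure d (μ + j))) η‖ ^ 2) with hV
  have e1 : ∀ ξ : E (d + 1), ‖branchFun v ξ‖ ^ 2 = juhlSymbol d μ j ξ ^ 2 * V (tangential ξ) := by
    intro ξ
    rw [branchFun, norm_mul, Complex.norm_real, mul_pow, Real.norm_eq_abs, sq_abs, mul_pow, inv_pow,
      Real.sq_sqrt hκ.le, mul_pow]
    simp only [hV]; ring
  have e2 : (fun η => ‖η‖ ^ (2 * (μ + j) - d) * V η) =ᵐ[volume] fun η =>
      (branchConst d μ j)⁻¹ * (‖η‖ ^ (d - 2 * (μ + j)) *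
        ‖(v : Lp ℂ 2 (freqMeasure d (μ + j))) η‖ ^ 2) := by
    filter_upwards [ae_norm_pos d] with η hη
    have := rpow_mul_rpow_neg_cancel hη (2 * (μ + j) - d) (d - 2 * (μ + j)) (by ring)
    simp only [hV]
    linear_combination (branchConst d μ j)⁻¹ * ‖η‖ ^ (d - 2 * (μ + j)) *
        ‖(v : Lp ℂ 2 (freqMeasure d (μ + j))) η‖ ^ 2 * this
  have hv : Integrable fun η => ‖η‖ ^ (d - 2 * (μ + j)) *
      ‖(v : Lp ℂ 2 (freqMeasure d (μ + j))) η‖ ^ 2 :=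
    (memLp_freq_iff v.aestronglyMeasurable).1 (Lp.memLp _)
  have key := integral_symbol_sq_mul (d := d) (μ := μ) (j := j) (V := V)
    (fun η => by simp only [hV]; positivity)
    (by
      have h2 : AEStronglyMeasurable fun η : E d => (‖η‖ ^ (d - 2 * (μ + j))) ^ 2 :=
        ((measurable_norm.pow_const _).pow_const 2).aestronglyMeasurable
      exact (h2.mul (v.aestronglyMeasurable.norm.pow 2)).const_mul _)
    ((hv.const_mul _).congr e2.symm)
  simp only [e1]
  refine ⟨key.1, ?_⟩
  rw [key.2, integral_congr_ae e2, integral_const_mul, CompSeries.norm_sq_eq,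
    mul_inv_cancel_left₀ hκ.ne']

theorem ae_tangential {p : E d → Prop} (hp : ∀ᵐ η, p η) : ∀ᵐ ξ : E (d + 1), p (tangential ξ) :=
  quasiMeasurePreserving_tangential.ae hp

variable [h₂ : ComplementaryRange (d + 1) μ]

theorem memLp_branchFun (v : CompSeries d (μ + j)) :
    MemLp (fun ξ => ((‖ξ‖ ^ (2 * μ - (d + 1 : ℕ)) : ℝ) : ℂ) * branchFun v ξ) 2
      (freqMeasure (d + 1) μ) :=
  memLp_dual (aestronglyMeasurable_branchFun v) (branchFun_sq v).1

variable (d μ j) in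
/-- The isometry of `𝒞_{μ+j}(ℝ^d)` into `𝒞_μ(ℝ^{d+1})`. -/
def branchIsometry : CompSeries d (μ + j) →ₗᵢ[ℂ] CompSeries (d + 1) μ where
  toFun v := freqVec _ (memLp_branchFun v)
  map_add' v w := by
    refine CompSeries.ext_ae ?_
    filter_upwards [freqVec_ae (memLp_branchFun (v + w)), freqVec_ae (memLp_branchFun v),
      freqVec_ae (memLp_branchFun w), ae_tangential (CompSeries.coe_add_ae v w),
      CompSeries.coe_add_ae (freqVec _ (memLp_branchFun v)) (freqVec _ (memLp_branchFun w))]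
      with ξ h1 h2 h3 h4 h5
    rw [h1, h5, h2, h3, branchFun, branchFun, branchFun, h4]; ring
  map_smul' c v := by
    refine CompSeries.ext_ae ?_
    filter_upwards [freqVec_ae (memLp_branchFun (c • v)), freqVec_ae (memLp_branchFun v),
      ae_tangential (CompSeries.coe_smul_ae c v),
      CompSeries.coe_smul_ae c (freqVec _ (memLp_branchFun v))] with ξ h1 h2 h4 h5
    rw [RingHom.id_apply, h1, h5, h2, branchFun, branchFun, h4]; ring
  norm_map' v := by
    refine (sq_eq_sq₀ (norm_nonneg _) (norm_nonneg _)).1 ?_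
    exact (norm_sq_dual (memLp_branchFun v)).trans (branchFun_sq v).2

theorem branchIsometry_ae (v : CompSeries d (μ + j)) :
    (branchIsometry d μ j v : Lp ℂ 2 (freqMeasure (d + 1) μ)) =ᵐ[volume]
      fun ξ => ((‖ξ‖ ^ (2 * μ - (d + 1 : ℕ)) : ℝ) : ℂ) * branchFun v ξ :=
  freqVec_ae (memLp_branchFun v)

omit h₂ in
-- The power of `|ξ'|` cancels the one in the test vector, leaving a polynomial times `𝓕 g(ξ')`.
theorem branchFun_testVec (g : TestSpace d (μ + j)) :
    branchFun (testVec d (μ + j) g) =ᵐ[volume] fun ξ =>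
      (((√(branchConst d μ j))⁻¹ * juhlSymbol d μ j ξ : ℝ) : ℂ) * 𝓕 g.1 (tangential ξ) := by
  have := ComplementaryRange.neZero (N := d) (μ := μ + j)
  filter_upwards [ae_tangential (testVec_ae g), ae_tangential (ae_norm_pos d)] with ξ h1 h2
  have h3 := rpow_mul_rpow_neg_cancel h2 (d - 2 * (μ + j)) (2 * (μ + j) - d) (by ring)
  have h4 : ((‖tangential ξ‖ ^ (d - 2 * (μ + j)) : ℝ) : ℂ) *
    ((‖tangential ξ‖ ^ (2 * (μ + j) - d) : ℝ) : ℂ) = 1 := by exact_mod_cast h3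
  rw [branchFun, h1]
  push_cast
  linear_combination ((√(branchConst d μ j))⁻¹ : ℂ) * (juhlSymbol d μ j ξ : ℂ) *
    𝓕 g.1 (tangential ξ) * h4

end Isometry

/-! ## Integration by parts along the normal direction -/

/-- The total exponent `-a - i/2` is negative, so the value at `τ = 0` dominates. Boundedness makes
the products with Schwartz functions integrable, and no boundary terms arise. -/
theorem exists_kernelDeriv_bound {a s : ℝ} (ha : 1 / 2 < a) (hs : 0 < s) (i : ℕ) :
    ∃ C : ℝ, ∀ τ, |kernelDeriv a s i τ| ≤ C := by
  obtain ⟨C, hC, hb⟩ := exists_juhlPoly_bound a i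
  refine ⟨|(-1) ^ i * (∏ l ∈ Finset.range i, (2 * a + l))| * (C * s ^ (-a - i / 2)), fun τ => ?_⟩
  have hp : 0 < s + τ ^ 2 := by positivity
  rw [kernelDeriv, abs_mul]
  refine mul_le_mul_of_nonneg_left ?_ (abs_nonneg _)
  rw [abs_mul, abs_of_nonneg (by positivity : 0 ≤ (s + τ ^ 2) ^ (-a - i : ℝ))]
  have h1 := hb √(s + τ ^ 2) s τ (Real.sqrt_nonneg _) hs.le (Real.sq_sqrt hp.le).symm
  have h2 : √(s + τ ^ 2) ^ i = (s + τ ^ 2) ^ ((i : ℝ) / 2) := by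
    rw [Real.sqrt_eq_rpow, ← Real.rpow_mul_natCast hp.le]; congr 1; ring
  rw [h2] at h1
  calc _ ≤ (s + τ ^ 2) ^ (-a - i : ℝ) * (C * (s + τ ^ 2) ^ ((i : ℝ) / 2)) := by gcongr
    _ = C * (s + τ ^ 2) ^ (-a - i / 2 : ℝ) := by
      rw [mul_left_comm, ← Real.rpow_add hp]; congr 2; ring
    _ ≤ _ := by
      refine mul_le_mul_of_nonneg_left
        (Real.rpow_le_rpow_of_nonpos hs (le_add_of_nonneg_right (sq_nonneg τ)) ?_) hC
      have : (0 : ℝ) ≤ i := i.cast_nonneg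
      linarith

theorem continuous_kernelDeriv {a s : ℝ} (ha : 1 / 2 < a) (hs : 0 < s) (i : ℕ) :
    Continuous (kernelDeriv a s i) :=
  continuous_iff_continuousAt.2 fun τ => (hasDerivAt_kernelDeriv ha hs i τ).continuousAt

theorem integrable_kernelDeriv_mul {a s : ℝ} (ha : 1 / 2 < a) (hs : 0 < s) (i : ℕ) {ψ : ℝ → ℂ}
    (hψ : Integrable ψ) : Integrable fun τ => (kernelDeriv a s i τ : ℂ) * ψ τ := by
  obtain ⟨C, hC⟩ := exists_kernelDeriv_bound ha hs i
  exact hψ.bdd_mul (c := C) (Complex.continuous_ofReal.comp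
    (continuous_kernelDeriv ha hs i)).aestronglyMeasurable (.of_forall fun τ => by simpa using hC τ)

theorem integral_kernelDeriv_mul {a s : ℝ} (ha : 1 / 2 < a) (hs : 0 < s) {ψ : ℕ → ℝ → ℂ}
    (hψ : ∀ i τ, HasDerivAt (ψ i) (ψ (i + 1) τ) τ) (hi : ∀ i, Integrable (ψ i)) (j : ℕ) :
    ∫ τ, (kernelDeriv a s 0 τ : ℂ) * ψ j τ
      = (-1) ^ j * ∫ τ, (kernelDeriv a s j τ : ℂ) * ψ 0 τ := by
  have step : ∀ m l, ∫ τ, (kernelDeriv a s m τ : ℂ) * ψ (l + 1) τ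
      = - ∫ τ, (kernelDeriv a s (m + 1) τ : ℂ) * ψ l τ := fun m l =>
    integral_mul_deriv_eq_deriv_mul_of_integrable
      (fun τ _ => (hasDerivAt_kernelDeriv ha hs m τ).ofReal_comp) (fun τ _ => hψ l τ)
      (integrable_kernelDeriv_mul ha hs m (hi (l + 1)))
      (integrable_kernelDeriv_mul ha hs (m + 1) (hi l))
      (integrable_kernelDeriv_mul ha hs m (hi l))
  have gen : ∀ i m l, ∫ τ, (kernelDeriv a s m τ : ℂ) * ψ (l + i) τ
      = (-1) ^ i * ∫ τ, (kernelDeriv a s (m + i) τ : ℂ) * ψ l τ := by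
    intro i
    induction i with
    | zero => intro m l; simp
    | succ i ih =>
      intro m l
      rw [← add_assoc, step, show m + (i + 1) = m + 1 + i by ring, ih, pow_succ]; ring
  simpa using gen j 0 0

/-- The unit normal vector of the hyperplane. -/
def normalVec (d : ℕ) : E (d + 1) := EuclideanSpace.single (Fin.last d) 1

theorem inner_normalVec (x : E (d + 1)) : inner ℝ x (normalVec d) = x (Fin.last d) := by
  simp [normalVec, EuclideanSpace.inner_single_right]

theorem hasDerivAt_join (η : E d) (τ : ℝ) : HasDerivAt (fun t => join η t) (normalVec d) τ := by
  have h : (fun t : ℝ => join η t) = fun t : ℝ => join η 0 + t • normalVec d := by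
    funext t
    ext i
    refine Fin.lastCases ?_ (fun i => ?_) i
    · simp [normalVec]
    · simp [normalVec]
  rw [h]
  simpa using ((hasDerivAt_id τ).smul_const (normalVec d)).const_add (join η 0)

theorem hasDerivAt_schwartz_join (φ : 𝓢(E (d + 1), ℂ)) (η : E d) (τ : ℝ) :
    HasDerivAt (fun t => φ (join η t)) ((LineDeriv.lineDerivOp (normalVec d) φ : 𝓢(E (d + 1), ℂ)) (join η τ)) τ := by
  rw [SchwartzMap.lineDerivOp_apply_eq_fderiv]
  exact (φ.differentiable.differentiableAt.hasFDerivAt).comp_hasDerivAt τ (hasDerivAt_join η τ)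

theorem integrable_schwartz_join (φ : 𝓢(E (d + 1), ℂ)) (η : E d) :
    Integrable fun t => φ (join η t) := by
  obtain ⟨C₀, -, h0⟩ := φ.decay 0 0
  obtain ⟨C₂, -, h2⟩ := φ.decay 2 0
  simp only [pow_zero, one_mul, norm_iteratedFDeriv_zero] at h0 h2
  have hc : Continuous fun t : ℝ => join η t :=
    continuous_join.comp (by fun_prop : Continuous fun t : ℝ => (η, t))
  refine (integrable_inv_one_add_sq.const_mul (C₀ + C₂)).mono'
    (φ.continuous.comp hc).aestronglyMeasurable (.of_forall fun t => ?_)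
  rw [← div_eq_mul_inv, le_div_iff₀ (by positivity)]
  have h3 := h0 (join η t)
  have h4 := h2 (join η t)
  rw [norm_join_sq] at h4
  nlinarith [norm_nonneg (φ (join η t)), sq_nonneg ‖η‖,
    mul_nonneg (sq_nonneg ‖η‖) (norm_nonneg (φ (join η t)))]

theorem fourier_iterate_lineDeriv (φ : 𝓢(E (d + 1), ℂ)) (i : ℕ) (x : E (d + 1)) :
    𝓕 (((LineDeriv.lineDerivOp (normalVec d))^[i] φ : 𝓢(E (d + 1), ℂ)) : E (d + 1) → ℂ) x
      = (2 * Real.pi * Complex.I) ^ i * (x (Fin.last d) : ℂ) ^ i * 𝓕 (φ : E (d + 1) → ℂ) x := by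
  induction i generalizing φ with
  | zero => simp
  | succ i ih =>
    have hg : Function.HasTemperateGrowth fun x : E (d + 1) => (inner ℝ x (normalVec d) : ℝ) :=
      by fun_prop
    rw [Function.iterate_succ_apply, ih, ← SchwartzMap.fourier_coe, SchwartzMap.fourier_lineDerivOp_eq,
      ← SchwartzMap.fourier_coe, smul_apply, SchwartzMap.smulLeftCLM_apply_apply hg,
      inner_normalVec, smul_eq_mul, Complex.real_smul]
    ring

end Branching
end

noncomputable section

namespace Branching

variable {N d : ℕ} {μ : ℝ} {j : ℕ}

/-! ## The isometry in the position picture -/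

theorem exists_riesz_schwartz_bound [NeZero N] {a : ℝ} (ha0 : 0 ≤ a) (ha : a < N) (χ : 𝓢(E N, ℂ)) :
    ∃ C : ℝ, ∀ z : E N, Integrable (fun x => ‖x - z‖ ^ (-a) * ‖χ x‖) ∧
      ∫ x, ‖x - z‖ ^ (-a) * ‖χ x‖ ≤ C := by
  obtain ⟨C₀, -, h⟩ := riesz_bound ha0 ha
  obtain ⟨B, -, hB⟩ := χ.decay 0 0
  simp only [pow_zero, one_mul, norm_iteratedFDeriv_zero] at hB
  exact ⟨_, h B _ (fun x => norm_nonneg _) hB χ.integrable.norm⟩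

theorem integrable_riesz_schwartz [NeZero N] {a : ℝ} (ha0 : 0 ≤ a) (ha : a < N) (χ : 𝓢(E N, ℂ))
    (z : E N) : Integrable fun x => ((‖x - z‖ ^ (-a) : ℝ) : ℂ) * χ x := by
  obtain ⟨C, h⟩ := exists_riesz_schwartz_bound ha0 ha χ
  refine (h z).1.mono' ?_ (.of_forall fun x => ?_)
  · refine AEStronglyMeasurable.mul ?_ χ.continuous.aestronglyMeasurable
    exact (Complex.measurable_ofReal.comp
      ((by fun_prop : Measurable fun x => ‖x - z‖).pow_const _)).aestronglyMeasurable
  · rw [norm_mul, Complex.norm_real, Real.norm_of_nonneg (by positivity)]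

/-- Multiplying `ψ` by a character translates `𝓕 ψ`, which moves the centre of the kernel to `z`.
For Schwartz functions both sides converge, as both singularities are weaker than `|x|^{-N}`. -/
theorem riesz_fourier_translate [ComplementaryRange N μ] (ψ : 𝓢(E N, ℂ)) (z : E N) :
    ∫ ξ, ((‖ξ‖ ^ (2 * μ - N) : ℝ) : ℂ) * ((Real.fourierChar (-inner ℝ z ξ) : ℂ) * ψ ξ)
      = (rieszConst N μ : ℂ) *
        ∫ x, ((‖x - z‖ ^ (-(2 * μ)) : ℝ) : ℂ) * 𝓕 (ψ : E N → ℂ) x := by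
  have := ComplementaryRange.neZero (N := N) (μ := μ)
  have hμ := range_pos N μ
  have hμ' := range_lt N μ
  have hF : ∀ x, 𝓕 (fun ξ => (Real.fourierChar (-inner ℝ z ξ) : ℂ) * ψ ξ) x
      = 𝓕 (ψ : E N → ℂ) (x + z) := by
    intro x
    rw [fourier_eq_char, fourier_eq_char]
    refine integral_congr_ae (.of_forall fun ξ => ?_)
    simp only [inner_add_right, neg_add, AddChar.map_add_eq_mul, Circle.coe_mul]
    rw [real_inner_comm z ξ]; ring
  have hm : Continuous fun ξ : E N => (Real.fourierChar (-inner ℝ z ξ) : ℂ) := by fun_prop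
  have hn : ∀ ξ : E N, ‖(Real.fourierChar (-inner ℝ z ξ) : ℂ)‖ ≤ 1 := fun ξ => (Circle.norm_coe _).le
  have h1 := integrable_riesz_schwartz (N := N) (a := 2 * μ) (by linarith) (by linarith)
    (𝓕 ψ : 𝓢(E N, ℂ)) z
  rw [SchwartzMap.fourier_coe] at h1
  have h1' := h1.comp_add_right z
  simp only [add_sub_cancel_right] at h1'
  have h2 := integrable_riesz_schwartz (N := N) (a := N - 2 * μ) (by linarith) (by linarith) ψ 0
  simp only [sub_zero, neg_sub] at h2
  rw [riesz_fourier (μ := μ) (φ := fun ξ => (Real.fourierChar (-inner ℝ z ξ) : ℂ) * ψ ξ)]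
  · simp only [hF]
    rw [← integral_add_right_eq_self
      (fun x => ((‖x - z‖ ^ (-(2 * μ)) : ℝ) : ℂ) * 𝓕 (ψ : E N → ℂ) x) z]
    simp only [add_sub_cancel_right]
  · exact ψ.integrable.bdd_mul (c := 1) hm.aestronglyMeasurable (.of_forall hn)
  · simpa only [hF] using h1'
  · refine (h2.bdd_mul (c := 1) hm.aestronglyMeasurable (.of_forall hn)).congr
      (.of_forall fun ξ => ?_)
    simp only; ring

theorem norm_hyperplaneIncl (y : E d) : ‖hyperplaneIncl y‖ = ‖y‖ := by
  have := norm_join_sq y 0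
  rw [← hyperplaneIncl_eq_join] at this
  simpa using this

theorem continuous_hyperplaneIncl : Continuous (hyperplaneIncl (d := d)) :=
  continuous_join.comp (by fun_prop : Continuous fun y : E d => (y, (0 : ℝ)))

variable (μ j) in
/-- The Poisson type integral `x_n^j ∫ |x - (y, 0)|^{-2(μ+j)} g(y) dy`. -/
def branchPotential (g : E d → ℂ) (x : E (d + 1)) : ℂ :=
  ∫ y, g y * (((x (Fin.last d)) ^ j * ‖x - hyperplaneIncl y‖ ^ (-(2 * (μ + j))) : ℝ) : ℂ)

theorem integrable_riesz_prod {a : ℝ} (ha0 : 0 ≤ a) (ha : a < d + 1) {g : E d → ℂ}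
    (hg : Integrable g) (χ : 𝓢(E (d + 1), ℂ)) : Integrable fun z : E d × E (d + 1) =>
      g z.1 * (((‖z.2 - hyperplaneIncl z.1‖ ^ (-a) : ℝ) : ℂ) * χ z.2) := by
  obtain ⟨C, hC⟩ := exists_riesz_schwartz_bound ha0 (by push_cast; exact ha) χ
  have hm : AEStronglyMeasurable fun z : E d × E (d + 1) =>
      g z.1 * (((‖z.2 - hyperplaneIncl z.1‖ ^ (-a) : ℝ) : ℂ) * χ z.2) := by
    rw [Measure.volume_eq_prod]
    refine AEStronglyMeasurable.mul hg.1.comp_fst (AEStronglyMeasurable.mul ?_ ?_)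
    · have : Continuous fun z : E d × E (d + 1) => ‖z.2 - hyperplaneIncl z.1‖ :=
        (continuous_snd.sub (continuous_hyperplaneIncl.comp continuous_fst)).norm
      exact (Complex.measurable_ofReal.comp (this.measurable.pow_const _)).aestronglyMeasurable
    · exact (χ.continuous.comp continuous_snd).aestronglyMeasurable
  have hn : ∀ (y : E d) (x : E (d + 1)),
      ‖g y * (((‖x - hyperplaneIncl y‖ ^ (-a) : ℝ) : ℂ) * χ x)‖
      = ‖g y‖ * (‖x - hyperplaneIncl y‖ ^ (-a) * ‖χ x‖) := by
    intro y x
    rw [norm_mul, norm_mul, Complex.norm_real, Real.norm_of_nonneg (by positivity)]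
  rw [Measure.volume_eq_prod] at hm ⊢
  rw [integrable_prod_iff hm]
  refine ⟨.of_forall fun y => ?_, ?_⟩
  · exact (integrable_riesz_schwartz (N := d + 1) ha0 (by push_cast; exact ha) χ
      (hyperplaneIncl y)).const_mul (g y)
  · refine (hg.norm.mul_const C).mono' hm.norm.integral_prod_right' (.of_forall fun y => ?_)
    simp only [hn]
    rw [integral_const_mul, Real.norm_of_nonneg (by positivity)]
    exact mul_le_mul_of_nonneg_left (hC _).2 (norm_nonneg _)

section Position

variable [h₁ : ComplementaryRange d (μ + j)] [h₂ : ComplementaryRange (d + 1) μ]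

omit h₂ in
-- This makes `|x|^{-2(μ+j)}` a Riesz kernel on `ℝ^{d+1}` as well.
theorem complementaryRange_succ : ComplementaryRange (d + 1) (μ + j) :=
  ⟨range_pos d (μ + j), by have := range_lt d (μ + j); push_cast; linarith⟩

/-- The slice-wise integration by parts. -/
theorem integral_riesz_lineDeriv (φ : 𝓢(E (d + 1), ℂ)) (g : TestSpace d (μ + j)) :
    ∫ ξ : E (d + 1), ((‖ξ‖ ^ (2 * (μ + j) - (d + 1 : ℕ)) : ℝ) : ℂ) *
      (((LineDeriv.lineDerivOp (normalVec d))^[j] φ : 𝓢(E (d + 1), ℂ)) ξ * 𝓕 g.1 (tangential ξ))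
    = (∏ l ∈ Finset.range j, (2 * juhlIndex d μ j + l) : ℝ) *
      ∫ ξ : E (d + 1), ((‖ξ‖ ^ (2 * μ - (d + 1 : ℕ)) * juhlSymbol d μ j ξ : ℝ) : ℂ) *
        (𝓕 g.1 (tangential ξ) * φ ξ) := by
  have := ComplementaryRange.neZero (N := d) (μ := μ + j)
  have := complementaryRange_succ (d := d) (μ := μ) (j := j)
  have ha := half_lt_juhlIndex (d := d) (μ := μ) (j := j)
  have hκ := branchConst_pos (d := d) (μ := μ) (j := j)
  have hgc : Continuous fun ξ : E (d + 1) => 𝓕 g.1 (tangential ξ) :=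
    (continuous_fourier_of_integrable (TestSpace.integrable g)).comp continuous_tangential
  have hi1 : Integrable fun ξ : E (d + 1) => ((‖ξ‖ ^ (2 * (μ + j) - (d + 1 : ℕ)) : ℝ) : ℂ) *
      (((LineDeriv.lineDerivOp (normalVec d))^[j] φ : 𝓢(E (d + 1), ℂ)) ξ *
        𝓕 g.1 (tangential ξ)) := by
    have h1 := range_lt (d + 1) (μ + j)
    have h2 := range_pos (d + 1) (μ + j)
    have h3 := integrable_riesz_schwartz (N := d + 1) (a := (d + 1 : ℕ) - 2 * (μ + j))
      (by linarith) (by linarith) ((LineDeriv.lineDerivOp (normalVec d))^[j] φ) 0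
    simp only [sub_zero, neg_sub] at h3
    refine (h3.mul_bdd (c := ∫ x, ‖g.1 x‖) hgc.aestronglyMeasurable
      (.of_forall fun ξ => norm_fourier_le _)).congr (.of_forall fun ξ => ?_)
    simp only; ring
  -- Up to a constant this is the pairing of an element of `𝒞_μ` with a Schwartz function, which is
  -- known to converge.
  have hi2 : Integrable fun ξ : E (d + 1) =>
      ((‖ξ‖ ^ (2 * μ - (d + 1 : ℕ)) * juhlSymbol d μ j ξ : ℝ) : ℂ) *
        (𝓕 g.1 (tangential ξ) * φ ξ) := by
    have h3 := integrable_mul_schwartz (branchIsometry d μ j (testVec d (μ + j) g)) φ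
    refine (h3.const_mul ((√(branchConst d μ j) : ℝ) : ℂ)).congr ?_
    filter_upwards [branchIsometry_ae (testVec d (μ + j) g), branchFun_testVec g] with ξ e1 e2
    rw [e1, e2]
    have h4 : ((√(branchConst d μ j) : ℝ) : ℂ) ≠ 0 := by
      exact_mod_cast (Real.sqrt_pos.2 hκ).ne'
    push_cast
    field_simp
  rw [integral_join hi1, integral_join hi2, ← integral_const_mul]
  refine integral_congr_ae ?_
  filter_upwards [ae_norm_pos d] with η hη
  have hs : 0 < ‖η‖ ^ 2 := by positivity
  have key := integral_kernelDeriv_mul ha hs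
    (ψ := fun i τ => ((LineDeriv.lineDerivOp (normalVec d))^[i] φ : 𝓢(E (d + 1), ℂ)) (join η τ))
    (fun i τ => by
      simp only [Function.iterate_succ_apply']
      exact hasDerivAt_schwartz_join _ η τ)
    (fun i => integrable_schwartz_join _ η) j
  simp only [tangential_join, juhlSymbol_join, norm_join_rpow]
  -- On the slice over `η` the left integrand has the power `-a` of `|η|² + τ²`, the right one the
  -- power `-a - j` and the polynomial: these are `kernelDeriv` of orders `0` and `j`, up to a
  -- constant.
  have e1 : ∀ τ : ℝ, (((‖η‖ ^ 2 + τ ^ 2) ^ ((2 * (μ + j) - (d + 1 : ℕ)) / 2) : ℝ) : ℂ) *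
      (((LineDeriv.lineDerivOp (normalVec d))^[j] φ : 𝓢(E (d + 1), ℂ)) (join η τ) * 𝓕 g.1 η)
      = ((kernelDeriv (juhlIndex d μ j) (‖η‖ ^ 2) 0 τ : ℂ) *
        ((LineDeriv.lineDerivOp (normalVec d))^[j] φ : 𝓢(E (d + 1), ℂ)) (join η τ)) * 𝓕 g.1 η := by
    intro τ
    rw [kernelDeriv_zero, ← mul_assoc]
    congr 4
    unfold juhlIndex; push_cast; ring
  have e2 : ∀ τ : ℝ, (((‖η‖ ^ 2 + τ ^ 2) ^ ((2 * μ - (d + 1 : ℕ)) / 2) *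
      juhlPoly (juhlIndex d μ j) j (‖η‖ ^ 2) τ : ℝ) : ℂ) * (𝓕 g.1 η * φ (join η τ))
      = (((‖η‖ ^ 2 + τ ^ 2) ^ (-juhlIndex d μ j - j) *
      juhlPoly (juhlIndex d μ j) j (‖η‖ ^ 2) τ : ℝ) : ℂ) * φ (join η τ) * 𝓕 g.1 η := by
    intro τ
    have : (2 * μ - (d + 1 : ℕ)) / 2 = -juhlIndex d μ j - j := by
      unfold juhlIndex; push_cast; ring
    rw [this]; ring
  simp only [e1, e2]
  rw [integral_mul_const, integral_mul_const, key, ← mul_assoc, ← integral_const_mul,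
    ← integral_const_mul]
  congr 1
  refine integral_congr_ae (.of_forall fun τ => ?_)
  have hone : ((-1 : ℂ) ^ j) * (-1) ^ j = 1 := by rw [← mul_pow]; simp
  simp only [kernelDeriv, Function.iterate_zero, id_eq]
  push_cast
  linear_combination (∏ l ∈ Finset.range j, (2 * (juhlIndex d μ j : ℂ) + l)) *
    ((((‖η‖ ^ 2 + τ ^ 2) ^ (-juhlIndex d μ j - j) : ℝ) : ℂ) *
      (juhlPoly (juhlIndex d μ j) j (‖η‖ ^ 2) τ : ℂ)) * φ (join η τ) * hone

variable (d μ j) in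
/-- The constant relating `branchIsometry` to `branchPotential`. -/
def branchFactor : ℂ :=
  (√(branchConst d μ j) : ℂ)⁻¹ * (∏ l ∈ Finset.range j, (2 * juhlIndex d μ j + l) : ℝ)⁻¹ *
    ((rieszConst (d + 1) (μ + j) : ℂ) * (2 * Real.pi * Complex.I) ^ j)

omit h₁ h₂ in
theorem branchPotential_mul_fourier (g : E d → ℂ) (φ : 𝓢(E (d + 1), ℂ)) (x : E (d + 1)) :
    (2 * Real.pi * Complex.I) ^ j * (branchPotential μ j g x * 𝓕 (φ : E (d + 1) → ℂ) x)
      = ∫ y, g y * (((‖x - hyperplaneIncl y‖ ^ (-(2 * (μ + j))) : ℝ) : ℂ) *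
        (𝓕 ((LineDeriv.lineDerivOp (normalVec d))^[j] φ) : 𝓢(E (d + 1), ℂ)) x) := by
  rw [branchPotential, ← integral_mul_const, ← integral_const_mul, SchwartzMap.fourier_coe]
  refine integral_congr_ae (.of_forall fun y => ?_)
  simp only [fourier_iterate_lineDeriv]
  push_cast; ring

/-- Multiplication of `𝓕 φ` by `x_n^j` is the transform of `∂_n^j φ`, up to `(2πi)^j`. The Riesz
kernel then becomes `|ξ|^{2(μ+j)-(d+1)}`, and the integral over `y` becomes `𝓕 g(ξ')`. Integration
by parts returns the derivatives to the kernel, where the Rodrigues formula produces the symbol. -/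
theorem realizes_branchIsometry_testVec (g : TestSpace d (μ + j)) :
    Realizes (branchIsometry d μ j (testVec d (μ + j) g))
      fun x => branchFactor d μ j * branchPotential μ j g.1 x := by
  have := ComplementaryRange.neZero (N := d) (μ := μ + j)
  have := complementaryRange_succ (d := d) (μ := μ) (j := j)
  have hr := range_lt (d + 1) (μ + j)
  have hr' := range_pos (d + 1) (μ + j)
  have hπ : (2 * Real.pi * Complex.I : ℂ) ^ j ≠ 0 := pow_ne_zero _ Complex.two_pi_I_ne_zero
  have hprod : ∀ φ : 𝓢(E (d + 1), ℂ), Integrable fun z : E d × E (d + 1) =>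
      g.1 z.1 * (((‖z.2 - hyperplaneIncl z.1‖ ^ (-(2 * (μ + j))) : ℝ) : ℂ) *
        (𝓕 ((LineDeriv.lineDerivOp (normalVec d))^[j] φ) : 𝓢(E (d + 1), ℂ)) z.2) := fun φ =>
    integrable_riesz_prod (by linarith) (by push_cast at hr; linarith) (TestSpace.integrable g) _
  refine realizes_of_forall_test _ _ (fun φ => ?_) fun φ => ?_
  · have h1 := (hprod φ).integral_prod_right
    refine (h1.const_mul (branchFactor d μ j * ((2 * Real.pi * Complex.I : ℂ) ^ j)⁻¹)).congr
      (.of_forall fun x => ?_)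
    simp only
    rw [← branchPotential_mul_fourier, SchwartzMap.fourier_coe]
    field_simp
  · rw [inner_schwartzTest]
    have h1 : ∫ x, (branchFactor d μ j * branchPotential μ j g.1 x) * (𝓕 φ : 𝓢(E (d + 1), ℂ)) x
        = branchFactor d μ j * ((2 * Real.pi * Complex.I : ℂ) ^ j)⁻¹ *
          ∫ x, ∫ y, g.1 y * (((‖x - hyperplaneIncl y‖ ^ (-(2 * (μ + j))) : ℝ) : ℂ) *
        (𝓕 ((LineDeriv.lineDerivOp (normalVec d))^[j] φ) : 𝓢(E (d + 1), ℂ)) x) := by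
      rw [← integral_const_mul]
      refine integral_congr_ae (.of_forall fun x => ?_)
      simp only
      rw [← branchPotential_mul_fourier, SchwartzMap.fourier_coe]
      field_simp
    have h2 : (rieszConst (d + 1) (μ + j) : ℂ) *
        ∫ x, ∫ y, g.1 y * (((‖x - hyperplaneIncl y‖ ^ (-(2 * (μ + j))) : ℝ) : ℂ) *
        (𝓕 ((LineDeriv.lineDerivOp (normalVec d))^[j] φ) : 𝓢(E (d + 1), ℂ)) x)
        = ∫ ξ : E (d + 1), ((‖ξ‖ ^ (2 * (μ + j) - (d + 1 : ℕ)) : ℝ) : ℂ) *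
      (((LineDeriv.lineDerivOp (normalVec d))^[j] φ : 𝓢(E (d + 1), ℂ)) ξ *
        𝓕 g.1 (tangential ξ)) := by
      have hsw := integral_integral_swap (f := fun (y : E d) (x : E (d + 1)) =>
        g.1 y * (((‖x - hyperplaneIncl y‖ ^ (-(2 * (μ + j))) : ℝ) : ℂ) *
          (𝓕 ((LineDeriv.lineDerivOp (normalVec d))^[j] φ) : 𝓢(E (d + 1), ℂ)) x)) (hprod φ)
      rw [← hsw, ← integral_const_mul]
      set ψ : 𝓢(E (d + 1), ℂ) := (LineDeriv.lineDerivOp (normalVec d))^[j] φ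
      have h3 : ∀ y, (rieszConst (d + 1) (μ + j) : ℂ) * ∫ x, g.1 y *
          (((‖x - hyperplaneIncl y‖ ^ (-(2 * (μ + j))) : ℝ) : ℂ) * (𝓕 ψ : 𝓢(E (d + 1), ℂ)) x)
          = ∫ ξ, g.1 y * (((‖ξ‖ ^ (2 * (μ + j) - (d + 1 : ℕ)) : ℝ) : ℂ) *
            ((Real.fourierChar (-inner ℝ (hyperplaneIncl y) ξ) : ℂ) * ψ ξ)) := by
        intro y
        rw [integral_const_mul, integral_const_mul, riesz_fourier_translate, SchwartzMap.fourier_coe]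
        ring
      simp only [h3]
      have hψ := integrable_riesz_schwartz (N := d + 1) (a := (d + 1 : ℕ) - 2 * (μ + j))
        (by linarith) (by linarith) ψ 0
      simp only [sub_zero, neg_sub] at hψ
      rw [integral_integral_swap]
      · refine integral_congr_ae (.of_forall fun ξ => ?_)
        simp only
        rw [fourier_eq_char, ← integral_const_mul, ← integral_const_mul]
        refine integral_congr_ae (.of_forall fun y => ?_)
        simp only
        rw [real_inner_comm, inner_hyperplaneIncl, real_inner_comm]; ring
      · have h4 := ((TestSpace.integrable g).mul_prod hψ).bdd_mul (c := 1) (f := fun z : E d × E (d + 1) =>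
          (Real.fourierChar (-inner ℝ (hyperplaneIncl z.1) z.2) : ℂ)) (by
            have : Continuous fun z : E d × E (d + 1) => inner ℝ (hyperplaneIncl z.1) z.2 :=
              (continuous_hyperplaneIncl.comp continuous_fst).inner continuous_snd
            exact (by fun_prop : Continuous fun z : E d × E (d + 1) =>
              (Real.fourierChar (-inner ℝ (hyperplaneIncl z.1) z.2) : ℂ)).aestronglyMeasurable)
          (.of_forall fun z => (Circle.norm_coe _).le)
        refine h4.congr (.of_forall fun z => ?_)
        simp only [Function.uncurry]; ring
    -- The constant of the Rodrigues formula has positive factors, since `a > 1/2`; it can be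
    -- divided out.
    have hP : (∏ l ∈ Finset.range j, (2 * (juhlIndex d μ j : ℂ) + l)) ≠ 0 := by
      have ha := half_lt_juhlIndex (d := d) (μ := μ) (j := j)
      refine Finset.prod_ne_zero_iff.2 fun l _ => ?_
      have : 0 < 2 * juhlIndex d μ j + l := by positivity
      exact_mod_cast this.ne'
    have h5 : ∫ ξ, (branchIsometry d μ j (testVec d (μ + j) g) : Lp ℂ 2 (freqMeasure (d + 1) μ)) ξ *
        φ ξ = (√(branchConst d μ j) : ℂ)⁻¹ *
        ∫ ξ : E (d + 1), ((‖ξ‖ ^ (2 * μ - (d + 1 : ℕ)) * juhlSymbol d μ j ξ : ℝ) : ℂ) *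
        (𝓕 g.1 (tangential ξ) * φ ξ) := by
      rw [← integral_const_mul]
      refine integral_congr_ae ?_
      filter_upwards [branchIsometry_ae (testVec d (μ + j) g), branchFun_testVec g] with ξ e1 e2
      rw [e1, e2]; push_cast; ring
    rw [h1, h5]
    have h6 := h2.trans (integral_riesz_lineDeriv φ g)
    rw [branchFactor]
    push_cast at h6 ⊢
    have h7 : ∀ A B c p q r : ℂ, p ≠ 0 → q ≠ 0 → c * A = p * B →
        (r * p⁻¹ * (c * q)) * q⁻¹ * A = r * B := by
      intro A B c p q r hp hq h
      field_simp
      linear_combination r * h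
    exact h7 _ _ _ _ _ _ hP hπ h6

end Position

end Branching
end

noncomputable section

namespace Branching

variable {N d : ℕ} {μ : ℝ} {j : ℕ}

/-! ## The conformal action of the subgroup -/

theorem extendMatrix_mulVec {p : ℕ} (A : Matrix (Fin p ⊕ Fin 1) (Fin p ⊕ Fin 1) ℝ)
    (X : Fin (p + 1) ⊕ Fin 1 → ℝ) (k : (Fin p ⊕ Fin 1) ⊕ Unit) :
    (extendMatrix p A *ᵥ X) (coordEquiv p k)
      = Sum.elim (A *ᵥ fun l => X (coordEquiv p (Sum.inl l)))
          (fun _ => X (coordEquiv p (Sum.inr ()))) k := by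
  change (Matrix.reindex (coordEquiv p) (coordEquiv p)
    (Matrix.fromBlocks A 0 0 (1 : Matrix Unit Unit ℝ)) *ᵥ X) _ = _
  rw [Matrix.reindex_apply, Matrix.submatrix_mulVec_equiv, Equiv.symm_symm, Function.comp_apply,
    Equiv.symm_apply_apply, Matrix.fromBlocks_mulVec]
  rcases k with k | k <;> simp [Function.comp_def]

theorem lightVector_hyperplaneIncl (y : E d) :
    (fun l => lightVector (hyperplaneIncl y) (coordEquiv (d + 1) (Sum.inl l))) = lightVector y := by
  funext l
  rcases l with l | l
  · change lightVector (hyperplaneIncl y) (Sum.inl l.castSucc) = _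
    refine Fin.cases ?_ (fun i => ?_) l
    · rw [Fin.castSucc_zero, lightVector_zero, lightVector_zero, norm_hyperplaneIncl]
    · rw [← Fin.succ_castSucc, lightVector_succ, lightVector_succ, hyperplaneIncl_eq_join,
        join_castSucc]
  · change lightVector (hyperplaneIncl y) (Sum.inr l) = _
    rw [lightVector_time, lightVector_time, norm_hyperplaneIncl]

section Subgroup

variable (h : SO₀ (d + 1))

theorem embed_mulVec (X : Fin (d + 2) ⊕ Fin 1 → ℝ) (l : Fin (d + 1) ⊕ Fin 1) :
    ((embedSO₀ (d + 1) h).mat *ᵥ X) (coordEquiv (d + 1) (Sum.inl l))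
      = (h.mat *ᵥ fun l => X (coordEquiv (d + 1) (Sum.inl l))) l :=
  extendMatrix_mulVec h.mat X (Sum.inl l)

theorem embed_mulVec_last (X : Fin (d + 2) ⊕ Fin 1 → ℝ) :
    ((embedSO₀ (d + 1) h).mat *ᵥ X) (Sum.inl (Fin.last (d + 1))) = X (Sum.inl (Fin.last (d + 1))) :=
  extendMatrix_mulVec h.mat X (Sum.inr ())

theorem conformalScale_embed (y : E d) :
    conformalScale (embedSO₀ (d + 1) h).mat (hyperplaneIncl y) = conformalScale h.mat y := by
  have h0 := embed_mulVec h (lightVector (hyperplaneIncl y)) (Sum.inl 0)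
  have h1 := embed_mulVec h (lightVector (hyperplaneIncl y)) (Sum.inr 0)
  rw [lightVector_hyperplaneIncl] at h0 h1
  change _ = _ / 2
  rw [← h0, ← h1]
  rfl

/-- The subgroup fixes the last space coordinate of the light vector, so the normal coordinate is
only rescaled. -/
theorem conformalMap_embed_last (x : E (d + 1)) :
    conformalMap (embedSO₀ (d + 1) h).mat x (Fin.last d)
      = x (Fin.last d) / conformalScale (embedSO₀ (d + 1) h).mat x := by
  change ((embedSO₀ (d + 1) h).mat *ᵥ lightVector x) (Sum.inl (Fin.last d).succ) / (2 * _) = _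
  rw [Fin.succ_last, embed_mulVec_last, ← Fin.succ_last, lightVector_succ,
    mul_div_mul_left _ _ two_ne_zero]

theorem conformalMap_embed (y : E d) :
    conformalMap (embedSO₀ (d + 1) h).mat (hyperplaneIncl y)
      = hyperplaneIncl (conformalMap h.mat y) := by
  ext i
  refine Fin.lastCases ?_ (fun i => ?_) i
  · rw [conformalMap_embed_last, hyperplaneIncl_eq_join, hyperplaneIncl_eq_join, join_last,
      join_last, zero_div]
  · rw [hyperplaneIncl_eq_join (conformalMap h.mat y), join_castSucc]
    change ((embedSO₀ (d + 1) h).mat *ᵥ lightVector (hyperplaneIncl y)) (Sum.inl i.castSucc.succ) /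
      (2 * conformalScale (embedSO₀ (d + 1) h).mat (hyperplaneIncl y)) =
      (h.mat *ᵥ lightVector y) (Sum.inl i.succ) / (2 * conformalScale h.mat y)
    have h0 := embed_mulVec h (lightVector (hyperplaneIncl y)) (Sum.inl i.succ)
    rw [lightVector_hyperplaneIncl] at h0
    rw [conformalScale_embed, ← h0]
    rfl

/-- Substitute `h⁻¹ y` for `y`, and let `J` and `J'` be the scales at `x` and `y`. The kernel
contributes `(J J')^{μ+j}`, the normal coordinate `J^{-j}`, the action `J^{-μ}` and the Jacobian
`J'^{-d}`. The powers of `J` cancel, and those of `J'` form the action with parameter `d - (μ+j)`.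
The factor `x_n^j` thus accounts for the shift of the parameter by `j`. -/
theorem principalAction_branchPotential [NeZero d] (g : E d → ℂ) {x : E (d + 1)}
    (hx : conformalScale (embedSO₀ (d + 1) h)⁻¹.mat x ≠ 0) :
    principalAction μ (embedSO₀ (d + 1) h) (branchPotential μ j g) x
      = branchPotential μ j (principalAction (d - (μ + j)) h g) x := by
  have hJ := conformalScale_pos _ hx
  rw [principalAction, branchPotential, branchPotential, integral_conformal h⁻¹,
    ← integral_const_mul]
  refine integral_congr_ae ?_
  filter_upwards [ae_conformalScale_ne_zero h⁻¹] with y hy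
  have hy' : conformalScale (embedSO₀ (d + 1) h⁻¹).mat (hyperplaneIncl y) ≠ 0 := by
    rwa [conformalScale_embed]
  have hJy := conformalScale_pos _ hy
  rw [← map_inv] at hx hJ ⊢
  rw [← riesz_kernel_conformal (embedSO₀ (d + 1) h⁻¹) (μ + j) hx hy', conformalMap_embed_last,
    ← conformalMap_embed, conformalScale_embed, principalAction, Complex.real_smul]
  set J := conformalScale (embedSO₀ (d + 1) h⁻¹).mat x
  set J' := conformalScale h⁻¹.mat y
  have e1 : J ^ (-(μ + j)) = J ^ (-μ) * (J ^ j)⁻¹ := by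
    rw [neg_add, Real.rpow_add hJ, Real.rpow_neg hJ.le (j : ℝ), Real.rpow_natCast]
  have e2 : J' ^ (-((d : ℝ) - (μ + j))) = J'⁻¹ ^ d * (J' ^ (-(μ + j)))⁻¹ := by
    rw [inv_pow, ← Real.rpow_natCast, ← Real.rpow_neg hJy.le, ← Real.rpow_neg hJy.le,
      ← Real.rpow_add hJy]
    congr 1; ring
  have e3 : ((J' ^ (-(μ + j)) : ℝ) : ℂ) ≠ 0 := by exact_mod_cast (Real.rpow_pos_of_pos hJy _).ne'
  have e4 : (J : ℂ) ≠ 0 := by exact_mod_cast hJ.ne'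
  rw [e1, e2]
  push_cast
  rw [div_pow]
  field_simp

end Subgroup

/-! ## Juhl's operator on the complementary series -/

section Intertwining

variable [h₁ : ComplementaryRange d (μ + j)] [h₂ : ComplementaryRange (d + 1) μ]

/-- By density it suffices to treat test vectors, where both sides are realized by the same function
almost everywhere and hence coincide. -/
theorem branchIsometry_compRep (h : SO₀ (d + 1)) (v : CompSeries d (μ + j)) :
    branchIsometry d μ j (compRep d (μ + j) h v)
      = compRep (d + 1) μ (embedSO₀ (d + 1) h) (branchIsometry d μ j v) := by
  have := ComplementaryRange.neZero (N := d) (μ := μ + j)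
  refine denseRange_testVec.induction_on v ?_ fun g => ?_
  · exact isClosed_eq ((branchIsometry d μ j).continuous.comp (compRep d (μ + j) h).continuous)
      ((compRep (d + 1) μ _).continuous.comp (branchIsometry d μ j).continuous)
  · rw [compRep_testVec]
    refine (realizes_branchIsometry_testVec _).unique_left
      ((realizes_branchIsometry_testVec g).compRep (embedSO₀ (d + 1) h)) ?_
    filter_upwards [ae_conformalScale_ne_zero (embedSO₀ (d + 1) h)⁻¹] with x hx
    change branchFactor d μ j * branchPotential μ j (principalAction (d - (μ + j)) h g.1) x = _
    rw [← principalAction_branchPotential h g.1 hx, principalAction, principalAction]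
    ring

variable (d μ j) in
/-- The scalar `c` with `D = c T†`. -/
def juhlFactor : ℂ := (√(branchConst d μ j) : ℂ) * (2 * Real.pi * Complex.I) ^ j

omit h₂ in
theorem juhlFactor_ne_zero : juhlFactor d μ j ≠ 0 := by
  refine mul_ne_zero ?_ (pow_ne_zero _ Complex.two_pi_I_ne_zero)
  exact_mod_cast (Real.sqrt_pos.2 branchConst_pos).ne'

variable (d μ j) in
/-- The extension of Juhl's operator to the complementary series. -/
def juhlExtension : CompSeries (d + 1) μ →L[ℂ] CompSeries d (μ + j) :=
  juhlFactor d μ j • ContinuousLinearMap.adjoint (branchIsometry d μ j).toContinuousLinearMap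

theorem inner_juhlExtension (v : CompSeries d (μ + j)) (u : CompSeries (d + 1) μ) :
    inner ℂ v (juhlExtension d μ j u)
      = juhlFactor d μ j * inner ℂ (branchIsometry d μ j v) u := by
  rw [juhlExtension, smul_apply, inner_smul_right,
    ContinuousLinearMap.adjoint_inner_right]
  rfl

/-- `T† T = 1` for an isometry; surjectivity and non-vanishing of `D` follow. -/
theorem juhlExtension_branchIsometry (v : CompSeries d (μ + j)) :
    juhlExtension d μ j (branchIsometry d μ j v) = juhlFactor d μ j • v := by
  refine ext_inner_left ℂ fun w => ?_
  rw [inner_juhlExtension, LinearIsometry.inner_map_map]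
  exact (inner_smul_right _ _ _).symm

theorem juhlExtension_surjective : Function.Surjective (juhlExtension d μ j) := fun v =>
  ⟨(juhlFactor d μ j)⁻¹ • branchIsometry d μ j v, by
    rw [map_smul, juhlExtension_branchIsometry, inv_smul_smul₀ juhlFactor_ne_zero]⟩

/-- The adjoint of an intertwiner of unitary representations is an intertwiner. -/
theorem juhlExtension_compRep (h : SO₀ (d + 1)) (u : CompSeries (d + 1) μ) :
    juhlExtension d μ j (compRep (d + 1) μ (embedSO₀ (d + 1) h) u)
      = compRep d (μ + j) h (juhlExtension d μ j u) := by
  refine ext_inner_left ℂ fun w => ?_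
  rw [inner_juhlExtension, inner_compRep, inner_compRep, inner_juhlExtension, ← map_inv,
    branchIsometry_compRep]

end Intertwining

theorem exists_compSeries_ne_zero [ComplementaryRange N μ] : ∃ u : CompSeries N μ, u ≠ 0 := by
  let b : ContDiffBump (0 : E N) := ⟨1, 2, by norm_num, by norm_num⟩
  have hb : ContDiff ℝ ∞ fun ξ => (b ξ : ℂ) := Complex.ofRealCLM.contDiff.comp b.contDiff
  have hc : HasCompactSupport fun ξ => (b ξ : ℂ) :=
    b.hasCompactSupport.comp_left (g := Complex.ofReal) Complex.ofReal_zero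
  have hm : MemLp (fun ξ => (b ξ : ℂ)) 2 (freqMeasure N μ) :=
    (hc.toSchwartzMap hb).memLp 2 _
  refine ⟨freqVec _ hm, fun h => ?_⟩
  have h1 := freqVec_ae hm
  rw [h] at h1
  have h2 : ((0 : CompSeries N μ) : Lp ℂ 2 (freqMeasure N μ)) =ᵐ[volume] 0 := by
    have := Lp.coeFn_zero ℂ 2 (freqMeasure N μ)
    rwa [Filter.EventuallyEq, ae_freqMeasure_eq] at this
  have h3 := (hb.continuous.ae_eq_iff_eq volume continuous_zero).1 (h1.symm.trans h2)
  have h4 := congrFun h3 0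
  rw [b.one_of_mem_closedBall (by simp [b])] at h4
  simp at h4

theorem juhlExtension_ne_zero [ComplementaryRange d (μ + j)] [ComplementaryRange (d + 1) μ] :
    juhlExtension d μ j ≠ 0 := by
  intro h
  obtain ⟨v, hv⟩ := exists_compSeries_ne_zero (N := d) (μ := μ + j)
  have h1 := juhlExtension_branchIsometry v
  rw [h, zero_apply] at h1
  exact smul_ne_zero juhlFactor_ne_zero hv h1.symm

end Branching
end

noncomputable section

namespace Branching

variable {N d : ℕ} {μ : ℝ} {j : ℕ}

/-! ## Juhl's operator on Schwartz functions -/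

/-- The partial derivative of a Schwartz function. -/
def schwartzDeriv (i : Fin N) (f : 𝓢(E N, ℂ)) : 𝓢(E N, ℂ) :=
  LineDeriv.lineDerivOp (EuclideanSpace.single i (1 : ℝ)) f

/-- The tangential Laplacian of a Schwartz function. -/
def schwartzLaplacian (f : 𝓢(E (d + 1), ℂ)) : 𝓢(E (d + 1), ℂ) :=
  ∑ i : Fin d, schwartzDeriv i.castSucc (schwartzDeriv i.castSucc f)

theorem coe_schwartzDeriv (i : Fin N) (f : 𝓢(E N, ℂ)) :
    ⇑(schwartzDeriv i f) = partialDeriv i f := by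
  funext x
  exact SchwartzMap.lineDerivOp_apply_eq_fderiv _ _ _

theorem coe_schwartzLaplacian (f : 𝓢(E (d + 1), ℂ)) :
    ⇑(schwartzLaplacian f) = tangentialLaplacian f := by
  funext x
  simp only [schwartzLaplacian, sum_apply, coe_schwartzDeriv, tangentialLaplacian]

variable (d μ j) in
/-- The differential operator in `juhlOperator`, on Schwartz functions. -/
def schwartzJuhl (f : 𝓢(E (d + 1), ℂ)) : 𝓢(E (d + 1), ℂ) :=
  ∑ k ∈ Finset.range (j / 2 + 1), (juhlCoeff d μ j k : ℂ) •
    ((schwartzDeriv (Fin.last d))^[j - 2 * k] (schwartzLaplacian^[k] f))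

theorem schwartzJuhl_apply (f : 𝓢(E (d + 1), ℂ)) (y : E d) :
    schwartzJuhl d μ j f (hyperplaneIncl y) = juhlOperator d μ j f y := by
  have h1 : ∀ (k : ℕ) (f : 𝓢(E (d + 1), ℂ)),
      ⇑(schwartzLaplacian^[k] f) = tangentialLaplacian^[k] f := fun k f =>
    (Function.Semiconj.iterate_right (f := fun f : 𝓢(E (d + 1), ℂ) => (f : E (d + 1) → ℂ))
      coe_schwartzLaplacian k) f
  have h2 : ∀ (k : ℕ) (f : 𝓢(E (d + 1), ℂ)),
      ⇑((schwartzDeriv (Fin.last d))^[k] f) = (partialDeriv (Fin.last d))^[k] f := fun k f =>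
    (Function.Semiconj.iterate_right (f := fun f : 𝓢(E (d + 1), ℂ) => (f : E (d + 1) → ℂ))
      (coe_schwartzDeriv (Fin.last d)) k) f
  simp only [schwartzJuhl, sum_apply, juhlOperator, smul_apply, smul_eq_mul, h1, h2]

theorem fourier_schwartzDeriv (i : Fin N) (f : 𝓢(E N, ℂ)) (ξ : E N) :
    (𝓕 (schwartzDeriv i f) : 𝓢(E N, ℂ)) ξ
      = (2 * Real.pi * Complex.I) * (ξ i : ℂ) * (𝓕 f : 𝓢(E N, ℂ)) ξ := by
  have hg : Function.HasTemperateGrowth fun x : E N =>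
    (inner ℝ x (EuclideanSpace.single i (1 : ℝ)) : ℝ) := by fun_prop
  rw [schwartzDeriv, SchwartzMap.fourier_lineDerivOp_eq, smul_apply,
    SchwartzMap.smulLeftCLM_apply_apply hg, EuclideanSpace.inner_single_right, smul_eq_mul,
    Complex.real_smul]
  simp [mul_assoc]

theorem fourier_sum_apply {ι : Type*} (s : Finset ι) (f : ι → 𝓢(E N, ℂ)) (ξ : E N) :
    (𝓕 (∑ i ∈ s, f i) : 𝓢(E N, ℂ)) ξ = ∑ i ∈ s, (𝓕 (f i) : 𝓢(E N, ℂ)) ξ := by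
  rw [← sum_apply]
  congr 1
  exact map_sum (FourierTransform.fourierCLM ℂ 𝓢(E N, ℂ)) f s

theorem fourier_schwartzLaplacian (f : 𝓢(E (d + 1), ℂ)) (ξ : E (d + 1)) :
    (𝓕 (schwartzLaplacian f) : 𝓢(E (d + 1), ℂ)) ξ
      = (2 * Real.pi * Complex.I) ^ 2 * ((‖tangential ξ‖ ^ 2 : ℝ) : ℂ) *
        (𝓕 f : 𝓢(E (d + 1), ℂ)) ξ := by
  rw [schwartzLaplacian, fourier_sum_apply, EuclideanSpace.real_norm_sq_eq]
  push_cast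
  rw [Finset.mul_sum, Finset.sum_mul]
  refine Finset.sum_congr rfl fun i _ => ?_
  rw [fourier_schwartzDeriv, fourier_schwartzDeriv, tangential_apply]; ring

/-- Every term of the operator has exactly `j` derivatives, which gives the common factor `(2πi)^j`;
what remains is the Gegenbauer polynomial, by the identification of the coefficients. -/
theorem fourier_schwartzJuhl (f : 𝓢(E (d + 1), ℂ)) (ξ : E (d + 1)) :
    (𝓕 (schwartzJuhl d μ j f) : 𝓢(E (d + 1), ℂ)) ξ
      = (2 * Real.pi * Complex.I) ^ j * (juhlSymbol d μ j ξ : ℂ) *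
        (𝓕 f : 𝓢(E (d + 1), ℂ)) ξ := by
  have h1 : ∀ (k : ℕ) (f : 𝓢(E (d + 1), ℂ)), (𝓕 (schwartzLaplacian^[k] f) : 𝓢(E (d + 1), ℂ)) ξ
      = ((2 * Real.pi * Complex.I) ^ 2 * ((‖tangential ξ‖ ^ 2 : ℝ) : ℂ)) ^ k *
        (𝓕 f : 𝓢(E (d + 1), ℂ)) ξ := by
    intro k f
    induction k with
    | zero => simp
    | succ k ih => rw [Function.iterate_succ_apply', fourier_schwartzLaplacian, ih]; ring
  have h2 : ∀ (k : ℕ) (f : 𝓢(E (d + 1), ℂ)),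
      (𝓕 ((schwartzDeriv (Fin.last d))^[k] f) : 𝓢(E (d + 1), ℂ)) ξ
      = (2 * Real.pi * Complex.I * (ξ (Fin.last d) : ℂ)) ^ k * (𝓕 f : 𝓢(E (d + 1), ℂ)) ξ := by
    intro k f
    induction k with
    | zero => simp
    | succ k ih => rw [Function.iterate_succ_apply', fourier_schwartzDeriv, ih]; ring
  have h3 : ∀ (c : ℂ) (f : 𝓢(E (d + 1), ℂ)), (𝓕 (c • f) : 𝓢(E (d + 1), ℂ)) ξ
      = c * (𝓕 f : 𝓢(E (d + 1), ℂ)) ξ := by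
    intro c f
    rw [FourierTransform.fourier_smul]; rfl
  rw [schwartzJuhl, fourier_sum_apply, juhlSymbol, juhlIndex, juhlPoly_eq_juhlCoeff]
  push_cast
  rw [Finset.mul_sum, Finset.sum_mul]
  refine Finset.sum_congr rfl fun k hk => ?_
  have hk' : 2 * k ≤ j := by simp only [Finset.mem_range] at hk; omega
  have h4 : (2 * Real.pi * Complex.I : ℂ) ^ j = (2 * Real.pi * Complex.I) ^ (j - 2 * k) *
      ((2 * Real.pi * Complex.I) ^ 2) ^ k := by
    rw [← pow_mul, ← pow_add]; congr 1; omega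
  rw [h3, h2, h1, h4]
  push_cast; ring

/-- The restriction of a Schwartz function to the hyperplane, in terms of Fourier transforms. -/
theorem integral_restrict_mul_fourier (F : 𝓢(E (d + 1), ℂ)) (φ : 𝓢(E d, ℂ)) :
    ∫ y, F (hyperplaneIncl y) * (𝓕 φ : 𝓢(E d, ℂ)) y
      = ∫ ξ, (𝓕 F : 𝓢(E (d + 1), ℂ)) ξ * φ (tangential ξ) := by
  have inv : ∀ {M : ℕ} (G : 𝓢(E M, ℂ)) (x : E M),
      G x = ∫ ξ, (Real.fourierChar (inner ℝ ξ x) : ℂ) * (𝓕 G : 𝓢(E M, ℂ)) ξ := by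
    intro M G x
    have e : (𝓕⁻ (𝓕 G : 𝓢(E M, ℂ)) : 𝓢(E M, ℂ)) = G := FourierTransform.fourierInv_fourier_eq G
    conv_lhs => rw [← e]
    rw [SchwartzMap.fourierInv_coe, Real.fourierInv_eq]
    rfl
  have h1 : ∀ y, F (hyperplaneIncl y) * (𝓕 φ : 𝓢(E d, ℂ)) y =
      ∫ ξ, (Real.fourierChar (inner ℝ (tangential ξ) y) : ℂ) * (𝓕 F : 𝓢(E (d + 1), ℂ)) ξ *
        (𝓕 φ : 𝓢(E d, ℂ)) y := by
    intro y
    rw [inv F, ← integral_mul_const]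
    simp only [inner_hyperplaneIncl]
  have h2 : ∀ ξ : E (d + 1), (𝓕 F : 𝓢(E (d + 1), ℂ)) ξ * φ (tangential ξ) =
      ∫ y, (Real.fourierChar (inner ℝ (tangential ξ) y) : ℂ) * (𝓕 F : 𝓢(E (d + 1), ℂ)) ξ *
        (𝓕 φ : 𝓢(E d, ℂ)) y := by
    intro ξ
    rw [inv φ, ← integral_const_mul]
    refine integral_congr_ae (.of_forall fun y => ?_)
    simp only
    rw [real_inner_comm]; ring
  simp only [h1, h2]
  refine integral_integral_swap ?_
  have h4 := ((𝓕 φ : 𝓢(E d, ℂ)).integrable (μ := volume)).mul_prod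
    ((𝓕 F : 𝓢(E (d + 1), ℂ)).integrable (μ := volume)) |>.bdd_mul (c := 1)
    (f := fun z : E d × E (d + 1) =>
      (Real.fourierChar (inner ℝ (tangential z.2) z.1) : ℂ)) (by
        have : Continuous fun z : E d × E (d + 1) => inner ℝ (tangential z.2) z.1 :=
          (continuous_tangential.comp continuous_snd).inner continuous_fst
        exact (by fun_prop : Continuous fun z : E d × E (d + 1) =>
          (Real.fourierChar (inner ℝ (tangential z.2) z.1) : ℂ)).aestronglyMeasurable)
      (.of_forall fun z => (Circle.norm_coe _).le)
  refine h4.congr (.of_forall fun z => ?_)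
  simp only [Function.uncurry]; ring

theorem realizes_schwartz [ComplementaryRange N μ] (f : 𝓢(E N, ℂ)) :
    Realizes (freqVec (𝓕 f : 𝓢(E N, ℂ)) ((𝓕 f : 𝓢(E N, ℂ)).memLp 2 (freqMeasure N μ))) f := by
  intro φ
  refine ⟨?_, integrable_mul_schwartz _ φ, ?_⟩
  · obtain ⟨C, -, hC⟩ := φ.decay 0 0
    simp only [pow_zero, one_mul, norm_iteratedFDeriv_zero] at hC
    exact (f.integrable (μ := volume)).mul_bdd (c := C) φ.continuous.aestronglyMeasurable
      (.of_forall hC)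
  · have h1 := integral_fourier_mul_flip (f.integrable (μ := volume)) (φ.integrable (μ := volume))
    rw [← SchwartzMap.fourier_coe, ← SchwartzMap.fourier_coe] at h1
    rw [← h1]
    refine integral_congr_ae ?_
    filter_upwards [freqVec_ae ((𝓕 f : 𝓢(E N, ℂ)).memLp 2 (freqMeasure N μ))] with ξ hξ
    rw [hξ]

section Extension

variable [h₁ : ComplementaryRange d (μ + j)] [h₂ : ComplementaryRange (d + 1) μ]

/-- Both pairings with `φ` equal the integral of `(2πi)^j P(|ξ'|², ξ_n) 𝓕f(ξ) φ(ξ')`, one by the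
restriction formula and the other by the definition of the adjoint. The factor `√κ` in `juhlFactor`
cancels the normalization of `T`. -/
theorem realizes_juhlExtension_schwartz (f : 𝓢(E (d + 1), ℂ)) :
    Realizes (juhlExtension d μ j (freqVec (𝓕 f : 𝓢(E (d + 1), ℂ))
      ((𝓕 f : 𝓢(E (d + 1), ℂ)).memLp 2 (freqMeasure (d + 1) μ)))) (juhlOperator d μ j f) := by
  have hf : juhlOperator d μ j f = fun y => schwartzJuhl d μ j f (hyperplaneIncl y) :=
    funext fun y => (schwartzJuhl_apply f y).symm
  rw [hf]
  refine realizes_of_forall_test _ _ (fun φ => ?_) fun φ => ?_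
  · obtain ⟨C, -, hC⟩ := (schwartzJuhl d μ j f).decay 0 0
    simp only [pow_zero, one_mul, norm_iteratedFDeriv_zero] at hC
    exact ((𝓕 φ : 𝓢(E d, ℂ)).integrable (μ := volume)).bdd_mul (c := C)
      ((schwartzJuhl d μ j f).continuous.comp continuous_hyperplaneIncl).aestronglyMeasurable
      (.of_forall fun y => hC _)
  · rw [inner_juhlExtension, integral_restrict_mul_fourier,
      (inner_dual _ _ (branchIsometry_ae (testVec d (μ + j) (schwartzTest d (μ + j) φ)))).2,
      ← integral_const_mul]
    refine integral_congr_ae ?_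
    filter_upwards [branchFun_testVec (schwartzTest d (μ + j) φ),
      freqVec_ae ((𝓕 f : 𝓢(E (d + 1), ℂ)).memLp 2 (freqMeasure (d + 1) μ))] with ξ e1 e2
    have e3 : star (𝓕 (schwartzTest d (μ + j) φ).1 (tangential ξ)) = φ (tangential ξ) := by
      change star (𝓕 (fun x => star ((𝓕 φ : 𝓢(E d, ℂ)) x)) _) = _
      rw [star_fourier_star, ← SchwartzMap.fourierInv_coe, FourierTransform.fourierInv_fourier_eq]
    have hκ : (√(branchConst d μ j) : ℂ) ≠ 0 := by
      exact_mod_cast (Real.sqrt_pos.2 branchConst_pos).ne'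
    rw [e1, e2, fourier_schwartzJuhl, star_mul', e3, Complex.star_def, Complex.conj_ofReal,
      juhlFactor]
    push_cast
    field_simp

end Extension

end Branching
end

noncomputable section

namespace Branching

variable {N d : ℕ} {μ : ℝ} {j : ℕ}

/-! ## Rotations -/

section Rotation

variable {p : ℕ} (a b : Fin p)

/-- The projection onto the plane of the space coordinates `a` and `b`. -/
def planeProj : Matrix (Fin p ⊕ Fin 1) (Fin p ⊕ Fin 1) ℝ :=
  Matrix.single (Sum.inl a) (Sum.inl a) 1 + Matrix.single (Sum.inl b) (Sum.inl b) 1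

/-- The infinitesimal rotation in the plane of the space coordinates `a` and `b`. -/
def planeGen : Matrix (Fin p ⊕ Fin 1) (Fin p ⊕ Fin 1) ℝ :=
  Matrix.single (Sum.inl b) (Sum.inl a) 1 - Matrix.single (Sum.inl a) (Sum.inl b) 1

/-- The rotation in the plane of the space coordinates `a` and `b`. -/
def planeRot (θ : ℝ) : Matrix (Fin p ⊕ Fin 1) (Fin p ⊕ Fin 1) ℝ :=
  1 + (Real.cos θ - 1) • planeProj a b + Real.sin θ • planeGen a b

variable {a b} (hab : a ≠ b)

include hab in
theorem planeProj_mul_planeProj : planeProj a b * planeProj a b = planeProj a b := by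
  simp [planeProj, mul_add, add_mul, hab, hab.symm]

include hab in
theorem planeProj_mul_planeGen : planeProj a b * planeGen a b = planeGen a b := by
  simp [planeProj, planeGen, mul_sub, add_mul, hab, hab.symm]

include hab in
theorem planeGen_mul_planeProj : planeGen a b * planeProj a b = planeGen a b := by
  simp [planeProj, planeGen, sub_mul, mul_add, hab, hab.symm]; abel

include hab in
theorem planeGen_mul_planeGen : planeGen a b * planeGen a b = -planeProj a b := by
  simp [planeProj, planeGen, sub_mul, mul_sub, hab, hab.symm]; abel

include hab in
-- On the plane the generator squares to `-1`, so these are the addition formulas of cosine and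
-- sine.
theorem planeRot_add (θ η : ℝ) : planeRot a b (θ + η) = planeRot a b θ * planeRot a b η := by
  simp only [planeRot, mul_add, add_mul, one_mul, mul_one, smul_mul_assoc, mul_smul_comm,
    planeProj_mul_planeProj hab, planeProj_mul_planeGen hab, planeGen_mul_planeProj hab,
    planeGen_mul_planeGen hab, Real.cos_add, Real.sin_add]
  module

theorem planeRot_zero : planeRot a b 0 = 1 := by simp [planeRot]

theorem transpose_planeRot (θ : ℝ) : (planeRot a b θ)ᵀ = planeRot a b (-θ) := by
  simp only [planeRot, planeProj, planeGen, Matrix.transpose_add, Matrix.transpose_smul,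
    Matrix.transpose_sub, Matrix.transpose_one, Matrix.transpose_single, Real.cos_neg, Real.sin_neg]
  module

include hab in
theorem det_planeRot (θ : ℝ) : (planeRot a b θ).det = 1 := by
  -- Orthogonality gives only that the determinant squares to one; the rotation is therefore written
  -- as the square of another.
  have h1 : planeRot a b θ = planeRot a b (θ / 2) * planeRot a b (θ / 2) := by
    rw [← planeRot_add hab]; congr 1; ring
  have h2 : planeRot a b (θ / 2) * (planeRot a b (θ / 2))ᵀ = 1 := by
    rw [transpose_planeRot, ← planeRot_add hab, add_neg_cancel, planeRot_zero]
  have h3 := congrArg Matrix.det h2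
  rw [Matrix.det_mul, Matrix.det_transpose, Matrix.det_one] at h3
  rw [h1, Matrix.det_mul, h3]

theorem lorentzForm_mul_planeRot (θ : ℝ) :
    lorentzForm p * planeRot a b θ = planeRot a b θ * lorentzForm p := by
  have h : ∀ i j : Fin p, lorentzForm p * Matrix.single (Sum.inl i) (Sum.inl j) 1
      = Matrix.single (Sum.inl i) (Sum.inl j) 1 * lorentzForm p := by
    intro i j
    ext x y
    rw [lorentzForm, LieAlgebra.Orthogonal.indefiniteDiagonal, Matrix.diagonal_mul,
      Matrix.mul_diagonal]
    rcases x with x | x <;> rcases y with y | y <;> simp [Matrix.single]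
  simp only [planeRot, planeProj, planeGen, mul_add, add_mul, mul_sub, sub_mul, h, mul_smul_comm,
    smul_mul_assoc, mul_one, one_mul]

/-- The rotation in the plane of the space coordinates `a` and `b`, as an element of `SO(p, 1)`. -/
def planeRotSO (θ : ℝ) : SO p :=
  ⟨⟨planeRot a b θ, planeRot a b (-θ),
    by rw [← planeRot_add hab, add_neg_cancel, planeRot_zero],
    by rw [← planeRot_add hab, neg_add_cancel, planeRot_zero]⟩, by
    refine ⟨?_, det_planeRot hab θ⟩
    change (planeRot a b θ)ᵀ * lorentzForm p * planeRot a b θ = _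
    rw [Matrix.mul_assoc, lorentzForm_mul_planeRot, ← Matrix.mul_assoc, transpose_planeRot,
      ← planeRot_add hab, neg_add_cancel, planeRot_zero, Matrix.one_mul]⟩

theorem continuous_planeRotSO : Continuous (planeRotSO hab) := by
  have h : Continuous (planeRot a b) := by
    have h1 : Continuous fun θ : ℝ => (1 : Matrix (Fin p ⊕ Fin 1) (Fin p ⊕ Fin 1) ℝ) +
        (Real.cos θ - 1) • planeProj a b + Real.sin θ • planeGen a b := by fun_prop
    exact h1
  exact continuous_induced_rng.2 ((Units.continuous_iff
    (f := fun θ => (planeRotSO hab θ : GL (Fin p ⊕ Fin 1) ℝ))).2 ⟨h, h.comp continuous_neg⟩)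

include hab in
/-- The rotation by `π` is in the identity component. -/
theorem exists_halfTurn : ∃ w : SO₀ p, w⁻¹.mat = w.mat ∧
    (∀ X, (w.mat *ᵥ X) (Sum.inr 0) = X (Sum.inr 0)) ∧
    ∀ X, (w.mat *ᵥ X) (Sum.inl a) = -X (Sum.inl a) := by
  have h0 : planeRotSO hab 0 = 1 := Subtype.ext (Units.ext planeRot_zero)
  have hmem : planeRotSO hab Real.pi ∈ connectedComponent (1 : SO p) :=
    (isPreconnected_range (continuous_planeRotSO hab)).subset_connectedComponent
      ⟨0, h0⟩ ⟨Real.pi, rfl⟩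
  let w : SO₀ p := ⟨planeRotSO hab Real.pi, hmem⟩
  have hw : w.mat = planeRot a b Real.pi := rfl
  have hw2 : w.mat * w.mat = 1 := by
    rw [hw, ← planeRot_add hab]
    simp [planeRot, ← two_mul]
  refine ⟨w, ?_, fun X => ?_, fun X => ?_⟩
  · calc w⁻¹.mat = w⁻¹.mat * (w.mat * w.mat) := by rw [hw2, mul_one]
      _ = w.mat := by rw [← mul_assoc, SO₀.mat_inv_mul, one_mul]
  · rw [hw]
    simp [planeRot, planeProj, Matrix.add_mulVec, Matrix.single_mulVec]
  · rw [hw]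
    simp [planeRot, planeProj, Matrix.add_mulVec, Matrix.single_mulVec, hab]
    ring

end Rotation

end Branching
end

noncomputable section

namespace Branching

variable {N d : ℕ} {μ : ℝ} {j : ℕ}

/-! ## Smooth vectors -/

variable (μ) in
/-- The smooth vector `(1 + |x|²)^{-μ} φ(u(x))`. -/
def smoothVec (φ : (Fin (N + 1) → ℝ) → ℂ) (x : E N) : ℂ :=
  (((1 + ‖x‖ ^ 2) ^ (-μ) : ℝ) : ℂ) * φ fun i => lightVector x (Sum.inl i) / (1 + ‖x‖ ^ 2)

theorem contDiff_smoothVec {φ : (Fin (N + 1) → ℝ) → ℂ} (hφ : ContDiff ℝ ∞ φ) :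
    ContDiff ℝ ∞ (smoothVec μ φ) := by
  have h1 : ContDiff ℝ ∞ fun x : E N => 1 + ‖x‖ ^ 2 := contDiff_const.add (contDiff_norm_sq ℝ)
  have h0 : ∀ x : E N, 1 + ‖x‖ ^ 2 ≠ 0 := fun x => by positivity
  refine ContDiff.mul ?_ (hφ.comp (contDiff_pi.2 fun i => ?_))
  · exact Complex.ofRealCLM.contDiff.comp (h1.rpow_const_of_ne h0)
  · refine ContDiff.div ?_ h1 h0
    have := contDiff_mulVec_lightVector (N := N) 1 (Sum.inl i)
    simpa only [Matrix.one_mulVec] using this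

theorem lightVector_div_time (x : E N) :
    lightVector x (Sum.inl 0) / (1 + ‖x‖ ^ 2) = 2 / (1 + ‖x‖ ^ 2) - 1 := by
  have h0 : 1 + ‖x‖ ^ 2 ≠ 0 := by positivity
  rw [lightVector_zero]; field_simp; ring

/-- The point of the light cone with time coordinate one above a point of the sphere. -/
def liftSphere (v : Fin (N + 1) → ℝ) : Fin (N + 1) ⊕ Fin 1 → ℝ := Sum.elim v fun _ => 1

theorem liftSphere_eq (x : E N) : liftSphere (fun i => lightVector x (Sum.inl i) / (1 + ‖x‖ ^ 2))
    = (1 + ‖x‖ ^ 2)⁻¹ • lightVector x := by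
  have h0 : 1 + ‖x‖ ^ 2 ≠ 0 := by positivity
  funext k
  rcases k with k | k
  · simp [liftSphere, div_eq_inv_mul]
  · simp [liftSphere, h0]

/-- If the time coordinate is preserved then `J (1 + |Rx|²) = 1 + |x|²`, so `R` acts linearly on
light vectors normalized to time coordinate one, that is, on the sphere. -/
theorem smul_lightVector_of_time {R : SO₀ (N + 1)}
    (hR : ∀ X, (R.mat *ᵥ X) (Sum.inr 0) = X (Sum.inr 0)) {x : E N}
    (hx : conformalScale R.mat x ≠ 0) :
    (1 + ‖conformalMap R.mat x‖ ^ 2)⁻¹ • lightVector (conformalMap R.mat x)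
      = R.mat *ᵥ ((1 + ‖x‖ ^ 2)⁻¹ • lightVector x) := by
  have h1 := conformalScale_mul_time R x hx
  rw [hR, lightVector_time] at h1
  have h2 : 1 + ‖conformalMap R.mat x‖ ^ 2 ≠ 0 := by positivity
  rw [Matrix.mulVec_smul, mulVec_lightVector R x hx, smul_smul, ← h1]
  congr 1
  field_simp

/-- A function on the sphere, transformed by a matrix that preserves the time coordinate. -/
def rotate (A : Matrix (Fin (N + 1) ⊕ Fin 1) (Fin (N + 1) ⊕ Fin 1) ℝ)
    (φ : (Fin (N + 1) → ℝ) → ℂ) (v : Fin (N + 1) → ℝ) : ℂ :=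
  φ fun i => (A *ᵥ liftSphere v) (Sum.inl i)

/-- The rotations act on smooth vectors through their action on the sphere. -/
theorem principalAction_smoothVec {R : SO₀ (N + 1)}
    (hR : ∀ X, (R⁻¹.mat *ᵥ X) (Sum.inr 0) = X (Sum.inr 0)) (φ : (Fin (N + 1) → ℝ) → ℂ) {x : E N}
    (hx : conformalScale R⁻¹.mat x ≠ 0) :
    principalAction μ R (smoothVec μ (rotate R.mat φ)) x
      = smoothVec μ φ x := by
  have hJ := conformalScale_pos _ hx
  have h1 := conformalScale_mul_time R⁻¹ x hx
  rw [hR, lightVector_time] at h1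
  have h2 : ∀ i, (R.mat *ᵥ liftSphere (fun i => lightVector (conformalMap R⁻¹.mat x) (Sum.inl i) /
      (1 + ‖conformalMap R⁻¹.mat x‖ ^ 2))) (Sum.inl i) = lightVector x (Sum.inl i) / (1 + ‖x‖ ^ 2) := by
    intro i
    rw [liftSphere_eq, smul_lightVector_of_time hR hx, Matrix.mulVec_mulVec, SO₀.mat_mul_inv,
      Matrix.one_mulVec, Pi.smul_apply, smul_eq_mul, div_eq_inv_mul]
  rw [principalAction, smoothVec, smoothVec, rotate]
  simp only [h2]
  rw [← mul_assoc, ← Complex.ofReal_mul, ← Real.mul_rpow hJ.le (by positivity), h1]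

/-! ### Cutting a smooth vector near the point at infinity -/

/-- A smooth cutoff on the sphere near the south pole. -/
def poleCutoff (ε t : ℝ) : ℝ := Real.smoothTransition ((t + 1) / ε - 1)

theorem contDiff_poleCutoff (ε : ℝ) : ContDiff ℝ ∞ (poleCutoff ε) :=
  Real.smoothTransition.contDiff.comp (by fun_prop)

theorem poleCutoff_eq_zero {ε t : ℝ} (hε : 0 < ε) (h : t + 1 ≤ ε) : poleCutoff ε t = 0 := by
  refine Real.smoothTransition.zero_of_nonpos ?_
  rw [sub_nonpos, div_le_one hε]; exact h

theorem poleCutoff_eq_one {ε t : ℝ} (hε : 0 < ε) (h : 2 * ε ≤ t + 1) : poleCutoff ε t = 1 := by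
  refine Real.smoothTransition.one_of_one_le ?_
  rw [le_sub_iff_add_le, le_div_iff₀ hε]; linarith

/-- The part of a function on the sphere away from the south pole. -/
def northPart (ε : ℝ) (φ : (Fin (N + 1) → ℝ) → ℂ) (v : Fin (N + 1) → ℝ) : ℂ :=
  (poleCutoff ε (v 0) : ℂ) * φ v

/-- The part of a function on the sphere near the south pole. -/
def southPart (ε : ℝ) (φ : (Fin (N + 1) → ℝ) → ℂ) (v : Fin (N + 1) → ℝ) : ℂ :=
  (1 - (poleCutoff ε (v 0) : ℂ)) * φ v

theorem contDiff_northPart (ε : ℝ) {φ : (Fin (N + 1) → ℝ) → ℂ} (hφ : ContDiff ℝ ∞ φ) :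
    ContDiff ℝ ∞ (northPart ε φ) :=
  ContDiff.mul (Complex.ofRealCLM.contDiff.comp
    ((contDiff_poleCutoff ε).comp (contDiff_apply ℝ ℝ 0))) hφ

theorem contDiff_southPart (ε : ℝ) {φ : (Fin (N + 1) → ℝ) → ℂ} (hφ : ContDiff ℝ ∞ φ) :
    ContDiff ℝ ∞ (southPart ε φ) :=
  ContDiff.mul (contDiff_const.sub (Complex.ofRealCLM.contDiff.comp
    ((contDiff_poleCutoff ε).comp (contDiff_apply ℝ ℝ 0)))) hφ

theorem northPart_add_southPart (ε : ℝ) (φ : (Fin (N + 1) → ℝ) → ℂ) (v : Fin (N + 1) → ℝ) :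
    northPart ε φ v + southPart ε φ v = φ v := by
  rw [northPart, southPart]; ring

theorem smoothVec_northPart_eq_zero {ε : ℝ} (hε : 0 < ε) (φ : (Fin (N + 1) → ℝ) → ℂ) {x : E N}
    (hx : 2 / (1 + ‖x‖ ^ 2) ≤ ε) : smoothVec μ (northPart ε φ) x = 0 := by
  rw [smoothVec, northPart, lightVector_div_time, poleCutoff_eq_zero hε (by linarith)]; simp

theorem smoothVec_northPart_eq {ε : ℝ} (hε : 0 < ε) (φ : (Fin (N + 1) → ℝ) → ℂ) {x : E N}
    (hx : 2 * ε ≤ 2 / (1 + ‖x‖ ^ 2)) : smoothVec μ (northPart ε φ) x = smoothVec μ φ x := by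
  rw [smoothVec, northPart, lightVector_div_time, poleCutoff_eq_one hε (by linarith), smoothVec]
  simp

/-- The south pole corresponds to the point at infinity, since `u_0 + 1 = 2/(1+|x|²)`. -/
theorem hasCompactSupport_northPart {ε : ℝ} (hε : 0 < ε) (φ : (Fin (N + 1) → ℝ) → ℂ) :
    HasCompactSupport (smoothVec μ (northPart ε φ) : E N → ℂ) := by
  refine HasCompactSupport.intro (isCompact_closedBall (0 : E N) (2 / ε)) fun x hx =>
    smoothVec_northPart_eq_zero hε φ ?_
  rw [mem_closedBall_zero_iff, not_le, div_lt_iff₀ hε] at hx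
  rw [div_le_iff₀ (by positivity)]
  nlinarith [sq_nonneg (‖x‖ - 1)]

theorem contDiff_rotate (A : Matrix (Fin (N + 1) ⊕ Fin 1) (Fin (N + 1) ⊕ Fin 1) ℝ)
    {φ : (Fin (N + 1) → ℝ) → ℂ} (hφ : ContDiff ℝ ∞ φ) : ContDiff ℝ ∞ (rotate A φ) := by
  refine hφ.comp (contDiff_pi.2 fun i => ?_)
  simp only [Matrix.mulVec, dotProduct]
  refine ContDiff.sum fun k _ => contDiff_const.mul ?_
  rcases k with k | k
  · exact contDiff_apply ℝ ℝ k
  · exact contDiff_const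

theorem smoothVec_rotate_southPart_eq_zero {A : Matrix (Fin (N + 1) ⊕ Fin 1) (Fin (N + 1) ⊕ Fin 1) ℝ}
    (hA : ∀ X, (A *ᵥ X) (Sum.inl 0) = -X (Sum.inl 0)) {ε : ℝ} (hε : 0 < ε)
    (φ : (Fin (N + 1) → ℝ) → ℂ) {x : E N} (hx : 2 / (1 + ‖x‖ ^ 2) ≤ 2 - 2 * ε) :
    smoothVec μ (rotate A (southPart ε φ)) x = 0 := by
  rw [smoothVec, rotate, southPart, hA, liftSphere, Sum.elim_inl, lightVector_div_time,
    poleCutoff_eq_one hε (by linarith)]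
  simp

/-- The matrix reverses the polar coordinate, so the part near the south pole moves to the vicinity
of `x = 0`; for `ε ≤ 1/2` it lies in the unit ball. -/
theorem hasCompactSupport_rotate_southPart
    {A : Matrix (Fin (N + 1) ⊕ Fin 1) (Fin (N + 1) ⊕ Fin 1) ℝ}
    (hA : ∀ X, (A *ᵥ X) (Sum.inl 0) = -X (Sum.inl 0)) {ε : ℝ} (hε : 0 < ε) (hε' : ε ≤ 1 / 2)
    (φ : (Fin (N + 1) → ℝ) → ℂ) :
    HasCompactSupport (smoothVec μ (rotate A (southPart ε φ)) : E N → ℂ) := by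
  refine HasCompactSupport.intro (isCompact_closedBall (0 : E N) 1) fun x hx =>
    smoothVec_rotate_southPart_eq_zero hA hε φ ?_
  rw [mem_closedBall_zero_iff, not_le] at hx
  have : 2 / (1 + ‖x‖ ^ 2) ≤ 1 := by
    rw [div_le_one (by positivity)]; nlinarith
  linarith

/-! ### Locality of Juhl's operator -/

theorem partialDeriv_congr {f g : E N → ℂ} {x : E N} (h : f =ᶠ[nhds x] g) (i : Fin N) :
    partialDeriv i f =ᶠ[nhds x] partialDeriv i g :=
  (h.fderiv (𝕜 := ℝ)).mono fun y hy => by rw [partialDeriv, hy, partialDeriv]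

theorem tangentialLaplacian_congr {f g : E (d + 1) → ℂ} {x : E (d + 1)} (h : f =ᶠ[nhds x] g) :
    tangentialLaplacian f =ᶠ[nhds x] tangentialLaplacian g := by
  have h1 : ∀ᶠ y in nhds x, ∀ i : Fin d, partialDeriv i.castSucc (partialDeriv i.castSucc f) y
      = partialDeriv i.castSucc (partialDeriv i.castSucc g) y :=
    Filter.eventually_all.2 fun i => partialDeriv_congr (partialDeriv_congr h _) _
  exact h1.mono fun y hy => Finset.sum_congr rfl fun i _ => hy i

theorem juhlOperator_congr {f g : E (d + 1) → ℂ} {y : E d}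
    (h : f =ᶠ[nhds (hyperplaneIncl y)] g) : juhlOperator d μ j f y = juhlOperator d μ j g y := by
  have h1 : ∀ k, tangentialLaplacian^[k] f =ᶠ[nhds (hyperplaneIncl y)]
      tangentialLaplacian^[k] g := fun k => by
    induction k with
    | zero => exact h
    | succ k ih =>
      rw [Function.iterate_succ_apply', Function.iterate_succ_apply']
      exact tangentialLaplacian_congr ih
  have h2 : ∀ k l, (partialDeriv (Fin.last d))^[l] (tangentialLaplacian^[k] f)
      =ᶠ[nhds (hyperplaneIncl y)] (partialDeriv (Fin.last d))^[l] (tangentialLaplacian^[k] g) :=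
    fun k l => by
    induction l with
    | zero => exact h1 k
    | succ l ih =>
      rw [Function.iterate_succ_apply', Function.iterate_succ_apply']
      exact partialDeriv_congr ih _
  exact Finset.sum_congr rfl fun k _ => by rw [(h2 k _).eq_of_nhds]

theorem partialDeriv_zero (i : Fin N) : partialDeriv i (0 : E N → ℂ) = 0 := by
  funext x
  simp [partialDeriv]

theorem juhlOperator_zero (y : E d) : juhlOperator d μ j 0 y = 0 := by
  have h1 : tangentialLaplacian (0 : E (d + 1) → ℂ) = 0 := by
    funext x
    simp [tangentialLaplacian, partialDeriv_zero]
  refine Finset.sum_eq_zero fun k _ => ?_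
  rw [Function.iterate_fixed h1, Function.iterate_fixed (partialDeriv_zero _), Pi.zero_apply,
    mul_zero]

/-! ### Juhl's operator on smooth vectors -/

section SmoothVectors

variable [h₁ : ComplementaryRange d (μ + j)] [h₂ : ComplementaryRange (d + 1) μ]

variable (d) in
-- The plane is spanned by the polar coordinate and a tangential one, which exists as `d ≠ 0`. The
-- half turn therefore lies in `H₁`, and `D` commutes with its action.
theorem exists_tangential_halfTurn [NeZero d] : ∃ w : SO₀ (d + 1), w⁻¹.mat = w.mat ∧
    (∀ X, (w.mat *ᵥ X) (Sum.inr 0) = X (Sum.inr 0)) ∧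
    ∀ X, (w.mat *ᵥ X) (Sum.inl 0) = -X (Sum.inl 0) :=
  exists_halfTurn (a := (0 : Fin (d + 1))) (b := Fin.last d) (by
    simp [Fin.ext_iff, (NeZero.ne d).symm])

theorem exists_realizes_contDiff {f : E (d + 1) → ℂ} (hf : ContDiff ℝ ∞ f)
    (hc : HasCompactSupport f) : ∃ u : CompSeries (d + 1) μ, Realizes u f ∧
      Realizes (juhlExtension d μ j u) (juhlOperator d μ j f) :=
  ⟨_, realizes_schwartz (hc.toSchwartzMap hf),
    realizes_juhlExtension_schwartz (hc.toSchwartzMap hf)⟩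

/-- The north part and the half-turned south part have compact support, so `D` is known on both, and
equivariance under `w` transports the second result back. Where the polar coordinate exceeds the
cutoff, the second contribution is zero by locality. Only that vanishing is needed, not a covariance
formula for the differential operator. -/
theorem exists_realizes_smoothVec_away_from_pole {φ : (Fin (d + 2) → ℝ) → ℂ} (hφ : ContDiff ℝ ∞ φ) {ε : ℝ}
    (hε : 0 < ε) (hε' : ε ≤ 1 / 2) : ∃ u : CompSeries (d + 1) μ, Realizes u (smoothVec μ φ) ∧
      ∃ G : E d → ℂ, Realizes (juhlExtension d μ j u) G ∧
        ∀ᵐ y, 2 * ε < 2 / (1 + ‖y‖ ^ 2) → G y = juhlOperator d μ j (smoothVec μ φ) y := by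
  have := ComplementaryRange.neZero (N := d) (μ := μ + j)
  obtain ⟨w, hw, hwt, hw0⟩ := exists_tangential_halfTurn d
  set W : SO₀ (d + 2) := embedSO₀ (d + 1) w with hW
  have hWt : ∀ X, (W.mat *ᵥ X) (Sum.inr 0) = X (Sum.inr 0) := fun X =>
    (embed_mulVec w X (Sum.inr 0)).trans (hwt _)
  have hW0 : ∀ X, (W.mat *ᵥ X) (Sum.inl 0) = -X (Sum.inl 0) := fun X =>
    (embed_mulVec w X (Sum.inl 0)).trans (hw0 _)
  have hWi : W⁻¹.mat = W.mat := by
    rw [hW, ← map_inv]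
    change extendMatrix (d + 1) w⁻¹.mat = extendMatrix (d + 1) w.mat
    rw [hw]
  obtain ⟨u₁, hu₁, hD₁⟩ := exists_realizes_contDiff (μ := μ) (j := j)
    (contDiff_smoothVec (μ := μ) (contDiff_northPart ε hφ)) (hasCompactSupport_northPart hε φ)
  obtain ⟨u₂, hu₂, hD₂⟩ := exists_realizes_contDiff (μ := μ) (j := j)
    (contDiff_smoothVec (μ := μ) (contDiff_rotate W.mat (contDiff_southPart ε hφ)))
    (hasCompactSupport_rotate_southPart hW0 hε hε' φ)
  refine ⟨u₁ + compRep (d + 1) μ W u₂, (hu₁.add (hu₂.compRep W)).congr ?_, _,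
    by rw [map_add, juhlExtension_compRep]; exact hD₁.add (hD₂.compRep w), ?_⟩
  · filter_upwards [ae_conformalScale_ne_zero W⁻¹] with x hx
    rw [principalAction_smoothVec (by rw [hWi]; exact hWt) (southPart ε φ) hx, smoothVec, smoothVec,
      smoothVec, ← mul_add, northPart_add_southPart]
  · filter_upwards [ae_conformalScale_ne_zero w⁻¹] with y hy hyε
    have e1 : juhlOperator d μ j (smoothVec μ φ) y
        = juhlOperator d μ j (smoothVec μ (northPart ε φ)) y := by
      refine juhlOperator_congr ?_
      have hopen : ∀ᶠ x : E (d + 1) in nhds (hyperplaneIncl y), 2 * ε < 2 / (1 + ‖x‖ ^ 2) := by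
        refine ContinuousAt.eventually_lt continuousAt_const ?_ ?_
        · exact continuousAt_const.div (by fun_prop) (by positivity)
        · simpa only [norm_hyperplaneIncl] using hyε
      filter_upwards [hopen] with x hx using (smoothVec_northPart_eq hε φ hx.le).symm
    have e2 : juhlOperator d μ j (smoothVec μ (rotate W.mat (southPart ε φ)))
        (conformalMap w⁻¹.mat y) = 0 := by
      rw [← juhlOperator_zero (μ := μ) (j := j) (conformalMap w⁻¹.mat y)]
      refine juhlOperator_congr ?_
      -- The half turn changes the sign of the polar coordinate `2/(1+|y|²) - 1`; hence the image of
      -- `y` lies where the turned south part vanishes.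
      have hz : 2 / (1 + ‖conformalMap w⁻¹.mat y‖ ^ 2) = 2 - 2 / (1 + ‖y‖ ^ 2) := by
        have h3 := congrFun (smul_lightVector_of_time (R := w⁻¹) (by rw [hw]; exact hwt) hy)
          (Sum.inl 0)
        rw [hw, hw0, ← hw] at h3
        simp only [Pi.smul_apply, smul_eq_mul, ← div_eq_inv_mul, lightVector_div_time] at h3
        linarith
      have hopen : ∀ᶠ x : E (d + 1) in nhds (hyperplaneIncl (conformalMap w⁻¹.mat y)),
          2 / (1 + ‖x‖ ^ 2) < 2 - 2 * ε := by
        refine ContinuousAt.eventually_lt ?_ continuousAt_const ?_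
        · exact continuousAt_const.div (by fun_prop) (by positivity)
        · rw [norm_hyperplaneIncl, hz]; linarith
      filter_upwards [hopen] with x hx using smoothVec_rotate_southPart_eq_zero hW0 hε φ hx.le
    rw [principalAction, e2, mul_zero, add_zero, e1]

/-- Let the cutoff `ε = 1/(m+2)` tend to zero. The element realizing the smooth vector is unique, so
it does not depend on `m`, and the functions realizing its image agree almost everywhere. Each `y`
is covered as soon as `m > |y|²`. -/
theorem exists_realizes_smoothVec {φ : (Fin (d + 2) → ℝ) → ℂ} (hφ : ContDiff ℝ ∞ φ) :
    ∃ u : CompSeries (d + 1) μ, Realizes u (smoothVec μ φ) ∧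
      Realizes (juhlExtension d μ j u) (juhlOperator d μ j (smoothVec μ φ)) := by
  have h : ∀ m : ℕ, ∃ u : CompSeries (d + 1) μ, Realizes u (smoothVec μ φ) ∧
      ∃ G : E d → ℂ, Realizes (juhlExtension d μ j u) G ∧
        ∀ᵐ y, 2 * (1 / ((m : ℝ) + 2)) < 2 / (1 + ‖y‖ ^ 2) →
          G y = juhlOperator d μ j (smoothVec μ φ) y := fun m =>
    exists_realizes_smoothVec_away_from_pole hφ (by positivity) (by gcongr; linarith [m.cast_nonneg (α := ℝ)])
  choose u hu G hG hGe using h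
  refine ⟨u 0, hu 0, (hG 0).congr ?_⟩
  have hG' : ∀ m, G 0 =ᵐ[volume] G m := fun m => by
    have := (hu 0).unique_left (hu m) (Filter.EventuallyEq.refl _ _)
    exact (hG 0).unique_right (by rw [this]; exact hG m)
  filter_upwards [ae_all_iff.2 hG', ae_all_iff.2 hGe] with y h1 h2
  obtain ⟨m, hm⟩ := exists_nat_gt (‖y‖ ^ 2)
  rw [h1 m]
  refine h2 m ?_
  rw [mul_one_div]
  exact div_lt_div_of_pos_left two_pos (by positivity) (by linarith)

end SmoothVectors

end Branching
end

/-- Here `n = d + 2`, so that `ℝ^{n-1} = ℝ^{d+1}`, `ℝ^{n-2} = ℝ^d`, `H = SO₀(d + 2, 1)` and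
`H₁ = SO₀(d + 1, 1)`. -/
theorem theorem6p2 (n d : ℕ) (hn : 2 < n) (hd : n = d + 2) (μ : ℝ) (j : ℕ)
    (hμ₀ : 0 < μ) (hμ : μ < ((n : ℝ) - 1) / 2) (hμj : μ + j < ((n : ℝ) - 2) / 2) :
    ∃ (π : Branching.SO₀ (d + 2) →*
          (Branching.CompSeries (d + 1) μ ≃ₗᵢ[ℂ] Branching.CompSeries (d + 1) μ))
      (π₁ : Branching.SO₀ (d + 1) →*
          (Branching.CompSeries d (μ + j) ≃ₗᵢ[ℂ] Branching.CompSeries d (μ + j)))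
      (D : Branching.CompSeries (d + 1) μ →L[ℂ] Branching.CompSeries d (μ + j)),
      Branching.IsComplementarySeries (d + 1) μ π ∧
      Branching.IsComplementarySeries d (μ + j) π₁ ∧
      (∀ f, Branching.IsSmoothVector (d + 1) μ f →
        ∃ u, Branching.Realizes u f ∧ Branching.Realizes (D u) (Branching.juhlOperator d μ j f)) ∧
      D ≠ 0 ∧
      Function.Surjective D ∧
      (∀ h u, D (π (Branching.embedSO₀ (d + 1) h) u) = π₁ h (D u)) ∧
      ∃ T : Branching.CompSeries d (μ + j) →ₗᵢ[ℂ] Branching.CompSeries (d + 1) μ,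
        ∀ h v, T (π₁ h v) = π (Branching.embedSO₀ (d + 1) h) (T v) := by
  subst hd
  have : Branching.ComplementaryRange (d + 1) μ := ⟨hμ₀, by push_cast at hμ ⊢; linarith⟩
  have : Branching.ComplementaryRange d (μ + j) := ⟨by positivity, by push_cast at hμj; linarith⟩
  refine ⟨Branching.compRep (d + 1) μ, Branching.compRep d (μ + j),
    Branching.juhlExtension d μ j, Branching.isComplementarySeries_compRep,
    Branching.isComplementarySeries_compRep, ?_, Branching.juhlExtension_ne_zero,
    Branching.juhlExtension_surjective, Branching.juhlExtension_compRep,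
    Branching.branchIsometry d μ j, Branching.branchIsometry_compRep⟩
  rintro f ⟨φ, hφ, hf⟩
  obtain rfl : f = Branching.smoothVec μ φ := funext hf
  exact Branching.exists_realizes_smoothVec hφ
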